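/- Let $s,t>1$ be coprime integers. Partitions are identified with their Young diagrams; $|\lambda|$ is the size and $\lambda'$ the conjugate of a partition $\lambda=(\lambda_1\ge\lambda_2\ge\dots)$, and $\lambda$ is self-conjugate if $\lambda'=\lambda$. The rim of $\lambda$ is the set of nodes $(r,c)$ of $\lambda$ such that $(r+1,c+1)$ is not a node of $\lambda$; a rim $s$-hook is a connected set of $s$ nodes of the rim whose removal leaves a Young diagram. An $s$-core is a partition with no rim $s$-hook; $\operatorname{cor}_s(\lambda)$ is the $s$-core obtained from $\lambda$ by repeatedly removing rim $s$-hooks until none remain, and $\operatorname{wei}_s(\lambda)$ is the number of rim $s$-hooks removed. The beta-set of $\lambda$ is $\mathcal B(\lambda)=\{\lambda_r-r : r\ge1\}\subset\mathbb Z$. For $b\in\mathbb Z$ write $\overline b=-1-b$. Let $\kappa_{s,t}$ be the unique largest partition that is both an $s$-core and a $t$-core. For partitions $\alpha,\beta$: - $\alpha\stackrel{s,t}{\rightharpoondown}\beta$ means that there is $b\in\mathcal B(\beta)\setminus\mathcal B(\alpha)$ with $\overline b-b\equiv t\pmod{2s}$ and $\mathcal B(\alpha)=(\mathcal B(\beta)\setminus\{b\})\cup\{\overline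 b\}$; - $\alpha\stackrel{s,t}{\leftrightharpoons}\beta$ means that there are distinct $b,c\in\mathcal B(\beta)\setminus\mathcal B(\alpha)$ with $\overline b-b\equiv t\pmod{2s}$, $\overline c-c\equiv-s\pmod{2t}$ and $\mathcal B(\alpha)=(\mathcal B(\beta)\setminus\{b,c\})\cup\{\overline b,\overline c\}$; in this case $\alpha\star\beta$ denotes the partition with beta-set $(\mathcal B(\beta)\setminus\{c\})\cup\{\overline c\}$. **Theorem.** Let $\sigma$ be an $s$-core, $\tau$ a $t$-core and $n\ge0$ an integer, and let $\mathcal P_{\sigma,\tau}(n)$ be the set of partitions of $n$ with $s$-core $\sigma$ and $t$-core $\tau$. Then $\mathcal P_{\sigma,\tau}(n)$ contains a unique self-conjugate partition if and only if $\sigma=\sigma'$, $\tau=\tau'$ and one of the following occurs. 1. $\operatorname{cor}_t(\sigma)=\operatorname{cor}_s(\tau)$ and $n=|\sigma|+|\tau|-|\operatorname{cor}_t(\sigma)|$. 2. $t$ is odd, $\operatorname{cor}_t(\sigma)\stackrel{s,t}{\rightharpoondown}\operatorname{cor}_s(\tau)$ and $n=|\tau|+t(\operatorname{wei}_t(\sigma)+1)$.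 3. $s$ is odd, $\operatorname{cor}_s(\tau)\stackrel{t,s}{\rightharpoondown}\operatorname{cor}_t(\sigma)$ and $n=|\sigma|+s(\operatorname{wei}_s(\tau)+1)$. 4. $s$ and $t$ are both odd, $\operatorname{cor}_t(\sigma)\stackrel{s,t}{\leftrightharpoons}\operatorname{cor}_s(\tau)$ and $n=|\operatorname{cor}_t(\sigma)\star\operatorname{cor}_s(\tau)|+s(\operatorname{wei}_s(\tau)+1)+t(\operatorname{wei}_t(\sigma)+1)$. 5. $s$ and $t$ are both odd, $\operatorname{cor}_t(\sigma)=\operatorname{cor}_s(\tau)=\kappa_{s,t}$ and $n=|\sigma|+|\tau|-|\kappa_{s,t}|+st$. -/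

import Mathlib

/-! Partitions are Mathlib's `YoungDiagram`s (English convention, rows and columns indexed from `0`);
the size is `YoungDiagram.card` and the conjugate partition is `YoungDiagram.transpose`. -/

namespace CorePartitions

/-- The beta-set `{λ_r - r : r ≥ 1}`; here `r = i + 1`, as rows of Young diagrams are
indexed from `0`. -/
def betaSet (μ : YoungDiagram) : Set ℤ :=
  {x | ∃ i : ℕ, x = (μ.rowLen i : ℤ) - ((i : ℤ) + 1)}

/-- The rim: the nodes `(r, c)` such that `(r + 1, c + 1)` is not a node. -/
def rim (μ : YoungDiagram) : Finset (ℕ × ℕ) :=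
  μ.cells.filter fun c => (c.1 + 1, c.2 + 1) ∉ μ

/-- `H` is a rim `s`-hook of `μ`: a connected set of `s` nodes of the rim whose removal leaves a
Young diagram. Nodes are adjacent when they share an edge, which is adjacency in the Hasse diagram
of `ℕ × ℕ`; connected graphs are non-empty, so there is no rim `0`-hook. -/
structure IsRimHook (s : ℕ) (μ : YoungDiagram) (H : Finset (ℕ × ℕ)) : Prop where
  subset_rim : H ⊆ rim μ
  card_eq : H.card = s
  connected : ((SimpleGraph.hasse (ℕ × ℕ)).induce (H : Set (ℕ × ℕ))).Connected
  isLowerSet : IsLowerSet ((μ.cells \ H : Finset (ℕ × ℕ)) : Set (ℕ × ℕ))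

/-- The partition left after removing a rim hook. -/
def removeHook {s : ℕ} {μ : YoungDiagram} {H : Finset (ℕ × ℕ)} (h : IsRimHook s μ H) :
    YoungDiagram :=
  ⟨μ.cells \ H, h.isLowerSet⟩

theorem card_removeHook_lt {s : ℕ} {μ : YoungDiagram} {H : Finset (ℕ × ℕ)}
    (h : IsRimHook s μ H) : (removeHook h).card < μ.card := by
  obtain ⟨⟨x, hx⟩⟩ := h.connected.nonempty
  have hx' : x ∈ H := hx
  have hxμ : x ∈ μ.cells := (Finset.mem_filter.mp (h.subset_rim hx')).1
  refine Finset.card_lt_card ⟨Finset.sdiff_subset, fun hs => ?_⟩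
  exact (Finset.mem_sdiff.mp (hs hxμ)).2 hx'

/-- An `s`-core is a partition with no rim `s`-hooks. -/
def IsCore (s : ℕ) (μ : YoungDiagram) : Prop :=
  ∀ H : Finset (ℕ × ℕ), ¬ IsRimHook s μ H

open Classical in
/-- The `s`-core of a partition: remove rim `s`-hooks, chosen arbitrarily, until none remain. -/
noncomputable def core (s : ℕ) (μ : YoungDiagram) : YoungDiagram :=
  if h : ∃ H : Finset (ℕ × ℕ), IsRimHook s μ H then core s (removeHook h.choose_spec) else μ
termination_by μ.card
decreasing_by exact card_removeHook_lt _

open Classical in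
/-- The `s`-weight of a partition: the number of rim `s`-hooks removed to reach the `s`-core. -/
noncomputable def weight (s : ℕ) (μ : YoungDiagram) : ℕ :=
  if h : ∃ H : Finset (ℕ × ℕ), IsRimHook s μ H then weight s (removeHook h.choose_spec) + 1 else 0
termination_by μ.card
decreasing_by exact card_removeHook_lt _

/-- The set of partitions of `n` with `s`-core `σ` and `t`-core `τ`. -/
def partitionsWithCores (s t n : ℕ) (σ τ : YoungDiagram) : Set YoungDiagram :=
  {μ | μ.card = n ∧ core s μ = σ ∧ core t μ = τ}

/-- `μ` is self-conjugate. -/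
def SelfConjugate (μ : YoungDiagram) : Prop :=
  μ.transpose = μ

/-- The reflection `b ↦ -1 - b` of the integers. -/
def bar (b : ℤ) : ℤ := -1 - b

/-- The relation `σ ⇀ τ` with superscript `s, t`: the beta-set of `σ` is obtained from that of `τ`
by replacing one element `b` with `bar b`, where `bar b - b ≡ t` modulo `2s`. -/
def SingleFlip (s t : ℕ) (σ τ : YoungDiagram) : Prop :=
  ∃ b ∈ betaSet τ \ betaSet σ,
    bar b - b ≡ (t : ℤ) [ZMOD 2 * (s : ℤ)] ∧
    betaSet σ = (betaSet τ \ {b}) ∪ {bar b}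

/-- The relation `σ ⇌ τ` with superscript `s, t`, witnessed by the integers `b` and `c`: the
beta-set of `σ` is obtained from that of `τ` by replacing `b, c` with `bar b, bar c`, where
`bar b - b ≡ t` modulo `2s` and `bar c - c ≡ -s` modulo `2t`. -/
structure DoubleFlipAt (s t : ℕ) (σ τ : YoungDiagram) (b c : ℤ) : Prop where
  ne : b ≠ c
  left_mem : b ∈ betaSet τ \ betaSet σ
  right_mem : c ∈ betaSet τ \ betaSet σ
  left_modEq : bar b - b ≡ (t : ℤ) [ZMOD 2 * (s : ℤ)]
  right_modEq : bar c - c ≡ -(s : ℤ) [ZMOD 2 * (t : ℤ)]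
  betaSet_eq : betaSet σ = (betaSet τ \ {b, c}) ∪ {bar b, bar c}

/-- `σ ⇌ τ` holds, and `υ` is the partition `σ ⋆ τ`, whose beta-set is obtained from that of `τ`
by replacing `c` with `bar c`. -/
def DoubleFlip (s t : ℕ) (σ τ υ : YoungDiagram) : Prop :=
  ∃ b c : ℤ, DoubleFlipAt s t σ τ b c ∧ betaSet υ = (betaSet τ \ {c}) ∪ {bar c}

/-- `κ` is the unique largest partition that is both an `s`-core and a `t`-core. -/
structure IsLargestCore (s t : ℕ) (κ : YoungDiagram) : Prop where
  left_core : IsCore s κ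
  right_core : IsCore t κ
  card_lt : ∀ μ : YoungDiagram, IsCore s μ → IsCore t μ → μ ≠ κ → μ.card < κ.card

end CorePartitions

namespace CorePartitions

open Function

section Pairing

open Classical in
/-- The indicator function of a set of integers. -/
noncomputable def ind (A : Set ℤ) (k : ℤ) : ℤ := if k ∈ A then 1 else 0

theorem ind_of_mem {A : Set ℤ} {k : ℤ} (h : k ∈ A) : ind A k = 1 := by simp [ind, h]

theorem ind_of_notMem {A : Set ℤ} {k : ℤ} (h : k ∉ A) : ind A k = 0 := by simp [ind, h]

theorem ind_nonneg (A : Set ℤ) (k : ℤ) : 0 ≤ ind A k := by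
  unfold ind; split_ifs <;> simp

theorem ind_le_one (A : Set ℤ) (k : ℤ) : ind A k ≤ 1 := by
  unfold ind; split_ifs <;> simp

theorem ind_le_ind {A B : Set ℤ} {k l : ℤ} (h : k ∈ A → l ∈ B) : ind A k ≤ ind B l := by
  by_cases hk : k ∈ A
  · rw [ind_of_mem hk, ind_of_mem (h hk)]
  · rw [ind_of_notMem hk]; exact ind_nonneg _ _

theorem ind_eq_one_iff {A : Set ℤ} {k : ℤ} : ind A k = 1 ↔ k ∈ A := by
  unfold ind; split_ifs with h <;> simp [h]

theorem eq_of_ind_eq {A B : Set ℤ} (h : ∀ k, ind A k = ind B k) : A = B := by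
  ext k; rw [← ind_eq_one_iff, ← ind_eq_one_iff, h]

/-- A set of integers which agrees with the negative integers outside a bounded interval. -/
def IsMaya (A : Set ℤ) : Prop := ∃ N : ℤ, (∀ k < -N, k ∈ A) ∧ ∀ k, N ≤ k → k ∉ A

/-- The integral of `f` against the difference of two indicator functions. -/
noncomputable def dif (A B : Set ℤ) (f : ℤ → ℤ) : ℤ := ∑ᶠ k, (ind A k - ind B k) * f k

theorem IsMaya.mono {A : Set ℤ} {N M : ℤ} (h : (∀ k < -N, k ∈ A) ∧ ∀ k, N ≤ k → k ∉ A)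
    (hNM : N ≤ M) : (∀ k < -M, k ∈ A) ∧ ∀ k, M ≤ k → k ∉ A :=
  ⟨fun k hk => h.1 k (by omega), fun k hk => h.2 k (by omega)⟩

theorem IsMaya.exists_common {A B : Set ℤ} (hA : IsMaya A) (hB : IsMaya B) :
    ∃ N : ℤ, ((∀ k < -N, k ∈ A) ∧ ∀ k, N ≤ k → k ∉ A) ∧
      ((∀ k < -N, k ∈ B) ∧ ∀ k, N ≤ k → k ∉ B) := by
  obtain ⟨N, hN⟩ := hA
  obtain ⟨M, hM⟩ := hB
  exact ⟨max N M, IsMaya.mono hN (le_max_left _ _), IsMaya.mono hM (le_max_right _ _)⟩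

theorem ind_sub_ind_eq_zero {A B : Set ℤ} {N : ℤ} (hA : (∀ k < -N, k ∈ A) ∧ ∀ k, N ≤ k → k ∉ A)
    (hB : (∀ k < -N, k ∈ B) ∧ ∀ k, N ≤ k → k ∉ B) {k : ℤ} (hk : k ∉ Finset.Ico (-N) N) :
    ind A k - ind B k = 0 := by
  rw [Finset.mem_Ico, not_and_or] at hk
  rcases hk with hk | hk
  · rw [ind_of_mem (hA.1 k (by omega)), ind_of_mem (hB.1 k (by omega)), sub_self]
  · rw [ind_of_notMem (hA.2 k (by omega)), ind_of_notMem (hB.2 k (by omega)), sub_self]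

theorem IsMaya.support_finite {A B : Set ℤ} (hA : IsMaya A) (hB : IsMaya B) :
    (support fun k => ind A k - ind B k).Finite := by
  obtain ⟨N, h1, h2⟩ := hA.exists_common hB
  refine (Finset.finite_toSet (Finset.Ico (-N) N)).subset fun k hk => ?_
  by_contra hk'
  exact hk (ind_sub_ind_eq_zero h1 h2 (by simpa using hk'))

theorem IsMaya.support_mul_finite {A B : Set ℤ} (hA : IsMaya A) (hB : IsMaya B) (f : ℤ → ℤ) :
    (support fun k => (ind A k - ind B k) * f k).Finite :=
  (hA.support_finite hB).subset fun k hk => by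
    intro h0; exact hk (by simp only [h0, zero_mul])

theorem dif_eq_sum {A B : Set ℤ} {N : ℤ} (hA : (∀ k < -N, k ∈ A) ∧ ∀ k, N ≤ k → k ∉ A)
    (hB : (∀ k < -N, k ∈ B) ∧ ∀ k, N ≤ k → k ∉ B) (f : ℤ → ℤ) :
    dif A B f = ∑ k ∈ Finset.Ico (-N) N, (ind A k - ind B k) * f k := by
  refine finsum_eq_sum_of_support_subset _ fun k hk => ?_
  by_contra hk'
  exact hk (by simp only [ind_sub_ind_eq_zero hA hB (by simpa using hk'), zero_mul])

theorem dif_self (A : Set ℤ) (f : ℤ → ℤ) : dif A A f = 0 := by simp [dif]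

theorem dif_comm (A B : Set ℤ) (f : ℤ → ℤ) : dif B A f = -dif A B f := by
  unfold dif
  rw [← finsum_neg_distrib]
  exact finsum_congr fun k => by ring

theorem dif_add_dif {A B C : Set ℤ} (hA : IsMaya A) (hB : IsMaya B) (hC : IsMaya C)
    (f : ℤ → ℤ) : dif A B f + dif B C f = dif A C f := by
  unfold dif
  rw [← finsum_add_distrib (hA.support_mul_finite hB f) (hB.support_mul_finite hC f)]
  exact finsum_congr fun k => by ring

theorem dif_add {A B : Set ℤ} (hA : IsMaya A) (hB : IsMaya B) (f g : ℤ → ℤ) :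
    dif A B (fun k => f k + g k) = dif A B f + dif A B g := by
  unfold dif
  rw [← finsum_add_distrib (hA.support_mul_finite hB f) (hA.support_mul_finite hB g)]
  exact finsum_congr fun k => by ring

theorem dif_sub {A B : Set ℤ} (hA : IsMaya A) (hB : IsMaya B) (f g : ℤ → ℤ) :
    dif A B (fun k => f k - g k) = dif A B f - dif A B g := by
  unfold dif
  rw [← finsum_sub_distrib (hA.support_mul_finite hB f) (hA.support_mul_finite hB g)]
  exact finsum_congr fun k => by ring

theorem dif_const_mul (A B : Set ℤ) (c : ℤ) (f : ℤ → ℤ) :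
    dif A B (fun k => c * f k) = c * dif A B f := by
  unfold dif
  rw [mul_finsum]
  exact finsum_congr fun k => by ring

theorem dif_congr {A B : Set ℤ} {f g : ℤ → ℤ} (h : ∀ k, f k = g k) : dif A B f = dif A B g := by
  rw [funext h]

/-- If the integrand is nonnegative and positive somewhere, so is the integral. -/
theorem finsum_pos_of_support_finite {φ : ℤ → ℤ} (hφ : (support φ).Finite) (h0 : ∀ k, 0 ≤ φ k)
    {x : ℤ} (hx : 0 < φ x) : 0 < ∑ᶠ k, φ k := by
  rw [finsum_eq_sum _ hφ]
  refine Finset.sum_pos' (fun k _ => h0 k) ⟨x, ?_, hx⟩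
  simpa using hx.ne'

/-- Replacing finitely many elements. -/
theorem dif_sdiff_union {A : Set ℤ} (F G : Finset ℤ) (hF : ∀ k ∈ F, k ∈ A) (hG : ∀ k ∈ G, k ∉ A)
    (f : ℤ → ℤ) : dif ((A \ F) ∪ G) A f = ∑ k ∈ G, f k - ∑ k ∈ F, f k := by
  classical
  have hdis : Disjoint F G := Finset.disjoint_left.2 fun k h1 h2 => hG k h2 (hF k h1)
  unfold dif
  rw [finsum_eq_sum_of_support_subset (s := F ∪ G)]
  · rw [Finset.sum_union hdis, sub_eq_add_neg, add_comm, ← Finset.sum_neg_distrib]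
    congr 1
    · refine Finset.sum_congr rfl fun k hk => ?_
      rw [ind_of_mem (Or.inr hk), ind_of_notMem (hG k hk)]; ring
    · refine Finset.sum_congr rfl fun k hk => ?_
      rw [ind_of_notMem, ind_of_mem (hF k hk)]
      · ring
      · rintro (h | h)
        · exact h.2 hk
        · exact hG k h (hF k hk)
  · intro k hk
    by_contra hk'
    simp only [Finset.coe_union, Set.mem_union, Finset.mem_coe, not_or] at hk'
    apply hk
    have : ind ((A \ F) ∪ G) k = ind A k := by
      unfold ind
      simp [hk'.1, hk'.2]
    simp only [this, sub_self, zero_mul]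

theorem IsMaya.sdiff_union {A : Set ℤ} (hA : IsMaya A) (F G : Finset ℤ) :
    IsMaya ((A \ F) ∪ G) := by
  obtain ⟨N, h1, h2⟩ := hA
  obtain ⟨a, ha⟩ := (F ∪ G).bddAbove
  obtain ⟨b, hb⟩ := (F ∪ G).bddBelow
  have hmem : ∀ k, k ∈ F ∨ k ∈ G → b ≤ k ∧ k ≤ a := fun k hk =>
    ⟨hb (by simpa using hk), ha (by simpa using hk)⟩
  refine ⟨max N (max (a + 1) (-b)), fun k hk => Or.inl ⟨h1 k (by omega), fun hF => ?_⟩,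
    fun k hk => ?_⟩
  · have := hmem k (Or.inl hF); omega
  · rintro (h | h)
    · exact h2 k (by omega) h.1
    · have := hmem k (Or.inr h); omega

theorem apply_eq_of_dvd_sub {t : ℤ} {u : ℤ → ℤ} (hu : ∀ k, u (k + t) = u k) {k l : ℤ}
    (h : t ∣ k - l) : u k = u l := by
  obtain ⟨m, hm⟩ := h
  have := (show Periodic u t from hu).int_mul m l
  rw [← this]
  congr 1
  simp only [Int.cast_id]
  linarith

/-- Equal `s`-charges: all `s`-periodic functions have the same integral. -/
def SameCharge (s : ℤ) (A B : Set ℤ) : Prop := ∀ u : ℤ → ℤ, (∀ k, u (k + s) = u k) → dif A B u = 0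

theorem SameCharge.refl (s : ℤ) (A : Set ℤ) : SameCharge s A A := fun u _ => dif_self A u

theorem SameCharge.symm {s : ℤ} {A B : Set ℤ} (h : SameCharge s A B) : SameCharge s B A :=
  fun u hu => by rw [dif_comm, h u hu, neg_zero]

theorem SameCharge.trans {s : ℤ} {A B C : Set ℤ} (hA : IsMaya A) (hB : IsMaya B) (hC : IsMaya C)
    (h : SameCharge s A B) (h' : SameCharge s B C) : SameCharge s A C := fun u hu => by
  rw [← dif_add_dif hA hB hC, h u hu, h' u hu, add_zero]

/-- The set is closed under subtracting `s`. -/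
def CoreSet (s : ℤ) (A : Set ℤ) : Prop := ∀ k ∈ A, k - s ∈ A

theorem CoreSet.sub_mul_mem {s : ℤ} {A : Set ℤ} (h : CoreSet s A) {k : ℤ} (hk : k ∈ A) (n : ℕ) :
    k - n * s ∈ A := by
  induction n with
  | zero => simpa using hk
  | succ n ih =>
    have := h _ ih
    rwa [show k - ((n + 1 : ℕ) : ℤ) * s = k - n * s - s by push_cast; ring]

theorem CoreSet.mem_of_le {s : ℤ} (hs : 0 < s) {A : Set ℤ} (h : CoreSet s A) {k l : ℤ}
    (hk : k ∈ A) (hlk : l ≤ k) (hd : s ∣ k - l) : l ∈ A := by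
  obtain ⟨c, hc⟩ := hd
  have hc0 : 0 ≤ c := by
    by_contra hneg
    nlinarith
  have := h.sub_mul_mem hk c.toNat
  rw [Int.toNat_of_nonneg hc0] at this
  rwa [show l = k - c * s by linarith]

theorem CoreSet.lt_of_mem_of_notMem {s : ℤ} (hs : 0 < s) {A : Set ℤ} (h : CoreSet s A) {k l : ℤ}
    (hk : k ∈ A) (hl : l ∉ A) (hd : s ∣ k - l) : k < l := by
  by_contra hlk
  exact hl (h.mem_of_le hs hk (not_lt.1 hlk) hd)

theorem dvd_add_right_self_sub {s k x : ℤ} : s ∣ k + s - x ↔ s ∣ k - x := by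
  rw [show k + s - x = k - x + s by ring, dvd_add_self_right]

open Classical in
/-- The indicator function of a residue class. -/
noncomputable def cls (s x : ℤ) (k : ℤ) : ℤ := if s ∣ k - x then 1 else 0

theorem cls_periodic (s x k : ℤ) : cls s x (k + s) = cls s x k := by
  unfold cls; simp only [dvd_add_right_self_sub]

theorem cls_nonneg (s x k : ℤ) : 0 ≤ cls s x k := by
  unfold cls; split_ifs <;> simp

theorem cls_of_dvd {s x k : ℤ} (h : s ∣ k - x) : cls s x k = 1 := by simp [cls, h]

theorem cls_of_not_dvd {s x k : ℤ} (h : ¬ s ∣ k - x) : cls s x k = 0 := by simp [cls, h]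

theorem CoreSet.subset_of_sameCharge {s : ℤ} (hs : 0 < s) {A B : Set ℤ} (mA : IsMaya A)
    (mB : IsMaya B) (hA : CoreSet s A) (hB : CoreSet s B) (h : SameCharge s A B) : A ⊆ B := by
  intro x hx
  by_contra hxB
  have h0 := h (cls s x) (cls_periodic s x)
  refine (finsum_pos_of_support_finite (x := x) (mA.support_mul_finite mB (cls s x)) ?_ ?_).ne' h0
  · intro k
    by_cases hk : s ∣ k - x
    · rw [cls_of_dvd hk, mul_one, sub_nonneg]
      refine ind_le_ind fun hkB => ?_
      have := hB.lt_of_mem_of_notMem hs hkB hxB hk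
      exact hA.mem_of_le hs hx this.le (by rw [← neg_sub, dvd_neg]; exact hk)
    · rw [cls_of_not_dvd hk, mul_zero]
  · rw [ind_of_mem hx, ind_of_notMem hxB, cls_of_dvd (by simp)]; norm_num

/-- A core is determined by its charges. -/
theorem CoreSet.eq_of_sameCharge {s : ℤ} (hs : 0 < s) {A B : Set ℤ} (mA : IsMaya A)
    (mB : IsMaya B) (hA : CoreSet s A) (hB : CoreSet s B) (h : SameCharge s A B) : A = B :=
  (hA.subset_of_sameCharge hs mA mB hB h).antisymm (hB.subset_of_sameCharge hs mB mA hA h.symm)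

/-- The energy of a set, normalised so that the negative integers have energy `0`. -/
noncomputable def energy (A : Set ℤ) : ℤ := dif A (Set.Iio 0) fun k => k

theorem isMaya_Iio : IsMaya (Set.Iio (0 : ℤ)) :=
  ⟨0, fun k hk => by simpa using hk, fun k hk => by simpa using hk⟩

theorem energy_sub_energy {A B : Set ℤ} (hA : IsMaya A) (hB : IsMaya B) :
    energy A - energy B = dif A B fun k => k := by
  unfold energy
  rw [← dif_add_dif hA hB isMaya_Iio]
  ring

theorem ind_preimage (A : Set ℤ) (e : ℤ → ℤ) (k : ℤ) : ind (e ⁻¹' A) k = ind A (e k) := rfl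

/-- Shifting the integrand. -/
theorem dif_comp_equiv (A B : Set ℤ) (e : ℤ ≃ ℤ) (f : ℤ → ℤ) :
    dif (e ⁻¹' A) (e ⁻¹' B) f = dif A B (fun k => f (e.symm k)) := by
  unfold dif
  rw [← finsum_comp_equiv e.symm]
  refine finsum_congr fun k => ?_
  rw [ind_preimage, ind_preimage, Equiv.apply_symm_apply]

end Pairing

section Diagonals

theorem exists_diag_notMem (μ : YoungDiagram) (k : ℤ) :
    ∃ n : ℕ, (n + (-k).toNat, n + k.toNat) ∉ μ := by
  obtain ⟨j, hj⟩ := μ.exists_notMem_row 0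
  exact ⟨j, fun h => hj (μ.up_left_mem (Nat.zero_le _) (Nat.le_add_right _ _) h)⟩

/-- The number of nodes `(i, j)` with `j - i = k`. -/
noncomputable def diagLen (μ : YoungDiagram) (k : ℤ) : ℕ := by
  classical exact Nat.find (exists_diag_notMem μ k)

theorem diag_mem_iff {μ : YoungDiagram} {k : ℤ} {n : ℕ} :
    (n + (-k).toNat, n + k.toNat) ∈ μ ↔ n < diagLen μ k := by
  classical
  unfold diagLen
  rw [Nat.lt_find_iff]
  refine ⟨fun h m hm => not_not.2 (μ.up_left_mem (by omega) (by omega) h), fun h => ?_⟩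
  simpa using h n le_rfl

theorem mem_iff_min_lt {μ : YoungDiagram} {i j : ℕ} :
    (i, j) ∈ μ ↔ min i j < diagLen μ ((j : ℤ) - i) := by
  rw [← diag_mem_iff]
  have h1 : min i j + (-((j : ℤ) - i)).toNat = i := by omega
  have h2 : min i j + ((j : ℤ) - i).toNat = j := by omega
  rw [h1, h2]

theorem eq_of_diagLen_eq {μ ν : YoungDiagram} (h : ∀ k, diagLen μ k = diagLen ν k) : μ = ν := by
  refine SetLike.ext fun c => ?_
  obtain ⟨i, j⟩ := c
  rw [mem_iff_min_lt, mem_iff_min_lt, h]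

theorem diagLen_eq_of_forall {μ : YoungDiagram} {k : ℤ} {d : ℕ}
    (h : ∀ n : ℕ, (n + (-k).toNat, n + k.toNat) ∈ μ ↔ n < d) : diagLen μ k = d := by
  have h1 : ∀ n, n < diagLen μ k ↔ n < d := fun n => by rw [← diag_mem_iff, h]
  have := h1 d
  have := h1 (diagLen μ k)
  omega

theorem diagLen_succ_of_nonneg (μ : YoungDiagram) {k : ℤ} (hk : 0 ≤ k) :
    diagLen μ (k + 1) ≤ diagLen μ k ∧ diagLen μ k ≤ diagLen μ (k + 1) + 1 := by
  constructor
  · by_contra! hlt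
    have h1 := diag_mem_iff.2 hlt
    exact lt_irrefl _ (diag_mem_iff.1 (μ.up_left_mem (i1 := diagLen μ k + (-k).toNat)
      (j1 := diagLen μ k + k.toNat) (by omega) (by omega) h1))
  · by_contra! hlt
    have h1 := diag_mem_iff.2 hlt
    exact lt_irrefl _ (diag_mem_iff.1 (μ.up_left_mem
      (i1 := diagLen μ (k + 1) + (-(k + 1)).toNat)
      (j1 := diagLen μ (k + 1) + (k + 1).toNat) (by omega) (by omega) h1))

theorem diagLen_succ_of_neg (μ : YoungDiagram) {k : ℤ} (hk : k < 0) :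
    diagLen μ k ≤ diagLen μ (k + 1) ∧ diagLen μ (k + 1) ≤ diagLen μ k + 1 := by
  constructor
  · by_contra! hlt
    have h1 := diag_mem_iff.2 hlt
    exact lt_irrefl _ (diag_mem_iff.1 (μ.up_left_mem
      (i1 := diagLen μ (k + 1) + (-(k + 1)).toNat)
      (j1 := diagLen μ (k + 1) + (k + 1).toNat) (by omega) (by omega) h1))
  · by_contra! hlt
    have h1 := diag_mem_iff.2 hlt
    exact lt_irrefl _ (diag_mem_iff.1 (μ.up_left_mem (i1 := diagLen μ k + (-k).toNat)
      (j1 := diagLen μ k + k.toNat) (by omega) (by omega) h1))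

theorem mem_betaSet_iff {μ : YoungDiagram} {k : ℤ} :
    k ∈ betaSet μ ↔ ∃ i : ℕ, (μ.rowLen i : ℤ) = k + i + 1 := by
  constructor <;> rintro ⟨i, hi⟩ <;> exact ⟨i, by omega⟩

theorem mem_betaSet_iff_of_nonneg {μ : YoungDiagram} {k : ℤ} (hk : 0 ≤ k) :
    k ∈ betaSet μ ↔ diagLen μ k = diagLen μ (k + 1) + 1 := by
  have hstep := diagLen_succ_of_nonneg μ hk
  have key : ∀ i : ℕ, (μ.rowLen i : ℤ) = k + i + 1 ↔ i < diagLen μ k ∧ ¬ i < diagLen μ (k + 1) := by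
    intro i
    rw [← diag_mem_iff, ← diag_mem_iff, YoungDiagram.mem_iff_lt_rowLen,
      YoungDiagram.mem_iff_lt_rowLen, show i + (-k).toNat = i by omega,
      show i + (-(k + 1)).toNat = i by omega]
    omega
  rw [mem_betaSet_iff]
  constructor
  · rintro ⟨i, hi⟩
    have := (key i).1 hi
    omega
  · intro h
    exact ⟨diagLen μ (k + 1), (key _).2 (by omega)⟩

theorem mem_betaSet_iff_of_neg {μ : YoungDiagram} {k : ℤ} (hk : k < 0) :
    k ∈ betaSet μ ↔ diagLen μ k = diagLen μ (k + 1) := by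
  have hstep := diagLen_succ_of_neg μ hk
  have key : ∀ n : ℕ, (μ.rowLen (n + (-(k + 1)).toNat) : ℤ) = n ↔
      n < diagLen μ k + 1 ∧ ¬ n < diagLen μ (k + 1) := by
    intro n
    rw [← diag_mem_iff, YoungDiagram.mem_iff_lt_rowLen, show n + (k + 1).toNat = n by omega]
    rcases n with _ | m
    · simp
    · rw [Nat.add_lt_add_iff_right, ← diag_mem_iff, YoungDiagram.mem_iff_lt_rowLen,
        show m + (-k).toNat = m + 1 + (-(k + 1)).toNat by omega]
      omega
  rw [mem_betaSet_iff]
  constructor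
  · rintro ⟨i, hi⟩
    have := (key (k + i + 1).toNat).1 (by
      rw [show (k + i + 1).toNat + (-(k + 1)).toNat = i by omega]; omega)
    omega
  · intro h
    refine ⟨diagLen μ (k + 1) + (-(k + 1)).toNat, ?_⟩
    rw [(key _).2 (by omega)]
    omega

theorem ind_betaSet (μ : YoungDiagram) (k : ℤ) :
    ind (betaSet μ) k - ind (Set.Iio 0) k = (diagLen μ k : ℤ) - diagLen μ (k + 1) := by
  rcases le_or_gt 0 k with hk | hk
  · have hstep := diagLen_succ_of_nonneg μ hk
    rw [ind_of_notMem (A := Set.Iio 0) (by simpa using hk)]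
    by_cases h : k ∈ betaSet μ
    · rw [ind_of_mem h]
      have := (mem_betaSet_iff_of_nonneg hk).1 h
      omega
    · rw [ind_of_notMem h]
      rw [mem_betaSet_iff_of_nonneg hk] at h
      omega
  · have hstep := diagLen_succ_of_neg μ hk
    rw [ind_of_mem (A := Set.Iio 0) (by simpa using hk)]
    by_cases h : k ∈ betaSet μ
    · rw [ind_of_mem h]
      have := (mem_betaSet_iff_of_neg hk).1 h
      omega
    · rw [ind_of_notMem h]
      rw [mem_betaSet_iff_of_neg hk] at h
      omega

theorem exists_diagLen_eq_zero (μ : YoungDiagram) :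
    ∃ N : ℤ, 0 < N ∧ ∀ k, k ≤ -N ∨ N ≤ k → diagLen μ k = 0 := by
  refine ⟨μ.rowLen 0 + μ.colLen 0 + 1, by positivity, fun k hk => diagLen_eq_of_forall fun n => ?_⟩
  simp only [not_lt_zero, iff_false]
  intro h
  have h1 := YoungDiagram.mem_iff_lt_rowLen.1 (μ.up_left_mem (Nat.zero_le _) le_rfl h)
  have h2 := YoungDiagram.mem_iff_lt_colLen.1 (μ.up_left_mem le_rfl (Nat.zero_le _) h)
  omega

theorem diagLen_eventually_eq (μ ν : YoungDiagram)
    (h : ∀ k, (diagLen μ k : ℤ) - diagLen μ (k + 1) = (diagLen ν k : ℤ) - diagLen ν (k + 1)) :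
    μ = ν := by
  obtain ⟨N, hN, h1⟩ := exists_diagLen_eq_zero μ
  obtain ⟨M, hM, h2⟩ := exists_diagLen_eq_zero ν
  refine eq_of_diagLen_eq fun k => ?_
  have key : ∀ n : ℕ, ∀ k : ℤ, max N M - n ≤ k → diagLen μ k = diagLen ν k := by
    intro n
    induction n with
    | zero =>
      intro k hk
      rw [h1 k (by omega), h2 k (by omega)]
    | succ n ih =>
      intro k hk
      have e1 := ih (k + 1) (by push_cast at hk; omega)
      have e2 := h k
      omega
  exact key (max N M - k).toNat k (by omega)

theorem betaSet_injective : Injective betaSet := by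
  intro μ ν h
  refine diagLen_eventually_eq μ ν fun k => ?_
  rw [← ind_betaSet, ← ind_betaSet, h]

theorem isMaya_betaSet (μ : YoungDiagram) : IsMaya (betaSet μ) := by
  obtain ⟨N, hN, h⟩ := exists_diagLen_eq_zero μ
  refine ⟨N, fun k hk => ?_, fun k hk => ?_⟩
  · rw [mem_betaSet_iff_of_neg (by omega), h k (by omega), h (k + 1) (by omega)]
  · rw [mem_betaSet_iff_of_nonneg (by omega), h k (by omega), h (k + 1) (by omega)]
    omega

theorem dif_betaSet (μ : YoungDiagram) (f : ℤ → ℤ) :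
    dif (betaSet μ) (Set.Iio 0) f = ∑ᶠ k, (diagLen μ k : ℤ) * (f k - f (k - 1)) := by
  obtain ⟨N, hN, h⟩ := exists_diagLen_eq_zero μ
  have hfin : ∀ g : ℤ → ℤ, (support fun k => (diagLen μ k : ℤ) * g k).Finite := fun g => by
    refine (Set.finite_Icc (-N) N).subset fun k hk => ?_
    by_contra hk'
    rw [Set.mem_Icc, not_and_or] at hk'
    exact hk (by simp only [h k (by omega), Nat.cast_zero, zero_mul])
  have h1 : ∀ k, (diagLen μ k : ℤ) * (f k - f (k - 1)) =
      diagLen μ k * f k - diagLen μ k * f (k - 1) := fun k => by ring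
  simp_rw [h1]
  rw [finsum_sub_distrib (hfin _) (hfin _),
    ← finsum_comp_equiv (f := fun k => (diagLen μ k : ℤ) * f (k - 1)) (Equiv.addRight (1 : ℤ)),
    ← finsum_sub_distrib (hfin _)]
  · unfold dif
    refine finsum_congr fun k => ?_
    rw [ind_betaSet]
    simp only [Equiv.coe_addRight, add_sub_cancel_right]
    ring
  · refine (Set.finite_Icc (-N - 1) N).subset fun k hk => ?_
    by_contra hk'
    rw [Set.mem_Icc, not_and_or] at hk'
    exact hk (by simp only [Equiv.coe_addRight, h (k + 1) (by omega), Nat.cast_zero, zero_mul])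

theorem dif_betaSet_one (μ : YoungDiagram) : dif (betaSet μ) (Set.Iio 0) (fun _ => 1) = 0 := by
  rw [dif_betaSet]
  simp

theorem card_diag (μ : YoungDiagram) (k : ℤ) :
    (μ.cells.filter fun c => (c.2 : ℤ) - c.1 = k).card = diagLen μ k := by
  have : μ.cells.filter (fun c => (c.2 : ℤ) - c.1 = k) =
      (Finset.range (diagLen μ k)).image fun n => (n + (-k).toNat, n + k.toNat) := by
    ext ⟨i, j⟩
    simp only [Finset.mem_filter, YoungDiagram.mem_cells, Finset.mem_image, Finset.mem_range,
      Prod.mk.injEq]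
    constructor
    · rintro ⟨h1, h2⟩
      rw [mem_iff_min_lt, h2] at h1
      exact ⟨min i j, h1, by omega, by omega⟩
    · rintro ⟨n, h1, rfl, rfl⟩
      exact ⟨diag_mem_iff.2 h1, by omega⟩
  rw [this, Finset.card_image_of_injective _ (fun a b hab => by simpa using hab),
    Finset.card_range]

theorem energy_betaSet (μ : YoungDiagram) : energy (betaSet μ) = μ.card := by
  unfold energy
  rw [dif_betaSet]
  simp only [sub_sub_cancel, mul_one]
  obtain ⟨N, hN, h⟩ := exists_diagLen_eq_zero μ
  rw [finsum_eq_sum_of_support_subset (s := Finset.Icc (-N) N)]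
  · rw [YoungDiagram.card, Finset.card_eq_sum_card_fiberwise
      (f := fun c : ℕ × ℕ => (c.2 : ℤ) - c.1) (t := Finset.Icc (-N) N)]
    · push_cast
      exact Finset.sum_congr rfl fun k _ => by rw [card_diag]
    · rintro ⟨i, j⟩ hc
      simp only [Finset.coe_Icc, Set.mem_Icc]
      by_contra hk
      have hc' : (i, j) ∈ μ := by simpa using hc
      rw [mem_iff_min_lt, h _ (by omega)] at hc'
      omega
  · intro k hk
    by_contra hk'
    rw [Finset.coe_Icc, Set.mem_Icc, not_and_or] at hk'
    exact hk (by simp only [h k (by omega), Nat.cast_zero])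

theorem diagLen_transpose (μ : YoungDiagram) (k : ℤ) :
    diagLen μ.transpose k = diagLen μ (-k) := by
  refine diagLen_eq_of_forall fun n => ?_
  rw [← diag_mem_iff, YoungDiagram.mem_transpose]
  simp

theorem mem_betaSet_transpose {μ : YoungDiagram} {k : ℤ} :
    k ∈ betaSet μ.transpose ↔ -1 - k ∉ betaSet μ := by
  rcases le_or_gt 0 k with hk | hk
  · have hstep := diagLen_succ_of_neg μ (k := -1 - k) (by omega)
    rw [mem_betaSet_iff_of_nonneg hk, mem_betaSet_iff_of_neg (by omega), diagLen_transpose,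
      diagLen_transpose]
    rw [show -1 - k + 1 = -k by ring, show -1 - k = -(k + 1) by ring] at *
    omega
  · have hstep := diagLen_succ_of_nonneg μ (k := -1 - k) (by omega)
    rw [mem_betaSet_iff_of_neg hk, mem_betaSet_iff_of_nonneg (by omega), diagLen_transpose,
      diagLen_transpose]
    rw [show -1 - k + 1 = -k by ring, show -1 - k = -(k + 1) by ring] at *
    omega

end Diagonals

section Existence

/-- A function which satisfies the step conditions of diagonal lengths is the function of diagonal
lengths of a Young diagram. -/
theorem exists_diagLen_eq (D : ℤ → ℕ) (N : ℕ) (h0 : ∀ k : ℤ, k ≤ -N ∨ N ≤ k → D k = 0)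
    (h1 : ∀ k : ℤ, 0 ≤ k → D (k + 1) ≤ D k ∧ D k ≤ D (k + 1) + 1)
    (h2 : ∀ k : ℤ, k < 0 → D k ≤ D (k + 1) ∧ D (k + 1) ≤ D k + 1) :
    ∃ μ : YoungDiagram, ∀ k, diagLen μ k = D k := by
  have hbound : ∀ k : ℤ, D k ≤ N := by
    have hpos : ∀ n : ℕ, ∀ k : ℤ, 0 ≤ k → N - n ≤ k → D k ≤ n := by
      intro n
      induction n with
      | zero => intro k _ hk; rw [h0 k (by right; simpa using hk)]
      | succ n ih =>
        intro k hk0 hk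
        have := h1 k hk0
        have := ih (k + 1) (by omega) (by push_cast at hk; omega)
        omega
    have hneg : ∀ n : ℕ, ∀ k : ℤ, k ≤ 0 → k ≤ -N + n → D k ≤ n := by
      intro n
      induction n with
      | zero => intro k _ hk; rw [h0 k (by left; simpa using hk)]
      | succ n ih =>
        intro k hk0 hk
        have := h2 (k - 1) (by omega)
        have := ih (k - 1) (by omega) (by push_cast at hk; omega)
        rw [sub_add_cancel] at *
        omega
    intro k
    rcases le_total 0 k with hk | hk
    · exact hpos N k hk (by omega)
    · exact hneg N k hk (by omega)
  have hmem : ∀ i j : ℕ, min i j < D ((j : ℤ) - i) → i < 2 * N + 1 ∧ j < 2 * N + 1 := by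
    intro i j h
    have hb := hbound ((j : ℤ) - i)
    have : ¬ ((j : ℤ) - i ≤ -N ∨ N ≤ (j : ℤ) - i) := fun hk => by rw [h0 _ hk] at h; omega
    omega
  have hup : ∀ i j : ℕ, min (i + 1) j < D ((j : ℤ) - (i + 1)) → min i j < D ((j : ℤ) - i) := by
    intro i j h
    rcases le_or_gt (i + 1) j with hij | hij
    · have := h1 ((j : ℤ) - (i + 1)) (by omega)
      rw [show (j : ℤ) - (i + 1) + 1 = j - i by ring] at this
      omega
    · have := h2 ((j : ℤ) - (i + 1)) (by omega)
      rw [show (j : ℤ) - (i + 1) + 1 = j - i by ring] at this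
      omega
  have hleft : ∀ i j : ℕ, min i (j + 1) < D (((j + 1 : ℕ) : ℤ) - i) →
      min i j < D ((j : ℤ) - i) := by
    intro i j h
    rcases le_or_gt i j with hij | hij
    · have := h1 ((j : ℤ) - i) (by omega)
      rw [show (j : ℤ) - i + 1 = ((j + 1 : ℕ) : ℤ) - i by push_cast; ring] at this
      omega
    · have := h2 ((j : ℤ) - i) (by omega)
      rw [show (j : ℤ) - i + 1 = ((j + 1 : ℕ) : ℤ) - i by push_cast; ring] at this
      omega
  have hup' : ∀ (j i' d : ℕ), min (i' + d) j < D ((j : ℤ) - (i' + d : ℕ)) →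
      min i' j < D ((j : ℤ) - i') := by
    intro j i' d
    induction d with
    | zero => exact id
    | succ d ih => intro h; exact ih (hup (i' + d) j (by push_cast at h ⊢; rwa [← add_assoc (i' : ℤ)] at h))
  have hleft' : ∀ (i j' d : ℕ), min i (j' + d) < D (((j' + d : ℕ) : ℤ) - i) →
      min i j' < D ((j' : ℤ) - i) := by
    intro i j' d
    induction d with
    | zero => exact id
    | succ d ih => intro h; exact ih (hleft i (j' + d) h)
  let cells : Finset (ℕ × ℕ) := (Finset.range (2 * N + 1) ×ˢ Finset.range (2 * N + 1)).filter
    fun c => min c.1 c.2 < D ((c.2 : ℤ) - c.1)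
  have hcells : ∀ i j : ℕ, (i, j) ∈ cells ↔ min i j < D ((j : ℤ) - i) := by
    intro i j
    simp only [cells, Finset.mem_filter, Finset.mem_product, Finset.mem_range]
    exact ⟨fun h => h.2, fun h => ⟨hmem i j h, h⟩⟩
  have hlow : IsLowerSet (cells : Set (ℕ × ℕ)) := by
    rintro ⟨i, j⟩ ⟨i', j'⟩ hle h
    obtain ⟨hi, hj⟩ := Prod.mk_le_mk.1 hle
    rw [Finset.mem_coe, hcells] at h ⊢
    obtain ⟨d, rfl⟩ := Nat.exists_eq_add_of_le hi
    obtain ⟨e, rfl⟩ := Nat.exists_eq_add_of_le hj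
    exact hleft' _ _ e (hup' _ _ d h)
  refine ⟨⟨cells, hlow⟩, fun k => diagLen_eq_of_forall fun n => ?_⟩
  rw [YoungDiagram.mem_mk, hcells]
  rw [show ((n + k.toNat : ℕ) : ℤ) - (n + (-k).toNat : ℕ) = k by omega,
    show min (n + (-k).toNat) (n + k.toNat) = n by omega]

/-- Every set with the right tails and total charge zero is a beta-set. -/
theorem exists_betaSet_eq {A : Set ℤ} (hA : IsMaya A) (h1 : dif A (Set.Iio 0) (fun _ => 1) = 0) :
    ∃ μ : YoungDiagram, betaSet μ = A := by
  obtain ⟨N, hAN, hIN⟩ := hA.exists_common isMaya_Iio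
  obtain ⟨M, hM⟩ : ∃ M : ℕ, N ≤ M := ⟨N.toNat, by omega⟩
  replace hAN := IsMaya.mono hAN hM
  replace hIN := IsMaya.mono hIN hM
  set χ : ℤ → ℤ := fun k => ind A k - ind (Set.Iio 0) k with hχ
  have hpos : ∀ k, 0 ≤ k → 0 ≤ χ k ∧ χ k ≤ 1 := fun k hk => by
    have := ind_nonneg A k; have := ind_le_one A k
    simp only [hχ, ind_of_notMem (A := Set.Iio 0) (k := k) (by simpa using hk)]; omega
  have hneg : ∀ k, k < 0 → -1 ≤ χ k ∧ χ k ≤ 0 := fun k hk => by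
    have := ind_nonneg A k; have := ind_le_one A k
    simp only [hχ, ind_of_mem (A := Set.Iio 0) (k := k) (by simpa using hk)]; omega
  have hzero : ∀ k, k ∉ Finset.Ico (-(M : ℤ)) M → χ k = 0 := fun k hk =>
    ind_sub_ind_eq_zero hAN hIN hk
  have htot : ∑ k ∈ Finset.Ico (-(M : ℤ)) M, χ k = 0 := by
    rw [dif_eq_sum hAN hIN] at h1
    simpa only [mul_one] using h1
  set E : ℤ → ℤ := fun k => ∑ j ∈ Finset.Ico k M, χ j with hE
  have hstep : ∀ k, E k = χ k + E (k + 1) := by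
    intro k
    rcases lt_or_ge k M with hk | hk
    · simp only [hE]
      rw [← Finset.insert_Ico_succ_left_eq_Ico hk, Finset.sum_insert (by simp)]
      rfl
    · simp only [hE]
      rw [Finset.Ico_eq_empty (by omega), Finset.Ico_eq_empty (by omega), hzero k (by simp; omega)]
      simp
  have hElow : ∀ k, k ≤ -(M : ℤ) → E k = 0 := by
    intro k hk
    rw [← htot]
    refine (Finset.sum_subset (Finset.Ico_subset_Ico_left hk) fun j _ hj => hzero j hj).symm
  have hEhigh : ∀ k, (M : ℤ) ≤ k → E k = 0 := fun k hk => by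
    simp only [hE]; rw [Finset.Ico_eq_empty (by omega)]; simp
  have hEnn : ∀ k, 0 ≤ E k := by
    intro k
    rcases le_or_gt 0 k with hk | hk
    · exact Finset.sum_nonneg fun j hj => (hpos j (by simp at hj; omega)).1
    · have : ∀ n : ℕ, ∀ k : ℤ, k ≤ 0 → k ≤ -M + n → 0 ≤ E k := by
        intro n
        induction n with
        | zero => intro k _ hk; rw [hElow k (by simpa using hk)]
        | succ n ih =>
          intro k hk0 hk
          have e1 := ih (k - 1) (by omega) (by push_cast at hk; omega)
          have e2 := hstep (k - 1)
          have e3 := hneg (k - 1) (by omega)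
          rw [sub_add_cancel] at e2
          omega
      exact this M k hk.le (by omega)
  obtain ⟨μ, hμ⟩ := exists_diagLen_eq (fun k => (E k).toNat) M
    (fun k hk => by
      rcases hk with hk | hk
      · simp [hElow k hk]
      · simp [hEhigh k hk])
    (fun k hk => by
      have := hstep k; have := hpos k hk; have := hEnn k; have := hEnn (k + 1)
      omega)
    (fun k hk => by
      have := hstep k; have := hneg k hk; have := hEnn k; have := hEnn (k + 1)
      omega)
  refine ⟨μ, eq_of_ind_eq fun k => ?_⟩
  have e1 := ind_betaSet μ k
  rw [hμ, hμ, Int.toNat_of_nonneg (hEnn _), Int.toNat_of_nonneg (hEnn _), hstep k] at e1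
  simp only [hχ] at e1
  linarith

end Existence

section Hooks

/-- The content of a node. -/
def content (c : ℕ × ℕ) : ℤ := (c.2 : ℤ) - c.1

theorem content_adj {a b : ℕ × ℕ} (h : (SimpleGraph.hasse (ℕ × ℕ)).Adj a b) :
    content b = content a + 1 ∨ content b = content a - 1 := by
  obtain ⟨i, j⟩ := a
  obtain ⟨i', j'⟩ := b
  rw [SimpleGraph.hasse_adj, Prod.mk_covBy_mk_iff, Prod.mk_covBy_mk_iff] at h
  simp only [Nat.covBy_iff_add_one_eq] at h
  simp only [content]
  omega

theorem exists_content_eq {V : Type*} {G : SimpleGraph V} {c : V → ℤ}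
    (hc : ∀ u v, G.Adj u v → c v ≤ c u + 1) {u w : V} (p : G.Walk u w) {m : ℤ} (h1 : c u ≤ m)
    (h2 : m ≤ c w) : ∃ v, c v = m := by
  induction p with
  | nil => exact ⟨_, le_antisymm h1 h2⟩
  | cons h p ih =>
    rename_i u v w
    rcases h1.eq_or_lt with h1 | h1
    · exact ⟨u, h1⟩
    · exact ih (by have := hc _ _ h; omega) h2

theorem min_add_one_eq_of_mem_rim {μ : YoungDiagram} {c : ℕ × ℕ} (hc : c ∈ rim μ) :
    min c.1 c.2 + 1 = diagLen μ (content c) := by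
  obtain ⟨i, j⟩ := c
  obtain ⟨h1, h2⟩ := Finset.mem_filter.1 hc
  rw [YoungDiagram.mem_cells, mem_iff_min_lt] at h1
  simp only at h2
  rw [mem_iff_min_lt, show ((j + 1 : ℕ) : ℤ) - (i + 1 : ℕ) = (j : ℤ) - i by push_cast; ring] at h2
  simp only [content]
  omega

theorem eq_of_content_eq_of_mem_rim {μ : YoungDiagram} {c d : ℕ × ℕ} (hc : c ∈ rim μ)
    (hd : d ∈ rim μ) (h : content c = content d) : c = d := by
  have h1 := min_add_one_eq_of_mem_rim hc
  have h2 := min_add_one_eq_of_mem_rim hd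
  rw [← h] at h2
  simp only [content] at h
  ext <;> omega

/-- Removing a rim hook replaces an element `b` of the beta-set by `b - s`. -/
theorem IsRimHook.betaSet_removeHook {s : ℕ} {μ : YoungDiagram} {H : Finset (ℕ × ℕ)}
    (h : IsRimHook s μ H) : ∃ b ∈ betaSet μ, b - s ∉ betaSet μ ∧
      betaSet (removeHook h) = (betaSet μ \ {b}) ∪ {b - (s : ℤ)} := by
  classical
  set C := H.image content with hC
  have hinj : Set.InjOn content (H : Set (ℕ × ℕ)) := fun c hc d hd hcd =>
    eq_of_content_eq_of_mem_rim (h.subset_rim hc) (h.subset_rim hd) hcd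
  have hCcard : C.card = s := by rw [hC, Finset.card_image_of_injOn hinj, h.card_eq]
  have hCne : C.Nonempty := by
    obtain ⟨⟨x, hx⟩⟩ := h.connected.nonempty
    exact ⟨content x, Finset.mem_image_of_mem _ hx⟩
  have hCint : C = Finset.Icc (C.min' hCne) (C.max' hCne) := by
    refine Finset.Subset.antisymm (fun k hk => Finset.mem_Icc.2
      ⟨Finset.min'_le _ _ hk, Finset.le_max' _ _ hk⟩) fun k hk => ?_
    obtain ⟨h1, h2⟩ := Finset.mem_Icc.1 hk
    obtain ⟨u, hu, hu'⟩ := Finset.mem_image.1 (C.min'_mem hCne)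
    obtain ⟨w, hw, hw'⟩ := Finset.mem_image.1 (C.max'_mem hCne)
    obtain ⟨p⟩ := h.connected.preconnected ⟨u, hu⟩ ⟨w, hw⟩
    obtain ⟨v, hv⟩ := exists_content_eq (c := fun x : (H : Set (ℕ × ℕ)) => content x.1)
      (fun a b hab => by
        have := content_adj (SimpleGraph.comap_adj.1 hab)
        simp only [Embedding.subtype_apply] at this
        omega) p (m := k) (by simpa only [hu'] using h1) (by simpa only [hw'] using h2)
    exact Finset.mem_image.2 ⟨v.1, v.2, hv⟩
  set p := C.min' hCne
  set q := C.max' hCne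
  have hpq : q - p + 1 = s := by
    have h1 : p ≤ q := C.min'_le_max' hCne
    rw [hCint, Int.card_Icc] at hCcard
    omega
  have hdl : ∀ k, (diagLen (removeHook h) k : ℤ) = diagLen μ k - if p ≤ k ∧ k ≤ q then 1 else 0 := by
    intro k
    have hmem : ∀ c, c ∈ removeHook h ↔ c ∈ μ ∧ c ∉ H := fun c => by
      rw [removeHook, YoungDiagram.mem_mk, Finset.mem_sdiff, YoungDiagram.mem_cells]
    split_ifs with hk
    · have hkC : k ∈ C := by rw [hCint]; exact Finset.mem_Icc.2 hk
      obtain ⟨c, hc, hck⟩ := Finset.mem_image.1 hkC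
      have hmin := min_add_one_eq_of_mem_rim (h.subset_rim hc)
      rw [hck] at hmin
      have : diagLen (removeHook h) k = diagLen μ k - 1 := by
        refine diagLen_eq_of_forall fun n => ?_
        rw [hmem, diag_mem_iff]
        constructor
        · rintro ⟨h1, h2⟩
          by_contra h3
          refine h2 ?_
          have : (n + (-k).toNat, n + k.toNat) = c := by
            simp only [content] at hck
            ext <;> simp only <;> omega
          rwa [this]
        · intro h1
          refine ⟨by omega, fun h2 => ?_⟩
          have h3 := min_add_one_eq_of_mem_rim (h.subset_rim h2)
          simp only [content] at h3
          rw [show ((n + k.toNat : ℕ) : ℤ) - (n + (-k).toNat : ℕ) = k by omega] at h3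
          omega
      omega
    · rw [sub_zero, Nat.cast_inj]
      refine diagLen_eq_of_forall fun n => ?_
      rw [hmem, diag_mem_iff]
      refine and_iff_left fun h2 => hk ?_
      have : k ∈ C := Finset.mem_image.2 ⟨_, h2, by simp only [content]; omega⟩
      rw [hCint] at this
      exact Finset.mem_Icc.1 this
  have hind : ∀ k, ind (betaSet (removeHook h)) k = ind (betaSet μ) k +
      (if k = p - 1 then 1 else 0) - if k = q then 1 else 0 := by
    intro k
    have e1 := ind_betaSet (removeHook h) k
    have e2 := ind_betaSet μ k
    have e3 := hdl k
    have e4 := hdl (k + 1)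
    split_ifs at * <;> omega
  have hq : q ∈ betaSet μ := by
    by_contra hq
    have := hind q
    have h0 := ind_nonneg (betaSet (removeHook h)) q
    rw [ind_of_notMem hq, if_neg (by have := C.min'_le_max' hCne; omega), if_pos rfl] at this
    omega
  have hp : p - 1 ∉ betaSet μ := by
    intro hp
    have := hind (p - 1)
    have h0 := ind_le_one (betaSet (removeHook h)) (p - 1)
    rw [ind_of_mem hp, if_neg (c := p - 1 = q) (by have := C.min'_le_max' hCne; omega),
      if_pos rfl] at this
    omega
  have hqs : q - s = p - 1 := by omega
  refine ⟨q, hq, hqs ▸ hp, eq_of_ind_eq fun k => ?_⟩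
  rw [hind, hqs]
  by_cases h1 : k = p - 1
  · subst h1
    rw [ind_of_notMem hp, if_pos rfl, if_neg (c := p - 1 = q)
      (by have := C.min'_le_max' hCne; omega), ind_of_mem (by simp)]
    rfl
  · by_cases h2 : k = q
    · rw [h2, ind_of_mem hq, if_neg (by omega), if_pos rfl, ind_of_notMem]
      · rfl
      · simp only [Set.mem_union, Set.mem_sdiff, Set.mem_singleton_iff, not_true, and_false,
          false_or]
        omega
    · rw [if_neg h1, if_neg h2, add_zero, sub_zero]
      unfold ind
      simp [h1, h2]

/-- The cell of content `k` in the rim, when the diagonal is nonempty. -/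
noncomputable def rimCell (μ : YoungDiagram) (k : ℤ) : ℕ × ℕ :=
  (diagLen μ k - 1 + (-k).toNat, diagLen μ k - 1 + k.toNat)

theorem content_rimCell (μ : YoungDiagram) (k : ℤ) : content (rimCell μ k) = k := by
  simp only [content, rimCell]; omega

theorem rimCell_adj {μ : YoungDiagram} {k : ℤ} (h1 : 0 < diagLen μ k) (h2 : 0 < diagLen μ (k + 1)) :
    (SimpleGraph.hasse (ℕ × ℕ)).Adj (rimCell μ k) (rimCell μ (k + 1)) := by
  simp only [rimCell, SimpleGraph.hasse_adj, Prod.mk_covBy_mk_iff, Nat.covBy_iff_add_one_eq]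
  rcases le_or_gt 0 k with hk | hk
  · have := diagLen_succ_of_nonneg μ hk
    omega
  · have := diagLen_succ_of_neg μ hk
    omega

/-- Every element `b` of the beta-set with `b - s` missing gives a rim `s`-hook. -/
theorem exists_isRimHook {s : ℕ} (hs : 0 < s) {μ : YoungDiagram} {b : ℤ} (hb : b ∈ betaSet μ)
    (hbs : b - s ∉ betaSet μ) : ∃ H, IsRimHook s μ H := by
  classical
  have hF : ∀ k ∈ ({b} : Finset ℤ), k ∈ betaSet μ := by simpa using hb
  have hG : ∀ k ∈ ({b - (s : ℤ)} : Finset ℤ), k ∉ betaSet μ := by simpa using hbs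
  have hmaya := (isMaya_betaSet μ).sdiff_union {b} {b - (s : ℤ)}
  obtain ⟨ν, hν⟩ := exists_betaSet_eq hmaya (by
    rw [← dif_add_dif hmaya (isMaya_betaSet μ) isMaya_Iio, dif_betaSet_one,
      dif_sdiff_union _ _ hF hG]
    simp)
  have hcard : (ν.card : ℤ) = μ.card - s := by
    have := energy_sub_energy (isMaya_betaSet ν) (isMaya_betaSet μ)
    rw [energy_betaSet, energy_betaSet, hν, dif_sdiff_union _ _ hF hG] at this
    simp at this
    omega
  have hind : ∀ k, ind (betaSet ν) k = ind (betaSet μ) k +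
      (if k = b - s then 1 else 0) - if k = b then 1 else 0 := by
    intro k
    rw [hν]
    by_cases h1 : k = b - s
    · subst h1
      rw [ind_of_notMem hbs, if_pos rfl, if_neg (by omega), ind_of_mem (by simp)]
      rfl
    · by_cases h2 : k = b
      · rw [h2, ind_of_mem hb, if_neg (by omega), if_pos rfl, ind_of_notMem]
        · rfl
        · simp
          omega
      · rw [if_neg h1, if_neg h2, add_zero, sub_zero]
        unfold ind
        simp [h1, h2]
  have hdl : ∀ k, (diagLen ν k : ℤ) =
      diagLen μ k - if b - s < k ∧ k ≤ b then 1 else 0 := by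
    obtain ⟨N, hN, hN'⟩ := exists_diagLen_eq_zero μ
    obtain ⟨M, hM, hM'⟩ := exists_diagLen_eq_zero ν
    have key : ∀ n : ℕ, ∀ k : ℤ, max (max N M) (b + 1) - n ≤ k → (diagLen ν k : ℤ) =
      diagLen μ k - if b - s < k ∧ k ≤ b then 1 else 0 := by
      intro n
      induction n with
      | zero =>
        intro k hk
        rw [hN' k (by omega), hM' k (by omega), if_neg (by omega), sub_zero]
      | succ n ih =>
        intro k hk
        have e1 := ih (k + 1) (by push_cast at hk; omega)
        have e2 := ind_betaSet ν k
        have e3 := ind_betaSet μ k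
        have e4 := hind k
        split_ifs at * <;> omega
    exact fun k => key (max (max N M) (b + 1) - k).toNat k (by omega)
  have hle : ν.cells ⊆ μ.cells := by
    rintro ⟨i, j⟩ h
    rw [YoungDiagram.mem_cells, mem_iff_min_lt] at h ⊢
    have := hdl ((j : ℤ) - i)
    split_ifs at this <;> omega
  have hH : ∀ c, c ∈ μ.cells \ ν.cells ↔
      (b - s < content c ∧ content c ≤ b) ∧ min c.1 c.2 + 1 = diagLen μ (content c) := by
    rintro ⟨i, j⟩
    rw [Finset.mem_sdiff, YoungDiagram.mem_cells, YoungDiagram.mem_cells, mem_iff_min_lt,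
      mem_iff_min_lt]
    have := hdl ((j : ℤ) - i)
    simp only [content]
    split_ifs at this with hk <;> omega
  have hpos : ∀ k, b - s < k ∧ k ≤ b → 0 < diagLen μ k := fun k hk => by
    have := hdl k
    rw [if_pos hk] at this
    omega
  have hrim : ∀ k, b - s < k ∧ k ≤ b → rimCell μ k ∈ μ.cells \ ν.cells := fun k hk => by
    rw [hH, content_rimCell]
    refine ⟨hk, ?_⟩
    have := hpos k hk
    simp only [rimCell]
    omega
  have heq : ∀ c ∈ μ.cells \ ν.cells, c = rimCell μ (content c) := fun c hc => by
    have := (hH c).1 hc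
    simp only [rimCell]
    have h1 : content c = (c.2 : ℤ) - c.1 := rfl
    ext <;> simp only <;> omega
  have hsd : μ.cells \ (μ.cells \ ν.cells) = ν.cells := by
    rw [sdiff_sdiff_right_self]
    exact Finset.inter_eq_right.2 hle
  refine ⟨μ.cells \ ν.cells, ⟨fun c hc => ?_, ?_, ?_, ?_⟩⟩
  · obtain ⟨i, j⟩ := c
    have h1 := (hH _).1 hc
    refine Finset.mem_filter.2 ⟨(Finset.mem_sdiff.1 hc).1, ?_⟩
    rw [mem_iff_min_lt]
    simp only [content] at h1
    rw [show ((j + 1 : ℕ) : ℤ) - (i + 1 : ℕ) = (j : ℤ) - i by push_cast; ring]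
    omega
  · have : (μ.cells \ ν.cells).card = μ.card - ν.card := Finset.card_sdiff_of_subset hle
    omega
  · rw [SimpleGraph.connected_iff_exists_forall_reachable]
    refine ⟨⟨rimCell μ b, hrim b (by omega)⟩, ?_⟩
    have key : ∀ n : ℕ, ∀ (k : ℤ) (hk : b - s < k ∧ k ≤ b), b - k = n →
        ((SimpleGraph.hasse (ℕ × ℕ)).induce
          ((μ.cells \ ν.cells : Finset (ℕ × ℕ)) : Set (ℕ × ℕ))).Reachable
          ⟨rimCell μ b, hrim b (by omega)⟩ ⟨rimCell μ k, hrim k hk⟩ := by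
      intro n
      induction n with
      | zero =>
        intro k hk hkn
        obtain rfl : k = b := by simp at hkn; omega
        rfl
      | succ n ih =>
        intro k hk hkn
        have hk1 : b - s < k + 1 ∧ k + 1 ≤ b := by push_cast at hkn; omega
        refine (ih (k + 1) hk1 (by push_cast at hkn; omega)).trans (SimpleGraph.Adj.reachable ?_)
        exact (rimCell_adj (hpos k hk) (hpos _ hk1)).symm
    rintro ⟨c, hc⟩
    have h1 := heq c hc
    have h2 := ((hH c).1 hc).1
    have := key (b - content c).toNat (content c) h2 (by omega)
    simpa only [← h1] using this
  · rw [hsd]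
    exact ν.isLowerSet

end Hooks

section Cores

theorem isCore_iff {s : ℕ} (hs : 0 < s) {μ : YoungDiagram} :
    IsCore s μ ↔ CoreSet s (betaSet μ) := by
  constructor
  · intro h b hb
    by_contra hbs
    obtain ⟨H, hH⟩ := exists_isRimHook hs hb hbs
    exact h H hH
  · intro h H hH
    obtain ⟨b, hb, hbs, -⟩ := hH.betaSet_removeHook
    exact hbs (h b hb)

theorem IsRimHook.dif_removeHook {s : ℕ} {μ : YoungDiagram} {H : Finset (ℕ × ℕ)}
    (h : IsRimHook s μ H) : ∃ b ∈ betaSet μ, b - s ∉ betaSet μ ∧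
      betaSet (removeHook h) = (betaSet μ \ {b}) ∪ {b - (s : ℤ)} ∧
      ∀ f, dif (betaSet (removeHook h)) (betaSet μ) f = f (b - s) - f b := by
  obtain ⟨b, hb, hbs, he⟩ := h.betaSet_removeHook
  refine ⟨b, hb, hbs, he, fun f => ?_⟩
  have := dif_sdiff_union (A := betaSet μ) {b} {b - (s : ℤ)} (by simpa using hb)
    (by simpa using hbs) f
  simpa [he] using this

theorem IsRimHook.sameCharge {s : ℕ} {μ : YoungDiagram} {H : Finset (ℕ × ℕ)}
    (h : IsRimHook s μ H) : SameCharge s (betaSet (removeHook h)) (betaSet μ) := by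
  obtain ⟨b, -, -, -, hd⟩ := h.dif_removeHook
  intro u hu
  rw [hd, ← hu (b - s), sub_add_cancel, sub_self]

theorem IsRimHook.card_removeHook {s : ℕ} {μ : YoungDiagram} {H : Finset (ℕ × ℕ)}
    (h : IsRimHook s μ H) : (removeHook h).card + s = μ.card := by
  obtain ⟨b, -, -, -, hd⟩ := h.dif_removeHook
  have := energy_sub_energy (isMaya_betaSet (removeHook h)) (isMaya_betaSet μ)
  rw [hd, energy_betaSet, energy_betaSet] at this
  omega

theorem core_spec (s : ℕ) (μ : YoungDiagram) :
    IsCore s (core s μ) ∧ SameCharge s (betaSet (core s μ)) (betaSet μ) ∧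
      μ.card = (core s μ).card + s * weight s μ := by
  induction hn : μ.card using Nat.strong_induction_on generalizing μ with
  | _ n ih =>
    by_cases h : ∃ H, IsRimHook s μ H
    · rw [core, dif_pos h, weight, dif_pos h]
      obtain ⟨h1, h2, h3⟩ := ih _ (hn ▸ card_removeHook_lt h.choose_spec) _ rfl
      have h4 := h.choose_spec.card_removeHook
      refine ⟨h1, h2.trans (isMaya_betaSet _) (isMaya_betaSet _) (isMaya_betaSet _)
        h.choose_spec.sameCharge, ?_⟩
      rw [Nat.mul_add, mul_one]
      omega
    · rw [core, dif_neg h, weight, dif_neg h]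
      exact ⟨fun H hH => h ⟨H, hH⟩, SameCharge.refl _ _, by omega⟩

theorem core_eq_iff {s : ℕ} (hs : 0 < s) {μ σ : YoungDiagram} (hσ : IsCore s σ) :
    core s μ = σ ↔ SameCharge s (betaSet μ) (betaSet σ) := by
  obtain ⟨h1, h2, -⟩ := core_spec s μ
  constructor
  · rintro rfl
    exact h2.symm
  · intro h
    refine betaSet_injective (CoreSet.eq_of_sameCharge (s := s) (by exact_mod_cast hs)
      (isMaya_betaSet _) (isMaya_betaSet _) ((isCore_iff hs).1 h1) ((isCore_iff hs).1 hσ) ?_)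
    exact h2.trans (isMaya_betaSet _) (isMaya_betaSet _) (isMaya_betaSet _) h

/-- The set is bounded above and contains exactly one of `k`, `-1 - k` for each `k`. -/
structure Symm (A : Set ℤ) : Prop where
  mem_iff : ∀ k, k ∈ A ↔ -1 - k ∉ A
  bounded : ∃ N : ℤ, ∀ k, N ≤ k → k ∉ A

theorem Symm.isMaya {A : Set ℤ} (h : Symm A) : IsMaya A := by
  obtain ⟨N, hN⟩ := h.bounded
  exact ⟨N, fun k hk => (h.mem_iff k).2 (hN _ (by omega)), hN⟩

theorem Symm.notMem_iff {A : Set ℤ} (h : Symm A) {k : ℤ} : k ∉ A ↔ -1 - k ∈ A := by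
  rw [h.mem_iff (-1 - k), show -1 - (-1 - k) = k by ring]

theorem selfConjugate_iff {μ : YoungDiagram} : SelfConjugate μ ↔ Symm (betaSet μ) := by
  constructor
  · intro h
    refine ⟨fun k => ?_, ?_⟩
    · rw [← mem_betaSet_transpose, h]
    · obtain ⟨N, -, hN⟩ := isMaya_betaSet μ
      exact ⟨N, hN⟩
  · intro h
    refine betaSet_injective (Set.ext fun k => ?_)
    rw [mem_betaSet_transpose, ← h.mem_iff]

theorem symm_Iio : Symm (Set.Iio 0) :=
  ⟨fun k => by simp only [Set.mem_Iio]; omega, 0, fun k hk => by simpa using hk⟩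

theorem dif_bar {A B : Set ℤ} (hA : Symm A) (hB : Symm B) (f : ℤ → ℤ) :
    dif A B (fun k => f (-1 - k)) = -dif A B f := by
  unfold dif
  rw [← finsum_comp_equiv (Equiv.subLeft (-1 : ℤ)), ← finsum_neg_distrib]
  refine finsum_congr fun k => ?_
  have h : ∀ {C : Set ℤ}, Symm C → ind C (-1 - k) = 1 - ind C k := fun {C} hC => by
    by_cases hk : k ∈ C
    · rw [ind_of_mem hk, ind_of_notMem ((hC.mem_iff k).1 hk)]; rfl
    · rw [ind_of_notMem hk, ind_of_mem (hC.notMem_iff.1 hk)]; rfl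
  simp only [Equiv.subLeft_apply]
  rw [h hA, h hB, show -1 - (-1 - k) = k by ring]
  ring

theorem Symm.exists_betaSet_eq {A : Set ℤ} (h : Symm A) :
    ∃ μ : YoungDiagram, betaSet μ = A := by
  refine CorePartitions.exists_betaSet_eq h.isMaya ?_
  have := dif_bar h symm_Iio fun _ => 1
  omega

end Cores

section Shuffles

/-- The symmetric sets with the `s`-charges of `α`, the `t`-charges of `β` and energy `n`. -/
def Sol (s t : ℤ) (α β : Set ℤ) (n : ℤ) : Set (Set ℤ) :=
  {B | Symm B ∧ SameCharge s B α ∧ SameCharge t B β ∧ energy B = n}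

theorem Sol_swap (s t : ℤ) (α β : Set ℤ) (n : ℤ) : Sol s t α β n = Sol t s β α n := by
  ext B
  constructor <;> rintro ⟨h1, h2, h3, h4⟩ <;> exact ⟨h1, h3, h2, h4⟩

/-- A permutation of the integers which permutes the classes modulo `s`, commutes with the
reflection, and preserves the `t`-charges of symmetric sets. -/
structure Shuffle (s t : ℤ) (e : ℤ ≃ ℤ) : Prop where
  bar : ∀ k, e (-1 - k) = -1 - e k
  periodic : ∀ k, e (k + s) = e k + s
  bounded : ∃ M : ℤ, ∀ k, k - M ≤ e k
  charge : ∀ A, Symm A → SameCharge t (e ⁻¹' A) A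

namespace Shuffle

variable {s t : ℤ} {e e' : ℤ ≃ ℤ}

theorem symm_preimage (h : Shuffle s t e) {A : Set ℤ} (hA : Symm A) : Symm (e ⁻¹' A) := by
  refine ⟨fun k => ?_, ?_⟩
  · rw [Set.mem_preimage, Set.mem_preimage, h.bar, hA.mem_iff]
  · obtain ⟨N, hN⟩ := hA.bounded
    obtain ⟨M, hM⟩ := h.bounded
    exact ⟨N + M, fun k hk => hN _ (by have := hM k; omega)⟩

theorem symm_bar (h : Shuffle s t e) (k : ℤ) : e.symm (-1 - k) = -1 - e.symm k := by
  rw [Equiv.symm_apply_eq, h.bar, Equiv.apply_symm_apply]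

theorem symm_periodic (h : Shuffle s t e) (k : ℤ) : e.symm (k + s) = e.symm k + s := by
  rw [Equiv.symm_apply_eq, h.periodic, Equiv.apply_symm_apply]

theorem symm_image (h : Shuffle s t e) {A : Set ℤ} (hA : Symm A) : Symm (e.symm ⁻¹' A) := by
  refine ⟨fun k => ?_, ?_⟩
  · rw [Set.mem_preimage, Set.mem_preimage, h.symm_bar, hA.mem_iff]
  · obtain ⟨N, hN⟩ := hA.bounded
    obtain ⟨M, hM⟩ := h.bounded
    refine ⟨N + M, fun k hk => hN _ ?_⟩
    have h1 := hM (-1 - e.symm k)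
    rw [h.bar, Equiv.apply_symm_apply] at h1
    omega

theorem refl : Shuffle s t (Equiv.refl ℤ) :=
  ⟨fun _ => rfl, fun _ => rfl, ⟨0, fun k => by simp⟩, fun A _ => SameCharge.refl t A⟩

theorem trans (h : Shuffle s t e) (h' : Shuffle s t e') : Shuffle s t (e.trans e') where
  bar k := by simp [h.bar, h'.bar]
  periodic k := by simp [h.periodic, h'.periodic]
  bounded := by
    obtain ⟨M, hM⟩ := h.bounded
    obtain ⟨M', hM'⟩ := h'.bounded
    refine ⟨M + M', fun k => ?_⟩
    have := hM k
    have := hM' (e k)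
    simp only [Equiv.trans_apply]
    omega
  charge A hA := by
    have h1 := h'.symm_preimage hA
    exact (h.charge _ h1).trans (h.symm_preimage h1).isMaya h1.isMaya hA.isMaya (h'.charge A hA)

theorem sameCharge_iff (h : Shuffle s t e) {A B : Set ℤ} :
    SameCharge s (e ⁻¹' A) (e ⁻¹' B) ↔ SameCharge s A B := by
  constructor
  · intro hc u hu
    have := hc (fun k => u (e k)) fun k => by simp only [h.periodic, hu]
    rw [dif_comp_equiv] at this
    simpa using this
  · intro hc u hu
    rw [dif_comp_equiv]
    exact hc _ fun k => by rw [h.symm_periodic, hu]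

theorem energy_sub (h : Shuffle s t e) {A B : Set ℤ} (hA : Symm A) (hB : Symm B)
    (hc : SameCharge s A B) :
    energy (e ⁻¹' A) - energy (e ⁻¹' B) = energy A - energy B := by
  rw [energy_sub_energy (h.symm_preimage hA).isMaya (h.symm_preimage hB).isMaya,
    energy_sub_energy hA.isMaya hB.isMaya, dif_comp_equiv]
  have h1 := hc (fun k => e.symm k - k) fun k => by rw [h.symm_periodic]; ring
  have h2 := dif_sub hA.isMaya hB.isMaya (fun k => e.symm k) (fun k => k)
  linarith

theorem mem_Sol_iff (h : Shuffle s t e) {α β B : Set ℤ} (hα : Symm α) (hβ : Symm β) (hB : Symm B)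
    {n : ℤ} : B ∈ Sol s t α β n ↔
      e ⁻¹' B ∈ Sol s t (e ⁻¹' α) β (n + energy (e ⁻¹' α) - energy α) := by
  have hB' := h.symm_preimage hB
  constructor
  · rintro ⟨-, h1, h2, h3⟩
    refine ⟨hB', h.sameCharge_iff.2 h1,
      (h.charge B hB).trans hB'.isMaya hB.isMaya hβ.isMaya h2, ?_⟩
    have := h.energy_sub hB hα h1
    omega
  · rintro ⟨-, h1, h2, h3⟩
    rw [h.sameCharge_iff] at h1
    refine ⟨hB, h1, (h.charge B hB).symm.trans hB.isMaya hB'.isMaya hβ.isMaya h2, ?_⟩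
    have := h.energy_sub hB hα h1
    omega

theorem existsUnique_iff (h : Shuffle s t e) {α β : Set ℤ} (hα : Symm α) (hβ : Symm β) {n : ℤ} :
    (∃! B, B ∈ Sol s t α β n) ↔
      ∃! B, B ∈ Sol s t (e ⁻¹' α) β (n + energy (e ⁻¹' α) - energy α) := by
  have hinv : ∀ B : Set ℤ, e ⁻¹' (e.symm ⁻¹' B) = B := fun B => by
    rw [← Set.preimage_comp]; simp
  have hinv' : ∀ B : Set ℤ, e.symm ⁻¹' (e ⁻¹' B) = B := fun B => by
    rw [← Set.preimage_comp]; simp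
  constructor
  · rintro ⟨B, hB, huniq⟩
    refine ⟨e ⁻¹' B, (h.mem_Sol_iff hα hβ hB.1).1 hB, fun C hC => ?_⟩
    have hC' := h.symm_image hC.1
    rw [← huniq _ ((h.mem_Sol_iff hα hβ hC').2 (by rwa [hinv])), hinv]
  · rintro ⟨B, hB, huniq⟩
    refine ⟨e.symm ⁻¹' B, (h.mem_Sol_iff hα hβ (h.symm_image hB.1)).2 (by rwa [hinv]),
      fun C hC => ?_⟩
    rw [← huniq _ ((h.mem_Sol_iff hα hβ hC.1).1 hC), hinv']

end Shuffle

theorem dif_involution {A : Set ℤ} {e : ℤ ≃ ℤ} (he : ∀ k, e (e k) = k) (f : ℤ → ℤ) :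
    dif (e ⁻¹' A) A f = -dif (e ⁻¹' A) A fun k => f (e k) := by
  have h1 : e ⁻¹' (e ⁻¹' A) = A := by
    ext k; simp [he]
  have h2 : ∀ k, e.symm k = e k := fun k => by rw [Equiv.symm_apply_eq, he]
  have h3 := dif_comp_equiv A (e ⁻¹' A) e f
  rw [h1] at h3
  rw [h3, dif_comm]
  simp only [h2]

/-- A symmetric `s`-core whose row of `x` is longer than the row of `x - a` can be made smaller by
swapping these two rows, and their mirror images. -/
theorem exists_swap {s t a x : ℤ} (hs : 0 < s) (ha : 0 < a) (hta : t ∣ a) (hsa : ¬ s ∣ a)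
    (hx : ¬ s ∣ 2 * x + 1) (hxa : ¬ s ∣ 2 * (x - a) + 1) {A : Set ℤ} (hA : Symm A)
    (hcore : CoreSet s A) (hxA : x ∈ A) (hxaA : x - a ∉ A) :
    ∃ e, Shuffle s t e ∧ energy (e ⁻¹' A) < energy A := by
  classical
  let c1 : ℤ → Prop := fun k => s ∣ k - x ∨ s ∣ k + 1 + x - a
  let c2 : ℤ → Prop := fun k => s ∣ k - x + a ∨ s ∣ k + 1 + x
  have hex : ∀ k, c1 k → ¬ c2 k := by
    rintro k (⟨c, hc⟩ | ⟨c, hc⟩) (⟨d, hd⟩ | ⟨d, hd⟩)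
    · exact hsa ⟨d - c, by linarith⟩
    · exact hx ⟨d - c, by linarith⟩
    · exact hxa ⟨c - d, by linarith⟩
    · exact hsa ⟨d - c, by linarith⟩
  have h12 : ∀ k, c1 k → c2 (k - a) := by
    rintro k (⟨c, hc⟩ | ⟨c, hc⟩)
    · exact Or.inl ⟨c, by linarith⟩
    · exact Or.inr ⟨c, by linarith⟩
  have h21 : ∀ k, c2 k → c1 (k + a) := by
    rintro k (⟨c, hc⟩ | ⟨c, hc⟩)
    · exact Or.inl ⟨c, by linarith⟩
    · exact Or.inr ⟨c, by linarith⟩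
  have hb12 : ∀ k, c1 k → c2 (-1 - k) := by
    rintro k (⟨c, hc⟩ | ⟨c, hc⟩)
    · exact Or.inr ⟨-c, by linarith⟩
    · exact Or.inl ⟨-c, by linarith⟩
  have hb21 : ∀ k, c2 k → c1 (-1 - k) := by
    rintro k (⟨c, hc⟩ | ⟨c, hc⟩)
    · exact Or.inr ⟨-c, by linarith⟩
    · exact Or.inl ⟨-c, by linarith⟩
  have hp1 : ∀ k, c1 k → c1 (k + s) := by
    rintro k (⟨c, hc⟩ | ⟨c, hc⟩)
    · exact Or.inl ⟨c + 1, by linarith⟩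
    · exact Or.inr ⟨c + 1, by linarith⟩
  have hp2 : ∀ k, c2 k → c2 (k + s) := by
    rintro k (⟨c, hc⟩ | ⟨c, hc⟩)
    · exact Or.inl ⟨c + 1, by linarith⟩
    · exact Or.inr ⟨c + 1, by linarith⟩
  have hp1' : ∀ k, c1 (k + s) → c1 k := by
    rintro k (⟨c, hc⟩ | ⟨c, hc⟩)
    · exact Or.inl ⟨c - 1, by linarith⟩
    · exact Or.inr ⟨c - 1, by linarith⟩
  have hp2' : ∀ k, c2 (k + s) → c2 k := by
    rintro k (⟨c, hc⟩ | ⟨c, hc⟩)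
    · exact Or.inl ⟨c - 1, by linarith⟩
    · exact Or.inr ⟨c - 1, by linarith⟩
  let w : ℤ → ℤ := fun k => if c1 k then k - a else if c2 k then k + a else k
  have w1 : ∀ k, c1 k → w k = k - a := fun k hk => if_pos hk
  have w2 : ∀ k, c2 k → w k = k + a := fun k hk => by
    simp only [w]; rw [if_neg fun h => hex k h hk, if_pos hk]
  have w3 : ∀ k, ¬ c1 k → ¬ c2 k → w k = k := fun k h1 h2 => by
    simp only [w]; rw [if_neg h1, if_neg h2]
  have hinv : ∀ k, w (w k) = k := by
    intro k
    by_cases h1 : c1 k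
    · rw [w1 k h1, w2 _ (h12 k h1)]; ring
    · by_cases h2 : c2 k
      · rw [w2 k h2, w1 _ (h21 k h2)]; ring
      · rw [w3 k h1 h2, w3 k h1 h2]
  let e : ℤ ≃ ℤ := ⟨w, w, hinv, hinv⟩
  have hew : ∀ k, e k = w k := fun k => rfl
  have hbar : ∀ k, e (-1 - k) = -1 - e k := by
    intro k
    simp only [hew]
    by_cases h1 : c1 k
    · rw [w1 k h1, w2 _ (hb12 k h1)]; ring
    · by_cases h2 : c2 k
      · rw [w2 k h2, w1 _ (hb21 k h2)]; ring
      · rw [w3 k h1 h2, w3]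
        · intro h; exact h2 (by have := hb12 _ h; rwa [show -1 - (-1 - k) = k by ring] at this)
        · intro h; exact h1 (by have := hb21 _ h; rwa [show -1 - (-1 - k) = k by ring] at this)
  have hper : ∀ k, e (k + s) = e k + s := by
    intro k
    simp only [hew]
    by_cases h1 : c1 k
    · rw [w1 k h1, w1 _ (hp1 k h1)]; ring
    · by_cases h2 : c2 k
      · rw [w2 k h2, w2 _ (hp2 k h2)]; ring
      · rw [w3 k h1 h2, w3 _ (fun h => h1 (hp1' k h)) (fun h => h2 (hp2' k h))]
  have hbd : ∀ k, k - a ≤ e k := by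
    intro k
    simp only [hew, w]
    split_ifs <;> omega
  have hsh : Shuffle s t e := by
    refine ⟨hbar, hper, ⟨a, hbd⟩, fun B hB u hu => ?_⟩
    have h1 : (fun k => u (e k)) = u := by
      funext k
      refine apply_eq_of_dvd_sub hu ?_
      simp only [hew, w]
      split_ifs
      · rwa [sub_sub_cancel_left, dvd_neg]
      · rwa [add_sub_cancel_left]
      · simp
    have h0 := dif_involution (A := B) (e := e) hinv u
    rw [h1] at h0
    omega
  refine ⟨e, hsh, ?_⟩
  have hA' := hsh.symm_preimage hA
  have h0 := energy_sub_energy hA'.isMaya hA.isMaya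
  have h1 := dif_involution (A := A) (e := e) hinv fun k => k
  have h2 := dif_sub hA.isMaya hA'.isMaya (fun k => k) (fun k => e k)
  rw [dif_comm _ _ (fun k => k), dif_comm _ _ (fun k => e k)] at h2
  have h3 : 0 < dif A (e ⁻¹' A) fun k => k - e k := by
    refine finsum_pos_of_support_finite (x := x) (hA.isMaya.support_mul_finite hA'.isMaya _) ?_ ?_
    · intro k
      rw [ind_preimage]
      beta_reduce
      rw [hew]
      have hbx : -1 - x ∉ A := (hA.mem_iff x).1 hxA
      have hbxa : -1 - x + a ∈ A := by
        have := hA.notMem_iff.1 hxaA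
        rwa [show -1 - (x - a) = -1 - x + a by ring] at this
      by_cases hk1 : c1 k
      · rw [w1 k hk1, sub_sub_cancel]
        refine mul_nonneg (sub_nonneg.2 (ind_le_ind fun hk => ?_)) ha.le
        rcases hk1 with hk1 | hk1
        · have := hcore.lt_of_mem_of_notMem hs hk hxaA (by obtain ⟨c, hc⟩ := hk1; exact ⟨c, by linarith⟩)
          exact hcore.mem_of_le hs hxA (by omega) (by obtain ⟨c, hc⟩ := hk1; exact ⟨-c, by linarith⟩)
        · have := hcore.lt_of_mem_of_notMem hs hk hbx (by obtain ⟨c, hc⟩ := hk1; exact ⟨c, by linarith⟩)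
          exact hcore.mem_of_le hs hbxa (by omega)
            (by obtain ⟨c, hc⟩ := hk1; exact ⟨-c, by linarith⟩)
      · by_cases hk2 : c2 k
        · rw [w2 k hk2, show k - (k + a) = -a by ring, mul_neg, ← neg_mul, neg_sub]
          refine mul_nonneg (sub_nonneg.2 (ind_le_ind fun hk => ?_)) ha.le
          rcases hk2 with hk2 | hk2
          · have := hcore.lt_of_mem_of_notMem hs hk hxaA
              (by obtain ⟨c, hc⟩ := hk2; exact ⟨c, by linarith⟩)
            exact hcore.mem_of_le hs hxA (by omega)
              (by obtain ⟨c, hc⟩ := hk2; exact ⟨-c, by linarith⟩)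
          · have := hcore.lt_of_mem_of_notMem hs hk hbx
              (by obtain ⟨c, hc⟩ := hk2; exact ⟨c, by linarith⟩)
            exact hcore.mem_of_le hs hbxa (by omega)
              (by obtain ⟨c, hc⟩ := hk2; exact ⟨-c, by linarith⟩)
        · rw [w3 k hk1 hk2, sub_self, zero_mul]
    · rw [ind_preimage]
      beta_reduce
      rw [hew, w1 x (Or.inl (by simp)), ind_of_mem hxA, ind_of_notMem hxaA]
      omega
  omega

theorem Symm.energy_nonneg {A : Set ℤ} (hA : Symm A) : 0 ≤ energy A := by
  obtain ⟨μ, rfl⟩ := hA.exists_betaSet_eq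
  rw [energy_betaSet]
  exact Int.natCast_nonneg _

theorem CoreSet.preimage {s t : ℤ} {e : ℤ ≃ ℤ} (h : Shuffle s t e) {A : Set ℤ}
    (hA : CoreSet s A) : CoreSet s (e ⁻¹' A) := by
  intro k hk
  have h1 := h.periodic (k - s)
  rw [sub_add_cancel] at h1
  have := hA _ hk
  rwa [h1, add_sub_cancel_right] at this

theorem exists_energy_lt {s t : ℤ} (hs : 1 < s) (ht : 1 < t) (hst : IsCoprime s t) {A : Set ℤ}
    (hA : Symm A) (hcore : CoreSet s A) (h : ¬ CoreSet t A) :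
    ∃ e, Shuffle s t e ∧ energy (e ⁻¹' A) < energy A := by
  have hs0 : 0 < s := by omega
  have hnst : ¬ s ∣ t := fun hd => by
    have := hst.isUnit_of_dvd' dvd_rfl hd
    rcases Int.isUnit_iff.1 this with h | h <;> omega
  have hodd : ∀ y, s ∣ 2 * y + 1 → ¬ s ∣ 2 * t := fun y hy hd => by
    have h2 : s ∣ 2 := hst.dvd_of_dvd_mul_right hd
    obtain ⟨c, hc⟩ := hy
    obtain ⟨d, hd⟩ := h2
    have : s ∣ 1 := ⟨c - d * y, by linear_combination hc - y * hd⟩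
    have := Int.le_of_dvd one_pos this
    omega
  unfold CoreSet at h
  push Not at h
  obtain ⟨x, hx, hxt⟩ := h
  by_cases h1 : s ∣ 2 * x + 1
  · have h2t := hodd x h1
    refine exists_swap (t := t) (a := 2 * t) (x := x + t) hs0 (by omega) ⟨2, by ring⟩ h2t ?_ ?_ hA
      hcore ?_ ?_
    · rintro ⟨c, hc⟩
      obtain ⟨d, hd⟩ := h1
      exact h2t ⟨c - d, by linarith⟩
    · rintro ⟨c, hc⟩
      obtain ⟨d, hd⟩ := h1
      exact h2t ⟨d - c, by linarith⟩
    · have hb := (hA.mem_iff x).1 hx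
      have hlt := hcore.lt_of_mem_of_notMem hs0 hx hb
        (by obtain ⟨d, hd⟩ := h1; exact ⟨d, by linarith⟩)
      exact hcore.mem_of_le hs0 (hA.notMem_iff.1 hxt) (by omega)
        (by obtain ⟨d, hd⟩ := h1; exact ⟨-d, by linarith⟩)
    · rwa [show x + t - 2 * t = x - t by ring]
  · by_cases h2 : s ∣ 2 * (x - t) + 1
    · have h2t := hodd _ h2
      refine exists_swap (t := t) (a := 2 * t) (x := x) hs0 (by omega) ⟨2, by ring⟩ h2t h1 ?_ hA
        hcore hx ?_
      · rintro ⟨c, hc⟩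
        obtain ⟨d, hd⟩ := h2
        exact h2t ⟨d - c, by linarith⟩
      · intro hmem
        have hlt := hcore.lt_of_mem_of_notMem hs0 (hA.notMem_iff.1 hxt) hxt
          (by obtain ⟨d, hd⟩ := h2; exact ⟨-d, by linarith⟩)
        exact (hA.mem_iff x).1 hx (hcore.mem_of_le hs0 hmem (by omega)
          (by obtain ⟨d, hd⟩ := h2; exact ⟨d, by linarith⟩))
    · exact exists_swap hs0 (by omega) dvd_rfl hnst h1 h2 hA hcore hx hxt

/-- Every symmetric `s`-core can be shuffled to its `t`-core. -/
theorem exists_shuffle {s t : ℤ} (hs : 1 < s) (ht : 1 < t) (hst : IsCoprime s t) {A : Set ℤ}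
    (hA : Symm A) (hcore : CoreSet s A) :
    ∃ e, Shuffle s t e ∧ CoreSet s (e ⁻¹' A) ∧ CoreSet t (e ⁻¹' A) := by
  induction hn : (energy A).toNat using Nat.strong_induction_on generalizing A with
  | _ n ih =>
    by_cases h : CoreSet t A
    · exact ⟨Equiv.refl ℤ, Shuffle.refl, hcore, h⟩
    · obtain ⟨e, he, hlt⟩ := exists_energy_lt hs ht hst hA hcore h
      have hA' := he.symm_preimage hA
      have h1 := hA'.energy_nonneg
      obtain ⟨e', he', h2, h3⟩ := ih _ (by omega) hA' (hcore.preimage he) rfl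
      exact ⟨e'.trans e, he'.trans he, h2, h3⟩

end Shuffles

section Flip

open Classical in
/-- Replace the elements `k` of a finite set by their reflections `-1 - k`. -/
noncomputable def flip (A : Set ℤ) (F : Finset ℤ) : Set ℤ :=
  (A \ F) ∪ (F.image fun k => -1 - k : Finset ℤ)

theorem mem_flip {A : Set ℤ} {F : Finset ℤ} {k : ℤ} :
    k ∈ flip A F ↔ (k ∈ A ∧ k ∉ F) ∨ -1 - k ∈ F := by
  classical
  unfold flip
  simp only [Set.mem_union, Set.mem_sdiff, Finset.mem_coe, Finset.mem_image]
  refine or_congr Iff.rfl ⟨?_, fun h => ⟨-1 - k, h, by ring⟩⟩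
  rintro ⟨l, hl, rfl⟩
  rwa [show -1 - (-1 - l) = l by ring]

theorem Symm.flip {A : Set ℤ} (hA : Symm A) {F : Finset ℤ} (hF : ∀ k ∈ F, k ∈ A) :
    Symm (flip A F) := by
  refine ⟨fun k => ?_, ?_⟩
  · rw [mem_flip, mem_flip, show -1 - (-1 - k) = k by ring]
    have h1 := hA.mem_iff k
    have h2 := hF k
    have h3 := hF (-1 - k)
    tauto
  · obtain ⟨N, -, hN⟩ := hA.isMaya.sdiff_union F (F.image fun k => -1 - k)
    exact ⟨N, fun k hk h => hN k hk (by unfold CorePartitions.flip at h; convert h)⟩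

theorem dif_flip {A : Set ℤ} (hA : Symm A) {F : Finset ℤ} (hF : ∀ k ∈ F, k ∈ A) (f : ℤ → ℤ) :
    dif (flip A F) A f = ∑ k ∈ F, (f (-1 - k) - f k) := by
  classical
  have h := dif_sdiff_union (A := A) F (F.image fun k => -1 - k) hF (by
    intro k hk
    obtain ⟨l, hl, rfl⟩ := Finset.mem_image.1 hk
    exact (hA.mem_iff l).1 (hF l hl)) f
  rw [Finset.sum_image (fun a _ b _ hab => by simpa using hab)] at h
  rw [Finset.sum_sub_distrib, ← h]
  unfold flip
  congr!

theorem energy_flip {A : Set ℤ} (hA : Symm A) {F : Finset ℤ} (hF : ∀ k ∈ F, k ∈ A) :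
    energy (flip A F) = energy A - ∑ k ∈ F, (2 * k + 1) := by
  have h := energy_sub_energy (hA.flip hF).isMaya hA.isMaya
  rw [dif_flip hA hF] at h
  have h2 : ∑ k ∈ F, (-1 - k - k) = -∑ k ∈ F, (2 * k + 1) := by
    rw [← Finset.sum_neg_distrib]
    exact Finset.sum_congr rfl fun k _ => by ring
  linarith

theorem sameCharge_flip {m : ℤ} {A : Set ℤ} (hA : Symm A) {F : Finset ℤ} (hF : ∀ k ∈ F, k ∈ A)
    (h : ∀ k ∈ F, m ∣ 2 * k + 1) : SameCharge m (flip A F) A := by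
  intro u hu
  rw [dif_flip hA hF]
  refine Finset.sum_eq_zero fun k hk => ?_
  rw [sub_eq_zero]
  refine apply_eq_of_dvd_sub hu ?_
  rw [show -1 - k - k = -(2 * k + 1) by ring, dvd_neg]
  exact h k hk

end Flip

section Rigid

/-- The only symmetric set with its `s`-charges, `t`-charges and energy. -/
structure Rigid (s t : ℤ) (B : Set ℤ) : Prop where
  symm : Symm B
  eq : ∀ C, Symm C → SameCharge s C B → SameCharge t C B → energy C = energy B → C = B

theorem Rigid.swap {s t : ℤ} {B : Set ℤ} (h : Rigid s t B) : Rigid t s B :=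
  ⟨h.symm, fun C h1 h2 h3 h4 => h.eq C h1 h3 h2 h4⟩

/-- Four distinct elements of a rigid set cannot be flipped without changing charges or energy. -/
theorem Rigid.four {s t : ℤ} {B : Set ℤ} (h : Rigid s t B) {w x y z : ℤ} (hw : w ∈ B) (hx : x ∈ B)
    (hy : y ∈ B) (hz : z ∈ B) (hwx : w ≠ x) (hwy : w ≠ y) (hwz : w ≠ z) (hxy : x ≠ y)
    (hxz : x ≠ z) (hyz : y ≠ z)
    (hs : ∀ u : ℤ → ℤ, (∀ k, u (k + s) = u k) → (u (-1 - w) - u w) + ((u (-1 - x) - u x) +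
      ((u (-1 - y) - u y) + (u (-1 - z) - u z))) = 0)
    (ht : ∀ u : ℤ → ℤ, (∀ k, u (k + t) = u k) → (u (-1 - w) - u w) + ((u (-1 - x) - u x) +
      ((u (-1 - y) - u y) + (u (-1 - z) - u z))) = 0)
    (he : w + x + y + z + 2 = 0) : False := by
  have hF : ∀ k ∈ ({w, x, y, z} : Finset ℤ), k ∈ B := by
    intro k hk
    simp only [Finset.mem_insert, Finset.mem_singleton] at hk
    rcases hk with rfl | rfl | rfl | rfl <;> assumption
  have hsum : ∀ f : ℤ → ℤ, ∑ k ∈ ({w, x, y, z} : Finset ℤ), f k = f w + (f x + (f y + f z)) := by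
    intro f
    rw [Finset.sum_insert (by simp [hwx, hwy, hwz]), Finset.sum_insert (by simp [hxy, hxz]),
      Finset.sum_insert (by simp [hyz]), Finset.sum_singleton]
  have heq := h.eq _ (h.symm.flip hF) (fun u hu => by rw [dif_flip h.symm hF, hsum, hs u hu])
    (fun u hu => by rw [dif_flip h.symm hF, hsum, ht u hu])
    (by rw [energy_flip h.symm hF, hsum]; omega)
  have hmem : w ∉ flip B {w, x, y, z} := by
    rw [mem_flip]
    rintro (h1 | h1)
    · exact h1.2 (by simp)
    · exact (h.symm.mem_iff w).1 hw (hF _ h1)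
  rw [heq] at hmem
  exact hmem hw

/-- In a rigid set, only special rectangles have two opposite corners in the set and the other two
outside. -/
theorem Rigid.rectangle {s t : ℤ} {B : Set ℤ} (h : Rigid s t B) {p a b : ℤ} (ha : s ∣ a)
    (hb : t ∣ b) (hab : a ≠ b) (hab' : a + b ≠ 0) (hp : p ∈ B) (hpab : p + a + b ∈ B)
    (hpa : p + a ∉ B) (hpb : p + b ∉ B) :
    2 * p + 1 = -a ∨ 2 * p + 1 = -a - 2 * b ∨ 2 * p + 1 = -b ∨ 2 * p + 1 = -b - 2 * a := by
  by_contra! hne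
  obtain ⟨h1, h2, h3, h4⟩ := hne
  refine h.four hp hpab (h.symm.notMem_iff.1 hpa) (h.symm.notMem_iff.1 hpb) (by omega) (by omega)
    (by omega) (by omega) (by omega) (by omega) (fun u hu => ?_) (fun u hu => ?_) (by ring)
  · rw [apply_eq_of_dvd_sub hu (k := -1 - (p + a + b)) (l := -1 - (p + b))
        (by rw [show -1 - (p + a + b) - (-1 - (p + b)) = -a by ring, dvd_neg]; exact ha),
      apply_eq_of_dvd_sub hu (k := p + a + b) (l := p + b)
        (by rw [show p + a + b - (p + b) = a by ring]; exact ha),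
      apply_eq_of_dvd_sub hu (k := -1 - (-1 - (p + a))) (l := p)
        (by rw [show -1 - (-1 - (p + a)) - p = a by ring]; exact ha),
      apply_eq_of_dvd_sub hu (k := -1 - (p + a)) (l := -1 - p)
        (by rw [show -1 - (p + a) - (-1 - p) = -a by ring, dvd_neg]; exact ha),
      show -1 - (-1 - (p + b)) = p + b by ring]
    ring
  · rw [apply_eq_of_dvd_sub hu (k := -1 - (p + a + b)) (l := -1 - (p + a))
        (by rw [show -1 - (p + a + b) - (-1 - (p + a)) = -b by ring, dvd_neg]; exact hb),
      apply_eq_of_dvd_sub hu (k := p + a + b) (l := p + a)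
        (by rw [show p + a + b - (p + a) = b by ring]; exact hb),
      apply_eq_of_dvd_sub hu (k := -1 - (-1 - (p + b))) (l := p)
        (by rw [show -1 - (-1 - (p + b)) - p = b by ring]; exact hb),
      apply_eq_of_dvd_sub hu (k := -1 - (p + b)) (l := -1 - p)
        (by rw [show -1 - (p + b) - (-1 - p) = -b by ring, dvd_neg]; exact hb),
      show -1 - (-1 - (p + a)) = p + a by ring]
    ring

/-- The largest element of a residue class. -/
theorem IsMaya.exists_top {A : Set ℤ} (hA : IsMaya A) {m : ℤ} (hm : 0 < m) (r : ℤ) :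
    ∃ y, m ∣ y - r ∧ y ∈ A ∧ ∀ z, y < z → m ∣ z - r → z ∉ A := by
  obtain ⟨N, h1, h2⟩ := hA
  obtain ⟨y, ⟨hy1, hy2⟩, hy3⟩ := Int.exists_greatest_of_bdd (P := fun y => m ∣ y - r ∧ y ∈ A)
    ⟨N, fun z hz => by by_contra hlt; exact h2 z (by omega) hz.2⟩
    ⟨r - m * (|r| + |N| + 1), ⟨-(|r| + |N| + 1), by ring⟩, h1 _ (by
      have := le_abs_self r
      have := neg_abs_le r
      have := le_abs_self N
      have := abs_nonneg r
      have := abs_nonneg N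
      nlinarith)⟩
  refine ⟨y, hy1, hy2, fun z hz hzr hzA => ?_⟩
  have := hy3 z ⟨hzr, hzA⟩
  omega

theorem exists_small_class {m : ℤ} (hm : 6 ≤ m) (x : ℤ) :
    ∃ r, ¬ m ∣ r - x ∧ ¬ m ∣ x + r + 1 ∧ ¬ m ∣ 2 * r + 1 := by
  have small : ∀ d, 0 < d → d < 6 → ¬ m ∣ d := fun d h1 h2 h => by
    have := Int.le_of_dvd h1 h
    omega
  by_contra! hcon
  have key : ∀ r, 0 ≤ r → r ≤ 2 → m ∣ r - x ∨ m ∣ x + r + 1 := by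
    intro r h0 h2
    by_contra! hr
    exact small (2 * r + 1) (by omega) (by omega) (hcon r hr.1 hr.2)
  have e1 : ∀ r r', 0 ≤ r → r < r' → r' ≤ 2 → m ∣ r - x → ¬ m ∣ r' - x := by
    rintro r r' h0 h1 h2 ⟨c, hc⟩ ⟨d, hd⟩
    exact small (r' - r) (by omega) (by omega) ⟨d - c, by linarith⟩
  have e2 : ∀ r r', 0 ≤ r → r < r' → r' ≤ 2 → m ∣ x + r + 1 → ¬ m ∣ x + r' + 1 := by
    rintro r r' h0 h1 h2 ⟨c, hc⟩ ⟨d, hd⟩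
    exact small (r' - r) (by omega) (by omega) ⟨d - c, by linarith⟩
  have k0 := key 0 (by omega) (by omega)
  have k1 := key 1 (by omega) (by omega)
  have k2 := key 2 (by omega) (by omega)
  have := e1 0 1 (by omega) (by omega) (by omega)
  have := e1 0 2 (by omega) (by omega) (by omega)
  have := e1 1 2 (by omega) (by omega) (by omega)
  have := e2 0 1 (by omega) (by omega) (by omega)
  have := e2 0 2 (by omega) (by omega) (by omega)
  have := e2 1 2 (by omega) (by omega) (by omega)
  tauto

/-- In a rigid set, an element which can be lowered by a multiple of `s * t` is at distance this
multiple from its reflection. -/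
theorem Rigid.eq_of_sub_notMem {s t m : ℤ} {B : Set ℤ} (h : Rigid s t B) (hm : 6 ≤ m)
    (hsm : s ∣ m) (htm : t ∣ m) {c : ℤ} (hc : 0 < c) (hmc : m ∣ c) {x : ℤ} (hx : x ∈ B)
    (hxc : x - c ∉ B) : 2 * x + 1 = c := by
  by_contra hne
  obtain ⟨r, h1, h2, h3⟩ := exists_small_class hm x
  obtain ⟨y, hyr, hy, hytop⟩ := h.symm.isMaya.exists_top (m := m) (by omega) r
  have hyc : y + c ∉ B := hytop _ (by omega) (by
    obtain ⟨d, hd⟩ := hyr; obtain ⟨e, he⟩ := hmc; exact ⟨d + e, by linarith⟩)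
  obtain ⟨d, hd⟩ := hyr
  obtain ⟨e, he⟩ := id hmc
  have g1 : x ≠ y := by rintro rfl; exact h1 ⟨-d, by linarith⟩
  have g2 : x - c ≠ y + c := fun hh => h1 ⟨-d - 2 * e, by linarith⟩
  have g3 : x + y + 1 ≠ c := fun hh => h2 ⟨e - d, by linarith⟩
  have g4 : x + y + 1 ≠ -c := fun hh => h2 ⟨-e - d, by linarith⟩
  have g5 : 2 * y + 1 ≠ -c := fun hh => h3 ⟨-e - 2 * d, by linarith⟩
  have key : ∀ q : ℤ, q ∣ c → ∀ u : ℤ → ℤ, (∀ k, u (k + q) = u k) → (u (-1 - x) - u x) +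
      ((u (-1 - (-1 - (x - c))) - u (-1 - (x - c))) +
      ((u (-1 - y) - u y) + (u (-1 - (-1 - (y + c))) - u (-1 - (y + c))))) = 0 := by
    intro q hq u hu
    rw [apply_eq_of_dvd_sub hu (k := -1 - (-1 - (x - c))) (l := x)
        (by rw [show -1 - (-1 - (x - c)) - x = -c by ring, dvd_neg]; exact hq),
      apply_eq_of_dvd_sub hu (k := -1 - (x - c)) (l := -1 - x)
        (by rw [show -1 - (x - c) - (-1 - x) = c by ring]; exact hq),
      apply_eq_of_dvd_sub hu (k := -1 - (-1 - (y + c))) (l := y)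
        (by rw [show -1 - (-1 - (y + c)) - y = c by ring]; exact hq),
      apply_eq_of_dvd_sub hu (k := -1 - (y + c)) (l := -1 - y)
        (by rw [show -1 - (y + c) - (-1 - y) = -c by ring, dvd_neg]; exact hq)]
    ring
  exact h.four hx (h.symm.notMem_iff.1 hxc) hy (h.symm.notMem_iff.1 hyc) (by omega) (by omega)
    (by omega) (by omega) (by omega) (by omega) (key s (hsm.trans hmc)) (key t (htm.trans hmc))
    (by ring)

end Rigid

section Types

/-- A rigid `st`-core `B` whose `s`-core `α` and `t`-core `β` are both `s`-cores and `t`-cores. -/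
structure RigidCore (s t : ℤ) (B α β : Set ℤ) : Prop where
  one_lt_left : 1 < s
  one_lt_right : 1 < t
  coprime : IsCoprime s t
  rigid : Rigid s t B
  core : CoreSet (s * t) B
  symm_left : Symm α
  symm_right : Symm β
  left_left : CoreSet s α
  left_right : CoreSet t α
  right_left : CoreSet s β
  right_right : CoreSet t β
  charge_left : SameCharge s B α
  charge_right : SameCharge t B β

theorem RigidCore.swap {s t : ℤ} {B α β : Set ℤ} (h : RigidCore s t B α β) :
    RigidCore t s B β α :=
  ⟨h.2, h.1, h.3.symm, h.4.swap, by rw [mul_comm]; exact h.5, h.7, h.6, h.11, h.10, h.9, h.8,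
    h.13, h.12⟩

/-- Comparison of two rows of a set whose `s`-core is a `t`-core. -/
theorem exists_finset_card_le {s t : ℤ} (ht : 0 < t) {B α : Set ℤ} (hB : IsMaya B)
    (hα : IsMaya α) (hαt : CoreSet t α) (hc : SameCharge s B α) {a : ℤ} (ha : 0 ≤ a) (hta : t ∣ a)
    (x : ℤ) : ∃ P N : Finset ℤ, (∀ k, k ∈ P ↔ s ∣ k - x ∧ k ∈ B ∧ k - a ∉ B) ∧
      (∀ k, k ∈ N ↔ s ∣ k - x ∧ k ∉ B ∧ k - a ∈ B) ∧ P.card ≤ N.card := by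
  classical
  let e : ℤ ≃ ℤ := Equiv.subRight a
  have he : ∀ k, e k = k - a := fun k => rfl
  have hes : ∀ k, e.symm k = k + a := fun k => rfl
  have hmaya : ∀ {C : Set ℤ}, IsMaya C → IsMaya (e ⁻¹' C) := by
    rintro C ⟨N, h1, h2⟩
    exact ⟨N + a, fun k hk => h1 _ (by rw [he]; omega), fun k hk => h2 _ (by rw [he]; omega)⟩
  have hB' := hmaya hB
  have hα' := hmaya hα
  have h1 : dif (e ⁻¹' B) (e ⁻¹' α) (cls s x) = 0 := by
    rw [dif_comp_equiv]
    refine hc _ fun k => ?_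
    rw [hes, hes, show k + s + a = k + a + s by ring, cls_periodic]
  have h2 := hc (cls s x) (cls_periodic s x)
  have h3 := dif_add_dif hB hα hα' (cls s x)
  have h4 := dif_add_dif hB hB' hα' (cls s x)
  have h5 : dif α (e ⁻¹' α) (cls s x) ≤ 0 := by
    rw [← neg_nonneg, ← dif_comm]
    refine finsum_nonneg fun k => mul_nonneg (sub_nonneg.2 ?_) (cls_nonneg _ _ _)
    rw [ind_preimage]
    exact ind_le_ind fun hk => hαt.mem_of_le ht hk (by rw [he]; omega) (by rw [he]; simpa using hta)
  have h6 : dif B (e ⁻¹' B) (cls s x) ≤ 0 := by omega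
  obtain ⟨M, hM1, hM2⟩ := hB.exists_common hB'
  rw [dif_eq_sum hM1 hM2] at h6
  have hzero : ∀ k, k ∉ Finset.Ico (-M) M → (k ∈ B ↔ k - a ∈ B) := fun k hk => by
    have := ind_sub_ind_eq_zero hM1 hM2 hk
    rw [ind_preimage, he] at this
    rw [← ind_eq_one_iff, ← ind_eq_one_iff, sub_eq_zero.1 this]
  refine ⟨(Finset.Ico (-M) M).filter fun k => s ∣ k - x ∧ k ∈ B ∧ k - a ∉ B,
    (Finset.Ico (-M) M).filter fun k => s ∣ k - x ∧ k ∉ B ∧ k - a ∈ B, fun k => ?_, fun k => ?_, ?_⟩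
  · rw [Finset.mem_filter]
    refine and_iff_right_of_imp fun hk => ?_
    by_contra hk'
    have := hzero k hk'
    tauto
  · rw [Finset.mem_filter]
    refine and_iff_right_of_imp fun hk => ?_
    by_contra hk'
    have := hzero k hk'
    tauto
  · have h7 : ∑ k ∈ Finset.Ico (-M) M, (ind B k - ind (e ⁻¹' B) k) * cls s x k =
        ∑ k ∈ Finset.Ico (-M) M, ((if s ∣ k - x ∧ k ∈ B ∧ k - a ∉ B then (1 : ℤ) else 0) -
          if s ∣ k - x ∧ k ∉ B ∧ k - a ∈ B then 1 else 0) := by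
      refine Finset.sum_congr rfl fun k _ => ?_
      rw [ind_preimage, he]
      by_cases g1 : s ∣ k - x <;> by_cases g2 : k ∈ B <;> by_cases g3 : k - a ∈ B <;>
        simp [ind, cls, g1, g2, g3]
    rw [h7, Finset.sum_sub_distrib, Finset.sum_boole, Finset.sum_boole] at h6
    exact_mod_cast sub_nonpos.1 h6

variable {s t : ℤ} {B α β : Set ℤ}

theorem dvd_of_dvd_two_mul {x a : ℤ} (hsx : s ∣ 2 * x + 1) (h2 : s ∣ 2 * a) : s ∣ a := by
  have : IsCoprime s 2 := by
    obtain ⟨c, hc⟩ := hsx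
    exact ⟨c, -x, by linarith⟩
  exact this.dvd_of_dvd_mul_left h2

theorem exists_step (hs : 0 < s) {u v : ℤ} (hu : u ∉ B) (hv : v ∈ B) (huv : u ≤ v)
    (hd : s ∣ v - u) : ∃ z, z ∈ B ∧ z - s ∉ B ∧ s ∣ z - u ∧ u < z ∧ z ≤ v := by
  obtain ⟨f, hf⟩ := hd
  by_contra! hcon
  have key : ∀ n : ℕ, (n : ℤ) ≤ f → u + n * s ∉ B := by
    intro n
    induction n with
    | zero => intro _; simpa using hu
    | succ n ih =>
      intro hn hmem
      push_cast at hn hmem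
      have h1 := hcon _ hmem
        (by rw [show u + (n + 1) * s - s = u + n * s by ring]; exact ih (by omega))
        ⟨n + 1, by ring⟩ (by nlinarith)
      nlinarith
  have hf0 : 0 ≤ f := by
    by_contra hlt
    nlinarith
  refine key f.toNat (by omega) ?_
  rw [Int.toNat_of_nonneg hf0, show u + f * s = v by linarith]
  exact hv

namespace RigidCore

theorem pos (h : RigidCore s t B α β) : 0 < s := by have := h.1; omega

theorem not_dvd (h : RigidCore s t B α β) : ¬ s ∣ t := fun hd => by
  have h1 := h.1
  have := h.coprime.isUnit_of_dvd' dvd_rfl hd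
  rcases Int.isUnit_iff.1 this with h | h <;> omega

theorem sub_mem (h : RigidCore s t B α β) {k a : ℤ} (hk : k ∈ B) (ha : 0 ≤ a) (h1 : s ∣ a)
    (h2 : t ∣ a) : k - a ∈ B :=
  h.core.mem_of_le (mul_pos h.pos h.swap.pos) hk (by omega)
    (by rw [sub_sub_cancel]; exact h.coprime.mul_dvd h1 h2)

/-- The possible shapes of a crossing of two rows. -/
theorem crossing (h : RigidCore s t B α β) {x y a : ℤ} (ha : 0 < a) (hta : t ∣ a) (hxy : s ∣ y - x)
    (hx : x ∈ B) (hxa : x - a ∉ B) (hy : y ∉ B) (hya : y - a ∈ B) :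
    y = -1 - x ∨ y = 2 * a - 1 - x ∨ 2 * x + 1 = a ∨ 2 * y + 1 = a := by
  have hne : y - x ≠ -a := fun he => by
    rw [he, dvd_neg] at hxy
    exact hxa (h.sub_mem hx ha.le hxy hta)
  have hne' : y - x + -a ≠ 0 := fun he => by
    have : s ∣ a := by rwa [show a = y - x by omega]
    exact hxa (h.sub_mem hx ha.le this hta)
  have := h.rigid.rectangle (p := x) hxy (dvd_neg.2 hta) hne hne' hx
    (by rwa [show x + (y - x) + -a = y - a by ring])
    (by rwa [show x + (y - x) = y by ring])
    (by rwa [show x + -a = x - a by ring])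
  omega

/-- The shapes of an element which can be lowered by a multiple of `t`. -/
theorem types_aux (h : RigidCore s t B α β) {x a : ℤ} (ha : 0 < a) (hta : t ∣ a) (hx : x ∈ B)
    (hxa : x - a ∉ B) : (s ∣ 2 * x + 1 ∧ -1 - x - a ∈ B) ∨
      (s ∣ 2 * (x - a) + 1 ∧ x - 2 * a ∈ B) ∨ 2 * x + 1 = a := by
  obtain ⟨P, N, hP, hN, hcard⟩ := exists_finset_card_le h.swap.pos h.rigid.symm.isMaya
    h.symm_left.isMaya h.left_right h.charge_left ha.le hta x
  have hxP : x ∈ P := (hP x).2 ⟨by simp, hx, hxa⟩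
  have main : ∀ y ∈ N, ((s ∣ 2 * x + 1 ∧ -1 - x - a ∈ B) ∨
      (s ∣ 2 * (x - a) + 1 ∧ x - 2 * a ∈ B) ∨ 2 * x + 1 = a) ∨ 2 * y + 1 = a := by
    intro y hy
    obtain ⟨h1, h2, h3⟩ := (hN y).1 hy
    rcases h.crossing ha hta h1 hx hxa h2 h3 with h4 | h4 | h4 | h4
    · left; left
      subst h4
      exact ⟨by obtain ⟨c, hc⟩ := h1; exact ⟨-c, by linarith⟩, h3⟩
    · left; right; left
      subst h4
      refine ⟨by obtain ⟨c, hc⟩ := h1; exact ⟨-c, by linarith⟩, ?_⟩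
      have := h.rigid.symm.notMem_iff.1 h2
      rwa [show -1 - (2 * a - 1 - x) = x - 2 * a by ring] at this
    · exact Or.inl (Or.inr (Or.inr h4))
    · exact Or.inr h4
  by_contra hcon
  have hall : ∀ y ∈ N, 2 * y + 1 = a := fun y hy => (main y hy).resolve_left hcon
  have hNcard : N.card ≤ 1 := Finset.card_le_one.2 fun y hy z hz => by
    have := hall y hy; have := hall z hz; omega
  obtain ⟨y, hy⟩ : N.Nonempty := by
    rw [← Finset.card_pos]
    have := Finset.card_pos.2 ⟨x, hxP⟩
    omega
  obtain ⟨h1, h2, h3⟩ := (hN y).1 hy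
  have hya := hall y hy
  have hx' : a - 1 - x ∈ P := by
    refine (hP _).2 ⟨?_, ?_, ?_⟩
    · obtain ⟨c, hc⟩ := h1
      exact ⟨2 * c, by linarith⟩
    · have := h.rigid.symm.notMem_iff.1 hxa
      rwa [show -1 - (x - a) = a - 1 - x by ring] at this
    · have := (h.rigid.symm.mem_iff x).1 hx
      rwa [show a - 1 - x - a = -1 - x by ring]
  have := Finset.card_le_one.1 (hcard.trans hNcard) x hxP _ hx'
  exact hcon (Or.inr (Or.inr (by omega)))

theorem not_dvd_of_type (h : RigidCore s t B α β) {x a : ℤ} (hx : x ∈ B)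
    (hxa : x - a ∉ B) (hs : s ∣ 2 * x + 1) (hxa' : -1 - x - a ∈ B) : ¬ t ∣ 2 * x + 1 := by
  intro ht
  rcases le_or_gt 0 (2 * x + 1) with h0 | h0
  · have := h.sub_mem hx h0 hs ht
    rw [show x - (2 * x + 1) = -1 - x by ring] at this
    exact (h.rigid.symm.mem_iff x).1 hx this
  · have := h.sub_mem hxa' (a := -(2 * x + 1)) (by omega) (dvd_neg.2 hs) (dvd_neg.2 ht)
    rw [show -1 - x - a - -(2 * x + 1) = x - a by ring] at this
    exact hxa this

theorem not_dvd_of_type' (h : RigidCore s t B α β) {x a : ℤ} (hx : x ∈ B)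
    (hxa : x - a ∉ B) (hs : s ∣ 2 * (x - a) + 1) (hxa' : x - 2 * a ∈ B) :
    ¬ t ∣ 2 * (x - a) + 1 := by
  have hb := h.rigid.symm.notMem_iff.1 hxa
  have := h.not_dvd_of_type (x := -1 - (x - a)) (a := a) hb
    (by rw [show -1 - (x - a) - a = -1 - x by ring]; exact (h.rigid.symm.mem_iff x).1 hx)
    (by rw [show 2 * (-1 - (x - a)) + 1 = -(2 * (x - a) + 1) by ring, dvd_neg]; exact hs)
    (by rw [show -1 - (-1 - (x - a)) - a = x - 2 * a by ring]; exact hxa')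
  rwa [show 2 * (-1 - (x - a)) + 1 = -(2 * (x - a) + 1) by ring, dvd_neg] at this

/-- The only positive multiple of `s` which can occur is `s` itself. -/
theorem eq_of_dvd (h : RigidCore s t B α β) {x : ℤ} (hx : x ∈ B) (hsx : s ∣ 2 * x + 1)
    (hpos : 0 < 2 * x + 1) : 2 * x + 1 = s := by
  by_contra hne
  have hs := h.pos
  have hnt : ¬ t ∣ 2 * x + 1 := fun htx => by
    have := h.sub_mem hx hpos.le hsx htx
    rw [show x - (2 * x + 1) = -1 - x by ring] at this
    exact (h.rigid.symm.mem_iff x).1 hx this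
  have hts : ¬ t ∣ s := h.swap.not_dvd
  obtain ⟨c, hc⟩ := id hsx
  have hcodd : ¬ 2 ∣ s * c := by omega
  have hc2 : ¬ 2 ∣ c := fun hd => hcodd (hd.mul_left s)
  have hs2 : ¬ 2 ∣ s := fun hd => hcodd (hd.mul_right c)
  obtain ⟨q, rfl⟩ : ∃ q, c = 2 * q + 1 := ⟨c / 2, by omega⟩
  obtain ⟨y, hy⟩ : ∃ y, s = 2 * y + 1 := ⟨s / 2, by omega⟩
  have hq : 0 < q := by
    by_contra hq
    rcases (not_lt.1 hq).eq_or_lt with rfl | hq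
    · exact hne (by linarith)
    · nlinarith
  have hsq : 0 < s * q := mul_pos hs hq
  have hxy : x - y = s * q := by linarith
  by_cases hyB : y ∈ B
  · have hyB' := (h.rigid.symm.mem_iff y).1 hyB
    have e : x - (s * q + s) = -1 - y := by linarith
    rcases h.swap.types_aux (x := x) (a := s * q + s) (by omega) ⟨q + 1, by ring⟩ hx
      (by rwa [e]) with h1 | h1 | h1
    · exact hnt h1.1
    · rw [e, show 2 * (-1 - y) + 1 = -s by linarith, dvd_neg] at h1
      exact hts h1.1
    · linarith
  · have e : x - s * q = y := by linarith
    rcases h.swap.types_aux (x := x) (a := s * q) (by omega) ⟨q, by ring⟩ hx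
      (by rwa [e]) with h1 | h1 | h1
    · exact hnt h1.1
    · rw [e, show 2 * y + 1 = s by linarith] at h1
      exact hts h1.1
    · linarith

theorem not_neg_of_type (h : RigidCore s t B α β) {x a : ℤ} (ha : 0 < a) (hta : t ∣ a)
    (hx : x ∈ B) (hxa : x - a ∉ B) (hs : s ∣ 2 * x + 1) (hxa' : -1 - x - a ∈ B) :
    0 < 2 * x + 1 := by
  by_contra hneg
  have hsa : ¬ s ∣ a := fun hd => hxa (h.sub_mem hx ha.le hd hta)
  have hs2a : ¬ s ∣ 2 * a := fun hd => hsa (dvd_of_dvd_two_mul hs hd)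
  have hsym := h.rigid.symm
  have hnt := h.not_dvd_of_type hx hxa hs hxa'
  have hx1 : -1 - x ∉ B := (hsym.mem_iff x).1 hx
  have hm1 : x + a ∉ B := by
    have := (hsym.mem_iff _).1 hxa'
    rwa [show -1 - (-1 - x - a) = x + a by ring] at this
  have hm2 : -1 - x + a ∈ B := by
    have := hsym.notMem_iff.1 hxa
    rwa [show -1 - (x - a) = -1 - x + a by ring] at this
  have cross : ∀ k l, s ∣ k - x → s ∣ l - x → k + a ∈ B → k ∉ B → l ∈ B → l + a ∉ B →
      l = -1 - k := by
    intro k l hk hl h1 h2 h3 h4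
    obtain ⟨c, hc⟩ := hk
    obtain ⟨d, hd⟩ := hl
    obtain ⟨f, hf⟩ := id hs
    rcases h.crossing (x := k + a) (y := l + a) ha hta ⟨d - c, by linarith⟩ h1 (by simpa using h2)
      h4 (by simpa using h3) with g | g | g | g
    · exact absurd (show s ∣ 2 * a from ⟨-d - c - f, by linarith⟩) hs2a
    · omega
    · exact absurd (show s ∣ a from ⟨-2 * c - f, by linarith⟩) hsa
    · exact absurd (show s ∣ a from ⟨-2 * d - f, by linarith⟩) hsa
  have agree : ∀ k, s ∣ k - x → k ≠ x → k ≠ -1 - x → (k ∈ B ↔ k + a ∈ B) := by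
    intro k hk h1 h2
    have hbar : s ∣ -1 - x - x := by obtain ⟨f, hf⟩ := hs; exact ⟨-f, by linarith⟩
    constructor
    · intro h3
      by_contra h4
      have := cross (-1 - x) k hbar hk hm2 hx1 h3 h4
      omega
    · intro h3
      by_contra h4
      have := cross k x hk (by simp) h3 h4 hx hm1
      omega
  obtain ⟨z, hz, hzs, hzx, hxz, hzx'⟩ : ∃ z, z ∈ B ∧ z - s ∉ B ∧ s ∣ z - (x + a) ∧ x + a < z ∧
      z ≤ -1 - x + a := by
    refine exists_step h.pos hm1 hm2 (by omega) ?_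
    obtain ⟨f, hf⟩ := hs
    exact ⟨-f, by linarith⟩
  have hsz : ¬ s ∣ 2 * z + 1 := by
    rintro ⟨c, hc⟩
    obtain ⟨d, hd⟩ := hzx
    obtain ⟨f, hf⟩ := hs
    exact hs2a ⟨c - 2 * d - f, by linarith⟩
  have hmx : s ∣ z - a - x := by obtain ⟨d, hd⟩ := hzx; exact ⟨d, by linarith⟩
  have hm1' : s ∣ 2 * (z - a) + 1 := by
    obtain ⟨d, hd⟩ := hmx; obtain ⟨f, hf⟩ := hs; exact ⟨2 * d + f, by linarith⟩
  have hms : s ∣ 2 * (z - a - s) + 1 := by obtain ⟨d, hd⟩ := hm1'; exact ⟨d - 2, by linarith⟩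
  rcases h.swap.types_aux h.pos dvd_rfl hz hzs with ⟨htz, hz'⟩ | ⟨htz, hz'⟩ | hz'
  · have htm : t ∣ 2 * (z - a) + 1 := by
      obtain ⟨c, hc⟩ := htz; obtain ⟨d, hd⟩ := hta; exact ⟨c - 2 * d, by linarith⟩
    have hne : z - a ≠ -1 - x := fun he => hnt (by
      rw [he, show 2 * (-1 - x) + 1 = -(2 * x + 1) by ring, dvd_neg] at htm; exact htm)
    have hmB : z - a ∈ B := (agree _ hmx (by omega) hne).2 (by simpa using hz)
    have hmneg : 2 * (z - a) + 1 < 0 := by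
      by_contra hge
      have := h.sub_mem hmB (not_lt.1 hge) hm1' htm
      rw [show z - a - (2 * (z - a) + 1) = -1 - (z - a) by ring] at this
      exact (hsym.mem_iff _).1 hmB this
    have hzs' : z - a - s = x := by
      by_contra hne'
      have hs' := h.pos
      have hmsB : z - a - s ∉ B := by
        rw [agree (z - a - s) (by obtain ⟨d, hd⟩ := hmx; exact ⟨d - 1, by linarith⟩) hne'
          (by omega), show z - a - s + a = z - s by ring]
        exact hzs
      rcases h.swap.types_aux h.pos dvd_rfl hmB hmsB with ⟨g1, g2⟩ | ⟨g1, g2⟩ | g1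
      · exact h.swap.not_dvd_of_type hmB hmsB g1 g2 hm1'
      · have g3 : t ∣ 2 * s := by
          obtain ⟨c, hc⟩ := g1; obtain ⟨d, hd⟩ := htm; exact ⟨d - c, by linarith⟩
        exact h.swap.not_dvd (dvd_of_dvd_two_mul htm g3)
      · omega
    have h1 := h.sub_mem hm2 (a := -(2 * (z - a) + 1)) (by omega) (dvd_neg.2 hm1') (dvd_neg.2 htm)
    have h2 := (hsym.mem_iff _).1 hz'
    refine h2 ?_
    convert h1 using 1
    linarith
  · have htm : t ∣ 2 * (z - a - s) + 1 := by
      obtain ⟨c, hc⟩ := htz; obtain ⟨d, hd⟩ := hta; exact ⟨c - 2 * d, by linarith⟩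
    have hs' := h.pos
    have hmsx : s ∣ z - a - s - x := by obtain ⟨d, hd⟩ := hmx; exact ⟨d - 1, by linarith⟩
    have hne : z - a - s ≠ x := fun he => hnt (by rw [he] at htm; exact htm)
    have hmsB : z - a - s ∉ B := by
      rw [agree _ hmsx hne (by omega), show z - a - s + a = z - s by ring]
      exact hzs
    have hmpos : 0 < 2 * (z - a - s) + 1 := by
      by_contra hle
      have hmB := hsym.notMem_iff.1 hmsB
      have := h.sub_mem hmB (a := -(2 * (z - a - s) + 1)) (by omega) (dvd_neg.2 hms)
        (dvd_neg.2 htm)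
      rw [show -1 - (z - a - s) - -(2 * (z - a - s) + 1) = z - a - s by ring] at this
      exact hmsB this
    have hzx2 : z - a = -1 - x := by
      by_contra hne'
      have hmB : z - a ∈ B := (agree _ hmx (by omega) hne').2 (by simpa using hz)
      rcases h.swap.types_aux h.pos dvd_rfl hmB hmsB with ⟨g1, g2⟩ | ⟨g1, g2⟩ | g1
      · have g3 : t ∣ 2 * s := by
          obtain ⟨c, hc⟩ := g1; obtain ⟨d, hd⟩ := htm; exact ⟨c - d, by linarith⟩
        exact h.swap.not_dvd (dvd_of_dvd_two_mul htm g3)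
      · exact h.swap.not_dvd_of_type' hmB hmsB g1 g2 hms
      · refine h.swap.not_dvd ?_
        obtain ⟨d, hd⟩ := htm
        exact ⟨-d, by linarith⟩
    have h1 := h.sub_mem hz' (a := 2 * (z - a - s) + 1) (by omega) hms htm
    refine hm1 ?_
    convert h1 using 1
    linarith
  · exact hsz (by rw [hz'])

/-- The shapes of an element which can be lowered by a multiple of `t`. -/
theorem types (h : RigidCore s t B α β) {x a : ℤ} (ha : 0 < a) (hta : t ∣ a) (hx : x ∈ B)
    (hxa : x - a ∉ B) : (2 * x + 1 = s ∧ -1 - x - a ∈ B) ∨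
      (2 * (x - a) + 1 = -s ∧ x - 2 * a ∈ B) ∨ (2 * x + 1 = a ∧ a = t) := by
  rcases h.types_aux ha hta hx hxa with ⟨h1, h2⟩ | ⟨h1, h2⟩ | h1
  · exact Or.inl ⟨h.eq_of_dvd hx h1 (h.not_neg_of_type ha hta hx hxa h1 h2), h2⟩
  · right; left
    refine ⟨?_, h2⟩
    have hb := h.rigid.symm.notMem_iff.1 hxa
    have hd : s ∣ 2 * (-1 - (x - a)) + 1 := by
      rw [show 2 * (-1 - (x - a)) + 1 = -(2 * (x - a) + 1) by ring, dvd_neg]; exact h1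
    have := h.eq_of_dvd hb hd (h.not_neg_of_type ha hta hb
      (by rw [show -1 - (x - a) - a = -1 - x by ring]; exact (h.rigid.symm.mem_iff x).1 hx) hd
      (by rw [show -1 - (-1 - (x - a)) - a = x - 2 * a by ring]; exact h2))
    linarith
  · have := h.swap.eq_of_dvd hx (by rw [h1]; exact hta) (by omega)
    exact Or.inr (Or.inr ⟨h1, by omega⟩)

end RigidCore

end Types

section Relations

/-- `α` arises from `β` by replacing one element `b` by its reflection, where `-1 - 2 * b ≡ t`
modulo `2 * s`. -/
def FlipRel (s t : ℤ) (α β : Set ℤ) : Prop :=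
  ∃ b ∈ β \ α, bar b - b ≡ t [ZMOD 2 * s] ∧ α = (β \ {b}) ∪ {bar b}

/-- `α` arises from `β` by replacing two elements by their reflections. -/
structure DoubleFlipRel (s t : ℤ) (α β : Set ℤ) (b c : ℤ) : Prop where
  ne : b ≠ c
  left_mem : b ∈ β \ α
  right_mem : c ∈ β \ α
  left_modEq : bar b - b ≡ t [ZMOD 2 * s]
  right_modEq : bar c - c ≡ -s [ZMOD 2 * t]
  eq : α = (β \ {b, c}) ∪ {bar b, bar c}

/-- The list of situations in which there is a unique symmetric set. -/
def Exceptional (s t : ℤ) (α β : Set ℤ) (n : ℤ) : Prop :=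
  (α = β ∧ n = energy α) ∨
  (Odd t ∧ FlipRel s t α β ∧ n = energy β + t) ∨
  (Odd s ∧ FlipRel t s β α ∧ n = energy α + s) ∨
  (Odd s ∧ Odd t ∧ ∃ b c, DoubleFlipRel s t α β b c ∧ n = energy ((β \ {c}) ∪ {bar c}) + s + t) ∨
  (Odd s ∧ Odd t ∧ (∀ x, 2 * x + 1 = s + t - s * t → x ∉ α) ∧ α = β ∧ n = energy α + s * t)

theorem flip_singleton (A : Set ℤ) (b : ℤ) : flip A {b} = (A \ {b}) ∪ {bar b} := by
  ext k
  simp only [mem_flip, Finset.mem_singleton, Set.mem_union, Set.mem_sdiff, Set.mem_singleton_iff,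
    bar]
  refine or_congr Iff.rfl ?_
  omega

theorem flip_flip {A : Set ℤ} (hA : Symm A) {x : ℤ} (hx : x ∈ A) :
    flip (flip A {x}) {-1 - x} = A := by
  ext k
  simp only [mem_flip, Finset.mem_singleton]
  have h1 := (hA.mem_iff x).1 hx
  by_cases hk : k = x
  · subst hk; simp [hx]
  · by_cases hk' : k = -1 - x
    · subst hk'; simp [h1]; omega
    · have h2 : ¬ -1 - k = x := by omega
      have h3 : ¬ -1 - k = -1 - x := by omega
      simp [hk, hk', h2, h3]

theorem Symm.flip_one {A : Set ℤ} (hA : Symm A) {x : ℤ} (hx : x ∈ A) :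
    Symm (CorePartitions.flip A {x}) :=
  hA.flip (by simpa using hx)

theorem energy_flip_one {A : Set ℤ} (hA : Symm A) {x : ℤ} (hx : x ∈ A) :
    energy (flip A {x}) = energy A - (2 * x + 1) := by
  rw [energy_flip hA (by simpa using hx), Finset.sum_singleton]

theorem sameCharge_flip_one {m : ℤ} {A : Set ℤ} (hA : Symm A) {x : ℤ} (hx : x ∈ A)
    (h : m ∣ 2 * x + 1) : SameCharge m (flip A {x}) A :=
  sameCharge_flip hA (by simpa using hx) (by simpa using h)

theorem mem_flip_one {A : Set ℤ} {x k : ℤ} :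
    k ∈ flip A {x} ↔ (k ∈ A ∧ k ≠ x) ∨ k = -1 - x := by
  simp only [mem_flip, Finset.mem_singleton]
  refine or_congr Iff.rfl ?_
  omega

/-- A symmetric `s`-core contains no nonnegative `x` with `s ∣ 2 * x + 1`. -/
theorem CoreSet.notMem_of_dvd {s : ℤ} (hs : 0 < s) {A : Set ℤ} (hA : Symm A) (h : CoreSet s A)
    {x : ℤ} (hx : 0 < 2 * x + 1) (hd : s ∣ 2 * x + 1) : x ∉ A := fun hxA =>
  (hA.mem_iff x).1 hxA (h.mem_of_le hs hxA (by omega)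
    (by rwa [show x - (-1 - x) = 2 * x + 1 by ring]))

/-- The `s`-core of the set obtained from an `s`-core by flipping `-t` to `t`. -/
theorem exists_flip_eq_core {s t : ℤ} (hs : 0 < s) (hst : ¬ s ∣ t) {α β : Set ℤ} (hα : Symm α)
    (hβ : Symm β) (hαs : CoreSet s α) (hβs : CoreSet s β) {x : ℤ} (hx : 2 * x + 1 = t)
    (hxβ : x ∉ β) (hc : SameCharge s α (flip β {-1 - x})) :
    ∃ b ∈ β, s ∣ b + 1 + x ∧ b + s ∉ β ∧ α = flip β {b} := by
  obtain ⟨b, hb1, hb2, hb3⟩ := hβ.isMaya.exists_top hs (-1 - x)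
  have hd : s ∣ b + 1 + x := by rwa [show b + 1 + x = b - (-1 - x) by ring]
  have hbs : b + s ∉ β := hb3 _ (by omega) (by
    obtain ⟨c, hc⟩ := hb1; exact ⟨c + 1, by linarith⟩)
  have hxβ' : -1 - x ∈ β := hβ.notMem_iff.1 hxβ
  have hnb : ¬ s ∣ 2 * b + 1 := fun h => hst (by
    obtain ⟨c, hc⟩ := h; obtain ⟨d, hd⟩ := hd; exact ⟨2 * d - c, by linarith⟩)
  refine ⟨b, hb2, hd, hbs, CoreSet.eq_of_sameCharge hs hα.isMaya (hβ.flip_one hb2).isMaya hαs ?_ ?_⟩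
  · intro k hk
    rw [mem_flip_one] at hk ⊢
    rcases hk with ⟨h1, h2⟩ | rfl
    · refine Or.inl ⟨hβs k h1, fun he => hbs ?_⟩
      rwa [show b + s = k by omega]
    · refine Or.inl ⟨?_, fun he => hnb ⟨-1, by linarith⟩⟩
      have := hβ.notMem_iff.1 hbs
      rwa [show -1 - (b + s) = -1 - b - s by ring] at this
  · refine hc.trans hα.isMaya (hβ.flip_one hxβ').isMaya (hβ.flip_one hb2).isMaya fun u hu => ?_
    rw [← dif_add_dif (hβ.flip_one hxβ').isMaya hβ.isMaya (hβ.flip_one hb2).isMaya,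
      dif_comm (flip β {b}), dif_flip hβ (by simpa using hxβ'), dif_flip hβ (by simpa using hb2),
      Finset.sum_singleton, Finset.sum_singleton,
      apply_eq_of_dvd_sub hu (k := -1 - x) (l := b)
        (by obtain ⟨d, hd⟩ := hd; exact ⟨-d, by linarith⟩),
      apply_eq_of_dvd_sub hu (k := -1 - (-1 - x)) (l := -1 - b)
        (by obtain ⟨d, hd⟩ := hd; exact ⟨d, by linarith⟩)]
    ring

theorem modEq_of_dvd {s t b x : ℤ} (hx : 2 * x + 1 = t) (h : s ∣ b + 1 + x) :
    bar b - b ≡ t [ZMOD 2 * s] := by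
  rw [Int.modEq_iff_dvd]
  obtain ⟨d, hd⟩ := h
  exact ⟨d, by simp only [bar]; linarith⟩

theorem flipRel_of_flip {s t : ℤ} {α β : Set ℤ} {x b : ℤ} (hx : 2 * x + 1 = t)
    (hb : b ∈ β) (hd : s ∣ b + 1 + x) (h : α = flip β {b}) : FlipRel s t α β := by
  refine ⟨b, ⟨hb, ?_⟩, modEq_of_dvd hx hd, by rw [h, flip_singleton]⟩
  rw [h, mem_flip_one]
  rintro (h1 | h1)
  · exact h1.2 rfl
  · omega

end Relations

section Necessity

variable {s t : ℤ} {B α β : Set ℤ}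

namespace RigidCore

theorem eq_core (h : RigidCore s t B α β) (hB : CoreSet s B) : B = α :=
  CoreSet.eq_of_sameCharge h.pos h.rigid.symm.isMaya h.symm_left.isMaya hB h.left_left h.charge_left

/-- If neither `s` nor `t` occurs, the set is a core. -/
theorem coreSet_of_notMem (h : RigidCore s t B α β) (hS : ∀ x, 2 * x + 1 = s → x ∉ B)
    (hT : ∀ x, 2 * x + 1 = t → x ∉ B) : CoreSet t B := by
  intro k hk
  by_contra hkt
  rcases h.types h.swap.pos dvd_rfl hk hkt with h1 | h1 | h1
  · exact hS k h1.1 hk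
  · exact hS (-1 - (k - t)) (by linarith) (h.rigid.symm.notMem_iff.1 hkt)
  · exact hT k h1.1 hk

/-- If `t` occurs and `s` does not, flipping `t` gives a `t`-core. -/
theorem coreSet_flip (h : RigidCore s t B α β) (hS : ∀ x, 2 * x + 1 = s → x ∉ B) {x : ℤ}
    (hx : 2 * x + 1 = t) : CoreSet t (flip B {x}) := by
  have ht := h.swap.pos
  have h3 : x + t ∉ B := fun hm => by
    have := h.swap.eq_of_dvd hm ⟨3, by linarith⟩ (by omega)
    omega
  intro k hk
  rw [mem_flip_one] at hk ⊢
  rcases hk with ⟨h1, h2⟩ | rfl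
  · refine Or.inl ⟨?_, fun he => h3 (by rwa [show x + t = k by omega])⟩
    by_contra hkt
    rcases h.types ht dvd_rfl h1 hkt with h4 | h4 | h4
    · exact hS k h4.1 h1
    · exact hS (-1 - (k - t)) (by linarith) (h.rigid.symm.notMem_iff.1 hkt)
    · omega
  · refine Or.inl ⟨?_, by omega⟩
    have := h.rigid.symm.notMem_iff.1 h3
    rwa [show -1 - (x + t) = -1 - x - t by ring] at this

theorem flipRel (h : RigidCore s t B α β) (hS : ∀ x, 2 * x + 1 = s → x ∉ B) {x : ℤ}
    (hx : 2 * x + 1 = t) (hxB : x ∈ B) : FlipRel s t α β ∧ energy B = energy β + t := by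
  have hsym := h.rigid.symm
  have hβ : flip B {x} = β := CoreSet.eq_of_sameCharge h.swap.pos (hsym.flip_one hxB).isMaya
    h.symm_right.isMaya (h.coreSet_flip hS hx) h.right_right
    ((sameCharge_flip_one hsym hxB (by rw [hx])).trans (hsym.flip_one hxB).isMaya hsym.isMaya
      h.symm_right.isMaya h.charge_right)
  constructor
  · have hxβ : x ∉ β := h.right_right.notMem_of_dvd h.swap.pos h.symm_right
      (by have := h.swap.pos; omega) (by rw [hx])
    obtain ⟨b, hb1, hb2, hb3, hb4⟩ := exists_flip_eq_core h.pos h.not_dvd h.symm_left h.symm_right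
      h.left_left h.right_left hx hxβ (by rw [← hβ, flip_flip hsym hxB]; exact h.charge_left.symm)
    exact flipRel_of_flip hx hb1 hb2 hb4
  · have := energy_flip_one hsym hxB
    rw [hβ] at this
    omega

theorem add_notMem (h : RigidCore s t B α β) {x : ℤ} (hx : 2 * x + 1 = t) (hxB : x ∈ B) :
    x + s ∉ B := by
  intro hm
  have hs := h.pos
  have ht := h.swap.pos
  have hnd := h.not_dvd
  have hne : t ≠ s := fun he => hnd (by rw [he])
  have hne3 : t ≠ 3 * s := fun he => hnd ⟨3, by linarith⟩
  by_cases h1 : x - s ∈ B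
  · have h2 : x + s - t ∉ B := by
      have := (h.rigid.symm.mem_iff _).1 h1
      rwa [show -1 - (x - s) = x + s - t by linarith] at this
    rcases h.types ht dvd_rfl hm h2 with h4 | h4 | h4 <;> omega
  · rcases h.swap.types hs dvd_rfl hxB h1 with h4 | h4 | h4
    · have := (h.rigid.symm.mem_iff _).1 h4.2
      rw [show -1 - (-1 - x - s) = x + s by ring] at this
      exact this hm
    · omega
    · omega

/-- If `s` and `t` occur, flipping both gives an `s`-core. -/
theorem coreSet_flip_pair (h : RigidCore s t B α β) {x y : ℤ} (hx : 2 * x + 1 = t)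
    (hxB : x ∈ B) (hy : 2 * y + 1 = s) : CoreSet s (flip B {x, y}) := by
  have hs := h.pos
  have ht := h.swap.pos
  have hnd := h.not_dvd
  have hne : t ≠ s := fun he => hnd (by rw [he])
  have h3 : y + s ∉ B := fun hm => by
    have := h.eq_of_dvd hm ⟨3, by linarith⟩ (by omega)
    omega
  have h4 := h.add_notMem hx hxB
  intro k hk
  rw [mem_flip] at hk ⊢
  simp only [Finset.mem_insert, Finset.mem_singleton, not_or] at hk ⊢
  rcases hk with ⟨h1, h2, h2'⟩ | hk | hk
  · by_cases hb : -1 - (k - s) = x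
    · exact Or.inr (Or.inl hb)
    · refine Or.inl ⟨?_, fun he => h4 (by rwa [show x + s = k by omega]),
        fun he => h3 (by rwa [show y + s = k by omega])⟩
      by_contra hks
      rcases h.swap.types hs dvd_rfl h1 hks with h5 | h5 | h5
      · omega
      · omega
      · omega
  · refine Or.inl ⟨?_, by omega, by omega⟩
    have := h.rigid.symm.notMem_iff.1 h4
    rwa [show -1 - (x + s) = k - s by omega] at this
  · refine Or.inl ⟨?_, by omega, by omega⟩
    have := h.rigid.symm.notMem_iff.1 h3
    rwa [show -1 - (y + s) = k - s by omega] at this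

theorem doubleFlipRel (h : RigidCore s t B α β) {x y : ℤ} (hx : 2 * x + 1 = t) (hxB : x ∈ B)
    (hy : 2 * y + 1 = s) (hyB : y ∈ B) :
    ∃ b c, DoubleFlipRel s t α β b c ∧ energy B = energy ((β \ {c}) ∪ {bar c}) + s + t := by
  have hs := h.pos
  have ht := h.swap.pos
  have hnd := h.not_dvd
  have hsym := h.rigid.symm
  have hxy : x ≠ y := fun he => hnd ⟨1, by rw [← hx, ← hy, he]; ring⟩
  set υ := flip B {x, y} with hυ
  have hF : ∀ k ∈ ({x, y} : Finset ℤ), k ∈ B := by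
    intro k hk
    simp only [Finset.mem_insert, Finset.mem_singleton] at hk
    rcases hk with rfl | rfl <;> assumption
  have hυsym : Symm υ := hsym.flip hF
  have hυs : CoreSet s υ := h.coreSet_flip_pair hx hxB hy
  have hυt : CoreSet t υ := by
    rw [hυ, Finset.pair_comm]
    exact h.swap.coreSet_flip_pair hy hyB hx
  have hυE : energy υ = energy B - s - t := by
    rw [energy_flip hsym hF, Finset.sum_pair hxy]
    omega
  have hxυ : x ∉ υ := hυt.notMem_of_dvd ht hυsym (by omega) (by rw [hx])
  have hyυ : y ∉ υ := hυs.notMem_of_dvd hs hυsym (by omega) (by rw [hy])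
  have hmem : ∀ k, k ∈ υ ↔ (k ∈ B ∧ k ≠ x ∧ k ≠ y) ∨ k = -1 - x ∨ k = -1 - y := fun k => by
    rw [hυ, mem_flip]
    simp only [Finset.mem_insert, Finset.mem_singleton, not_or]
    refine or_congr Iff.rfl ?_
    omega
  have hyB' := (hsym.mem_iff y).1 hyB
  have hxB' := (hsym.mem_iff x).1 hxB
  have e1 : flip υ {-1 - x} = flip B {y} := by
    ext k
    rw [mem_flip_one, mem_flip_one, hmem, show -1 - (-1 - x) = x by ring]
    by_cases h1 : k = x
    · subst h1; simp [hxB, hxy]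
    · by_cases h2 : k = -1 - x
      · subst h2; simp [hxB', hxy]; omega
      · simp [h1, h2]
  have e2 : flip υ {-1 - y} = flip B {x} := by
    ext k
    rw [mem_flip_one, mem_flip_one, hmem, show -1 - (-1 - y) = y by ring]
    by_cases h1 : k = y
    · subst h1; simp [hyB, hxy.symm]
    · by_cases h2 : k = -1 - y
      · subst h2; simp [hyB']; omega
      · simp [h1, h2]
  obtain ⟨b, hb1, hb2, hb3, hb4⟩ := exists_flip_eq_core hs hnd h.symm_left hυsym h.left_left hυs hx
    hxυ (by
      rw [e1]
      exact h.charge_left.symm.trans h.symm_left.isMaya hsym.isMaya (hsym.flip_one hyB).isMaya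
        (sameCharge_flip_one hsym hyB (by rw [hy])).symm)
  obtain ⟨d, hd1, hd2, hd3, hd4⟩ := exists_flip_eq_core ht h.swap.not_dvd h.symm_right hυsym
    h.right_right hυt hy hyυ (by
      rw [e2]
      exact h.charge_right.symm.trans h.symm_right.isMaya hsym.isMaya (hsym.flip_one hxB).isMaya
        (sameCharge_flip_one hsym hxB (by rw [hx])).symm)
  have hbd : b ≠ d := by
    intro hbd
    have hαβ : α = β := by rw [hb4, hd4, hbd]
    have hαE : energy α = energy υ - (2 * b + 1) := by rw [hb4, energy_flip_one hυsym hb1]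
    have hbx : -1 - x ≤ b := by
      by_contra hlt
      have := hυs.mem_of_le (k := -1 - x) (l := b + s) hs (hυsym.notMem_iff.1 hxυ)
        (by
          obtain ⟨c, hc⟩ := hb2
          have : c < 0 := by
            by_contra hc0
            nlinarith
          nlinarith)
        (by obtain ⟨c, hc⟩ := hb2; exact ⟨-c - 1, by linarith⟩)
      exact hb3 this
    obtain ⟨w, hw⟩ : ∃ w, s + t + (2 * b + 1) = 2 * w + 1 := ⟨y + x + b + 1, by linarith⟩
    have hws : s ∣ 2 * w + 1 := by
      obtain ⟨c, hc⟩ := hb2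
      exact ⟨1 + 2 * c, by linarith⟩
    have hwt : t ∣ 2 * w + 1 := by
      rw [hbd] at hw
      obtain ⟨c, hc⟩ := hd2
      exact ⟨1 + 2 * c, by linarith⟩
    have hw0 : 0 < 2 * w + 1 := by omega
    have hwα : -1 - w ∈ α := h.symm_left.notMem_iff.1
      (h.left_left.notMem_of_dvd hs h.symm_left hw0 hws)
    have hwd : ∀ m, m ∣ 2 * w + 1 → m ∣ 2 * (-1 - w) + 1 := fun m hm => by
      rwa [show 2 * (-1 - w) + 1 = -(2 * w + 1) by ring, dvd_neg]
    have hfs := h.symm_left.flip_one hwα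
    have heq := h.rigid.eq _ hfs
      ((sameCharge_flip_one h.symm_left hwα (hwd s hws)).trans hfs.isMaya h.symm_left.isMaya
        hsym.isMaya h.charge_left.symm)
      ((sameCharge_flip_one h.symm_left hwα (hwd t hwt)).trans hfs.isMaya h.symm_left.isMaya
        hsym.isMaya (hαβ ▸ h.charge_right.symm))
      (by rw [energy_flip_one h.symm_left hwα]; omega)
    have hwB : w ∈ B := by
      rw [← heq, mem_flip_one]
      right; ring
    have := h.sub_mem hwB hw0.le hws hwt
    rw [show w - (2 * w + 1) = -1 - w by ring] at this
    exact (hsym.mem_iff w).1 hwB this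
  have hmα : ∀ k, k ∈ α ↔ (k ∈ υ ∧ k ≠ b) ∨ k = -1 - b := fun k => by rw [hb4, mem_flip_one]
  have hmβ : ∀ k, k ∈ β ↔ (k ∈ υ ∧ k ≠ d) ∨ k = -1 - d := fun k => by rw [hd4, mem_flip_one]
  have hd1' := (hυsym.mem_iff d).1 hd1
  have hb1' := (hυsym.mem_iff b).1 hb1
  have hbd' : b ≠ -1 - d := fun he => hd1' (he ▸ hb1)
  refine ⟨b, -1 - d, ⟨hbd', ⟨(hmβ b).2 (Or.inl ⟨hb1, hbd⟩), ?_⟩, ⟨(hmβ _).2 (Or.inr rfl), ?_⟩,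
    modEq_of_dvd hx hb2, ?_, ?_⟩, ?_⟩
  · rw [hmα]; omega
  · rw [hmα]
    rintro (h1 | h1)
    · exact hd1' h1.1
    · omega
  · have := (modEq_of_dvd hy hd2).neg
    simp only [bar] at this ⊢
    convert this using 1
    ring
  · ext k
    simp only [hmα, hmβ, Set.mem_union, Set.mem_sdiff, Set.mem_insert_iff, Set.mem_singleton_iff,
      bar, not_or, show -1 - (-1 - d) = d by ring]
    by_cases h1 : k = d
    · subst h1; simp [hd1, hbd.symm]
    · by_cases h2 : k = -1 - d
      · subst h2; simp [hd1']; omega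
      · simp [h1, h2]
  · have : (β \ {-1 - d}) ∪ {bar (-1 - d)} = υ := by
      rw [← flip_singleton, hd4, flip_flip hυsym hd1]
    rw [this]
    omega

/-- If `t` occurs, then `t - 2 * s` does not. -/
theorem sub_notMem (h : RigidCore s t B α β) {x : ℤ} (hx : 2 * x + 1 = t) (hxB : x ∈ B) :
    x - s ∉ B := by
  have hs := h.pos
  have ht := h.swap.pos
  have hnd := h.not_dvd
  have hsym := h.rigid.symm
  have hbx : x - t ∉ B := by
    have := (hsym.mem_iff x).1 hxB
    rwa [show -1 - x = x - t by omega] at this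
  obtain ⟨P, N, hP, hN, hcard⟩ := exists_finset_card_le ht hsym.isMaya
    h.symm_left.isMaya h.left_right h.charge_left ht.le dvd_rfl x
  obtain ⟨y, hy⟩ : N.Nonempty := by
    rw [← Finset.card_pos]
    have := Finset.card_pos.2 ⟨x, (hP x).2 ⟨by simp, hxB, hbx⟩⟩
    omega
  obtain ⟨h1, h2, h3⟩ := (hN y).1 hy
  rcases lt_or_ge x y with hlt | hge
  · obtain ⟨z, hz1, hz2, hz3, hz4, hz5⟩ := exists_step hs hbx h3 (by omega)
      (by obtain ⟨c, hc⟩ := h1; exact ⟨c, by linarith⟩)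
    obtain ⟨c, hc⟩ := hz3
    rcases h.swap.types hs dvd_rfl hz1 hz2 with g | g | g
    · exact absurd (⟨c, by linarith⟩ : s ∣ t) hnd
    · have := (hsym.mem_iff z).1 hz1
      rwa [show -1 - z = x - s by omega] at this
    · exact absurd (⟨2 * c - 1, by linarith⟩ : s ∣ t) hnd
  · obtain ⟨z, hz1, hz2, hz3, hz4, hz5⟩ := exists_step hs h2 hxB hge
      (by obtain ⟨c, hc⟩ := h1; exact ⟨-c, by linarith⟩)
    obtain ⟨c, hc⟩ := hz3
    obtain ⟨d, hd⟩ := h1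
    rcases h.swap.types hs dvd_rfl hz1 hz2 with g | g | g
    · rwa [show x - s = z - s by omega]
    · exact absurd (⟨1 - c - d, by linarith⟩ : s ∣ t) hnd
    · exact absurd (⟨1 - 2 * c - 2 * d, by linarith⟩ : s ∣ t) hnd

theorem exceptional (h : RigidCore s t B α β) : Exceptional s t α β (energy B) := by
  by_cases hT : ∃ x, 2 * x + 1 = t ∧ x ∈ B
  · obtain ⟨x, hx, hxB⟩ := hT
    have hot : Odd t := ⟨x, hx.symm⟩
    by_cases hS : ∃ y, 2 * y + 1 = s ∧ y ∈ B
    · obtain ⟨y, hy, hyB⟩ := hS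
      exact Or.inr (Or.inr (Or.inr (Or.inl ⟨⟨y, hy.symm⟩, hot, h.doubleFlipRel hx hxB hy hyB⟩)))
    · push Not at hS
      exact Or.inr (Or.inl ⟨hot, h.flipRel hS hx hxB⟩)
  · push Not at hT
    by_cases hS : ∃ y, 2 * y + 1 = s ∧ y ∈ B
    · obtain ⟨y, hy, hyB⟩ := hS
      exact Or.inr (Or.inr (Or.inl ⟨⟨y, hy.symm⟩, h.swap.flipRel hT hy hyB⟩))
    · push Not at hS
      have h1 := h.swap.eq_core (h.coreSet_of_notMem hS hT)
      have h2 := h.eq_core (h.swap.coreSet_of_notMem hT hS)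
      exact Or.inl ⟨h2.symm.trans h1, by rw [h2]⟩

end RigidCore

end Necessity

section WeightOne

variable {s t : ℤ}

theorem six_le_mul (hs : 1 < s) (ht : 1 < t) (hst : IsCoprime s t) : 6 ≤ s * t := by
  have hne : s ≠ t := by
    rintro rfl
    rcases Int.isUnit_iff.1 (isCoprime_self.1 hst) with h | h <;> omega
  rcases lt_or_gt_of_ne hne with h | h <;> nlinarith

namespace Rigid

variable {B : Set ℤ} {x : ℤ}

theorem add_notMem (h : Rigid s t B) (hm : 6 ≤ s * t) (hx : 2 * x + 1 = s * t) (hxB : x ∈ B) :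
    x + s * t ∉ B := by
  intro hmem
  have := h.eq_of_sub_notMem hm (dvd_mul_right s t) (dvd_mul_left t s) (c := 2 * (s * t))
    (by omega) (dvd_mul_left _ _) hmem (by
      rw [show x + s * t - 2 * (s * t) = -1 - x by omega]
      exact (h.symm.mem_iff x).1 hxB)
  omega

theorem coreSet_flip (h : Rigid s t B) (hm : 6 ≤ s * t) (hx : 2 * x + 1 = s * t) (hxB : x ∈ B) :
    CoreSet (s * t) (flip B {x}) := by
  have h1 := h.add_notMem hm hx hxB
  intro k hk
  rw [mem_flip_one] at hk ⊢
  rcases hk with ⟨hk, hkx⟩ | rfl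
  · refine Or.inl ⟨?_, fun he => h1 (by rwa [show x + s * t = k by omega])⟩
    by_contra hkm
    have := h.eq_of_sub_notMem hm (dvd_mul_right s t) (dvd_mul_left t s) (by omega) dvd_rfl hk hkm
    omega
  · refine Or.inl ⟨?_, by omega⟩
    have := h.symm.notMem_iff.1 h1
    rwa [show -1 - (x + s * t) = -1 - x - s * t by ring] at this

/-- Flipping `s * t` in a rigid set gives a rigid set. -/
theorem flip_mul (h : Rigid s t B) (hm : 6 ≤ s * t) (hx : 2 * x + 1 = s * t) (hxB : x ∈ B) :
    Rigid s t (flip B {x}) := by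
  have hsym := h.symm
  have hρ := hsym.flip_one hxB
  have hE := energy_flip_one hsym hxB
  refine ⟨hρ, fun C hC hCs hCt hCE => ?_⟩
  have charge : ∀ q : ℤ, q ∣ s * t → SameCharge q C (flip B {x}) → SameCharge q C B :=
    fun q hq hc => hc.trans hC.isMaya hρ.isMaya hsym.isMaya
      (sameCharge_flip_one hsym hxB (by rwa [hx]))
  have hs : s ∣ s * t := dvd_mul_right s t
  have ht : t ∣ s * t := dvd_mul_left t s
  by_cases hxC : x ∈ C
  · exfalso
    obtain ⟨r, -, -, hr⟩ := exists_small_class hm x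
    have hC' := hC.flip_one hxC
    obtain ⟨y, ⟨d, hd⟩, hy, htop⟩ := hC'.isMaya.exists_top (m := s * t) (by omega) r
    have hym : y + s * t ∉ flip C {x} := htop _ (by omega) ⟨d + 1, by linarith⟩
    have hym' := hC'.notMem_iff.1 hym
    have hne : y ≠ -1 - (y + s * t) := fun he => hr ⟨-1 - 2 * d, by linarith⟩
    have hF : ∀ k ∈ ({y, -1 - (y + s * t)} : Finset ℤ), k ∈ flip C {x} := by
      intro k hk
      simp only [Finset.mem_insert, Finset.mem_singleton] at hk
      rcases hk with rfl | rfl <;> assumption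
    have hC'' := hC'.flip hF
    have charge' : ∀ q : ℤ, q ∣ s * t → SameCharge q C (flip B {x}) →
        SameCharge q (flip (flip C {x}) {y, -1 - (y + s * t)}) B := by
      intro q hq hc
      refine SameCharge.trans hC''.isMaya hC'.isMaya hsym.isMaya (fun u hu => ?_)
        ((sameCharge_flip_one hC hxC (by rwa [hx])).trans hC'.isMaya hC.isMaya hsym.isMaya
          (charge q hq hc))
      rw [dif_flip hC' hF, Finset.sum_pair hne,
        apply_eq_of_dvd_sub hu (k := -1 - (-1 - (y + s * t))) (l := y)
          (by rwa [show -1 - (-1 - (y + s * t)) - y = s * t by ring]),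
        apply_eq_of_dvd_sub hu (k := -1 - (y + s * t)) (l := -1 - y)
          (by rwa [show -1 - (y + s * t) - (-1 - y) = -(s * t) by ring, dvd_neg])]
      ring
    have heq := h.eq _ hC'' (charge' s hs hCs) (charge' t ht hCt) (by
      rw [energy_flip hC' hF, Finset.sum_pair hne, energy_flip_one hC hxC]
      linarith)
    have h1 : y + s * t ∈ B := by
      rw [← heq, mem_flip]
      right; simp
    have h2 : y + s * t - s * t ∉ B := by
      rw [add_sub_cancel_right, ← heq, mem_flip]
      rintro (g | g)
      · exact g.2 (by simp)
      · simp only [Finset.mem_insert, Finset.mem_singleton] at g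
        rcases g with g | g <;> omega
    have h3 := h.eq_of_sub_notMem hm hs ht (by omega) dvd_rfl h1 h2
    exact hr ⟨-1 - 2 * d, by linarith⟩
  · have hxC' := hC.notMem_iff.1 hxC
    have hC' := hC.flip_one hxC'
    have charge' : ∀ q : ℤ, q ∣ s * t → SameCharge q C (flip B {x}) →
        SameCharge q (flip C {-1 - x}) B := fun q hq hc =>
      (sameCharge_flip_one hC hxC' (by
        rwa [show 2 * (-1 - x) + 1 = -(s * t) by linarith, dvd_neg])).trans hC'.isMaya hC.isMaya
          hsym.isMaya (charge q hq hc)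
    have heq := h.eq _ hC' (charge' s hs hCs) (charge' t ht hCt) (by
      rw [energy_flip_one hC hxC']; linarith)
    have h1 := flip_flip hC hxC'
    rw [heq, show -1 - (-1 - x) = x by ring] at h1
    exact h1.symm

end Rigid

variable {B α β : Set ℤ}

/-- If a rigid set contains `s * t`, then after flipping this element, `t` does not occur. -/
theorem RigidCore.notMem_of_mul {x : ℤ} (hB : Rigid s t B) (hx : 2 * x + 1 = s * t) (hxB : x ∈ B)
    (h : RigidCore s t (flip B {x}) α β) {y : ℤ} (hy : 2 * y + 1 = t) : y ∉ flip B {x} := by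
  intro hyρ
  have hs := h.pos
  have ht := h.swap.pos
  have hs1 := h.one_lt_left
  have hnd := h.not_dvd
  have hm := six_le_mul h.one_lt_left h.one_lt_right h.coprime
  have h1 := h.sub_notMem hy hyρ
  have hyx : y ≠ x := fun he => by
    have : s * t = t := by rw [← hx, ← hy, he]
    nlinarith
  have hyB : y ∈ B := by
    rw [mem_flip_one] at hyρ
    rcases hyρ with g | g
    · exact g.1
    · omega
  have hlt : t < s * t := by nlinarith
  have hysB : y - s ∉ B := fun hmem => h1 (mem_flip_one.2 (Or.inl ⟨hmem, by omega⟩))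
  have hxs : x + s ∉ flip B {x} := fun hmem => by
    have := h.eq_of_dvd hmem ⟨t + 2, by linarith⟩ (by omega)
    omega
  have hxsB : -1 - (x + s) ∈ B := by
    have := h.rigid.symm.notMem_iff.1 hxs
    rw [mem_flip_one] at this
    rcases this with g | g
    · exact g.1
    · omega
  obtain ⟨w, hw⟩ : ∃ w, s = 2 * w + 1 := by
    have : Odd (s * t) := ⟨x, hx.symm⟩
    exact (Int.odd_mul.1 this).1
  have hw0 : 0 < w := by omega
  have hwt : 0 < w * t := mul_pos hw0 ht
  have hst : s * t = 2 * (w * t) + t := by rw [hw]; ring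
  have e : -1 - x - y = -(w * t) - t := by omega
  have hne : -s ≠ -1 - x - y := fun he => by
    rw [e] at he
    exact hnd ⟨2 - t, by linarith⟩
  rcases hB.rectangle (p := y) (a := -s) (b := -1 - x - y) (dvd_neg.2 dvd_rfl)
    ⟨-w - 1, by rw [e]; ring⟩ hne (by omega) hyB
    (by rwa [show y + -s + (-1 - x - y) = -1 - (x + s) by ring])
    (by rwa [show y + -s = y - s by ring])
    (by rw [show y + (-1 - x - y) = -1 - x by ring]; exact (hB.symm.mem_iff x).1 hxB)
    with g | g | g | g
  · exact hnd ⟨1, by linarith⟩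
  · omega
  · omega
  · omega

/-- The data of a rigid set with cores that are both `s`-cores and `t`-cores. -/
theorem Rigid.exceptional (hs : 1 < s) (ht : 1 < t) (hst : IsCoprime s t) (hα : Symm α)
    (hβ : Symm β) (hαs : CoreSet s α) (hαt : CoreSet t α) (hβs : CoreSet s β) (hβt : CoreSet t β)
    (hB : Rigid s t B) (hBα : SameCharge s B α) (hBβ : SameCharge t B β) :
    Exceptional s t α β (energy B) := by
  have hm := six_le_mul hs ht hst
  by_cases hcore : CoreSet (s * t) B
  · exact RigidCore.exceptional ⟨hs, ht, hst, hB, hcore, hα, hβ, hαs, hαt, hβs, hβt, hBα, hBβ⟩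
  have hsym := hB.symm
  unfold CoreSet at hcore
  push Not at hcore
  obtain ⟨x, hxB, hxm⟩ := hcore
  have hx := hB.eq_of_sub_notMem hm (dvd_mul_right s t) (dvd_mul_left t s) (by omega) dvd_rfl hxB hxm
  have hρ := hsym.flip_one hxB
  have h : RigidCore s t (flip B {x}) α β := ⟨hs, ht, hst, hB.flip_mul hm hx hxB,
    hB.coreSet_flip hm hx hxB, hα, hβ, hαs, hαt, hβs, hβt,
    (sameCharge_flip_one hsym hxB (by rw [hx]; exact dvd_mul_right s t)).trans hρ.isMaya
      hsym.isMaya hα.isMaya hBα,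
    (sameCharge_flip_one hsym hxB (by rw [hx]; exact dvd_mul_left t s)).trans hρ.isMaya
      hsym.isMaya hβ.isMaya hBβ⟩
  have hT : ∀ y, 2 * y + 1 = t → y ∉ flip B {x} := fun y hy => h.notMem_of_mul hB hx hxB hy
  have hS : ∀ y, 2 * y + 1 = s → y ∉ flip B {x} := fun y hy =>
    h.swap.notMem_of_mul hB.swap (by rw [hx, mul_comm]) hxB hy
  have h1 := h.swap.eq_core (h.coreSet_of_notMem hS hT)
  have h2 := h.eq_core (h.swap.coreSet_of_notMem hT hS)
  have hodd : Odd (s * t) := ⟨x, hx.symm⟩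
  obtain ⟨hos, hot⟩ := Int.odd_mul.1 hodd
  have hE := energy_flip_one hsym hxB
  rw [h2, hx] at hE
  refine Or.inr (Or.inr (Or.inr (Or.inr ⟨hos, hot, fun z hz hzα => ?_, h2.symm.trans h1, by omega⟩)))
  obtain ⟨v, hv⟩ := hos
  obtain ⟨w, hw⟩ := hot
  have hls : s < s * t := by nlinarith
  have hlt : t < s * t := by nlinarith
  have hzB : z ∈ B := by
    rw [← h2, mem_flip_one] at hzα
    rcases hzα with g | g
    · exact g.1
    · omega
  have hvB : v ∉ B := fun hmem => hS v (by omega) (mem_flip_one.2 (Or.inl ⟨hmem, by omega⟩))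
  have hwB : w ∉ B := fun hmem => hT w (by omega) (mem_flip_one.2 (Or.inl ⟨hmem, by omega⟩))
  have e1 : s * t = 2 * (s * w) + s := by rw [hw]; ring
  have e2 : s * t = 2 * (v * t) + t := by rw [hv]; ring
  have hne : s ≠ t := fun he => h.not_dvd (by rw [he])
  rcases hB.rectangle (p := x) (a := -(s * w)) (b := -(v * t)) (dvd_neg.2 (dvd_mul_right _ _))
    (dvd_neg.2 (dvd_mul_left _ _)) (by omega) (by omega) hxB
    (by rwa [show x + -(s * w) + -(v * t) = z by omega])
    (by rwa [show x + -(s * w) = v by omega]) (by rwa [show x + -(v * t) = w by omega])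
    with g | g | g | g
  · omega
  · exact h.swap.not_dvd ⟨s - 2, by linarith⟩
  · omega
  · exact h.not_dvd ⟨t - 2, by linarith⟩

/-- If there is a unique symmetric set with given data, then the data are exceptional. -/
theorem exceptional_of_existsUnique (hs : 1 < s) (ht : 1 < t) (hst : IsCoprime s t) (hα : Symm α)
    (hβ : Symm β) (hαs : CoreSet s α) (hαt : CoreSet t α) (hβs : CoreSet s β) (hβt : CoreSet t β)
    {n : ℤ} (h : ∃! B, B ∈ Sol s t α β n) : Exceptional s t α β n := by
  obtain ⟨B, ⟨h1, h2, h3, rfl⟩, huniq⟩ := h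
  refine Rigid.exceptional hs ht hst hα hβ hαs hαt hβs hβt ⟨h1, fun C hC hCs hCt hCE => ?_⟩ h2 h3
  exact huniq C ⟨hC, hCs.trans hC.isMaya h1.isMaya hα.isMaya h2,
    hCt.trans hC.isMaya h1.isMaya hβ.isMaya h3, hCE⟩

end WeightOne

section Potential

theorem Symm.exists_eq_flip {A B : Set ℤ} (hA : Symm A) (hB : Symm B) :
    ∃ Q : Finset ℤ, (∀ k ∈ Q, k ∈ A) ∧ B = CorePartitions.flip A Q := by
  classical
  obtain ⟨N, h1, h2⟩ := hA.isMaya.exists_common hB.isMaya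
  refine ⟨(Finset.Ico (-N) N).filter fun k => k ∈ A ∧ k ∉ B,
    fun k hk => (Finset.mem_filter.1 hk).2.1, ?_⟩
  have hQ : ∀ k, k ∈ ((Finset.Ico (-N) N).filter fun k => k ∈ A ∧ k ∉ B) ↔ k ∈ A ∧ k ∉ B := by
    intro k
    rw [Finset.mem_filter]
    refine and_iff_right_of_imp fun hk => ?_
    rw [Finset.mem_Ico]
    by_contra hcon
    rcases lt_or_ge k (-N) with g | g
    · exact hk.2 (h2.1 k g)
    · exact h1.2 k (by omega) hk.1
  ext k
  rw [mem_flip, hQ, hQ]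
  have g1 := hA.mem_iff k
  have g2 := hB.mem_iff k
  tauto

theorem card_mul_le_dif_flip {A : Set ℤ} (hA : Symm A) {Q : Finset ℤ} (hQ : ∀ k ∈ Q, k ∈ A)
    {f : ℤ → ℤ} {c : ℤ} (hf : ∀ k, k ∉ A → c ≤ f k) (hf' : ∀ k ∈ A, f k ≤ -c) :
    2 * c * Q.card ≤ dif (flip A Q) A f := by
  rw [dif_flip hA hQ, mul_comm, ← nsmul_eq_mul]
  refine Finset.card_nsmul_le_sum _ _ _ fun k hk => ?_
  have h1 := hf' k (hQ k hk)
  have h2 := hf _ ((hA.mem_iff k).1 (hQ k hk))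
  linarith

theorem eq_of_dif_eq_zero {A B : Set ℤ} (hA : Symm A) (hB : Symm B) {f : ℤ → ℤ} {c : ℤ}
    (hc : 0 < c) (hf : ∀ k, k ∉ A → c ≤ f k) (hf' : ∀ k ∈ A, f k ≤ -c) (h : dif B A f = 0) :
    B = A := by
  obtain ⟨Q, hQ, rfl⟩ := hA.exists_eq_flip hB
  have h1 := card_mul_le_dif_flip hA hQ hf hf'
  rw [h] at h1
  have h2 : (Q.card : ℤ) = 0 := by nlinarith [Int.natCast_nonneg Q.card]
  have h3 : Q = ∅ := Finset.card_eq_zero.1 (by exact_mod_cast h2)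
  subst h3
  ext k
  simp [mem_flip]

theorem eq_flip_of_dif_eq {A B : Set ℤ} (hA : Symm A) (hB : Symm B) {f : ℤ → ℤ} {c : ℤ}
    (hc : 0 < c) (hf : ∀ k, k ∉ A → c ≤ f k) (hf' : ∀ k ∈ A, f k ≤ -c) (h : dif B A f = 2 * c)
    (hE : energy B = energy A + c) {x : ℤ} (hx : 2 * x + 1 = c) : B = flip A {-1 - x} := by
  obtain ⟨Q, hQ, rfl⟩ := hA.exists_eq_flip hB
  have h1 := card_mul_le_dif_flip hA hQ hf hf'
  rw [h] at h1
  have h2 : (Q.card : ℤ) ≤ 1 := by nlinarith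
  rw [energy_flip hA hQ] at hE
  have h3 : Q.card ≤ 1 := by exact_mod_cast h2
  rcases Finset.card_le_one_iff_subset_singleton.1 h3 with ⟨q, hq⟩
  rcases Finset.subset_singleton_iff.1 hq with rfl | rfl
  · simp at hE; omega
  · rw [Finset.sum_singleton] at hE
    rw [show -1 - x = q by omega]

theorem dif_eq_mul_energy {s t : ℤ} {A B : Set ℤ} (hA : IsMaya A) (hB : IsMaya B)
    (h1 : SameCharge s A B) (h2 : SameCharge t A B) {f u v : ℤ → ℤ} {p : ℤ}
    (hu : ∀ k, u (k + s) = u k) (hv : ∀ k, v (k + t) = v k) (hf : ∀ k, f k = p * k + (u k + v k)) :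
    dif A B f = p * (energy A - energy B) := by
  rw [energy_sub_energy hA hB, dif_congr hf, dif_add hA hB, dif_add hA hB, dif_const_mul, h1 u hu,
    h2 v hv]
  ring

theorem nonneg_of_dvd {s d : ℤ} (hd : s ∣ d) (h : -s < d) : 0 ≤ d := by
  obtain ⟨c, rfl⟩ := hd
  by_contra hneg
  have : c ≠ 0 := by rintro rfl; simp at hneg
  rcases lt_or_gt_of_ne this with hc | hc <;> nlinarith

/-- The first missing element of each residue class. -/
theorem CoreSet.exists_first {s : ℤ} (hs : 0 < s) {A : Set ℤ} (hA : IsMaya A) (h : CoreSet s A) :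
    ∃ m : ℤ → ℤ, (∀ k, m (k + s) = m k) ∧ (∀ k, s ∣ m k - k) ∧ (∀ k, m k ∉ A) ∧
      (∀ k, m k - s ∈ A) ∧ (∀ k, k ∉ A → m k ≤ k) ∧ ∀ k ∈ A, k ≤ m k - s := by
  choose F hF1 hF2 hF3 using fun r => hA.exists_top hs r
  have d1 : ∀ k, s ∣ F (k % s) + s - k := fun k => by
    obtain ⟨c, hc⟩ := hF1 (k % s)
    have := Int.emod_add_mul_ediv k s
    exact ⟨c + 1 - k / s, by linarith⟩
  have n1 : ∀ k, F (k % s) + s ∉ A := fun k => hF3 (k % s) _ (by omega) (by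
    obtain ⟨c, hc⟩ := hF1 (k % s)
    exact ⟨c + 1, by linarith⟩)
  refine ⟨fun k => F (k % s) + s, fun k => by simp, d1, n1,
    fun k => by simpa using hF2 (k % s), fun k hk => ?_, fun k hk => ?_⟩
  · have h1 := h.lt_of_mem_of_notMem hs (hF2 (k % s)) hk (by
      obtain ⟨c, hc⟩ := d1 k
      exact ⟨c - 1, by linarith⟩)
    have := nonneg_of_dvd (dvd_neg.2 (d1 k)) (by omega)
    show F (k % s) + s ≤ k
    omega
  · have h1 := h.lt_of_mem_of_notMem hs hk (n1 k) (by
      obtain ⟨c, hc⟩ := d1 k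
      exact ⟨-c, by linarith⟩)
    have := nonneg_of_dvd (s := s) (d := F (k % s) - k) (by
      obtain ⟨c, hc⟩ := d1 k
      exact ⟨c - 1, by linarith⟩) (by omega)
    show k ≤ F (k % s) + s - s
    omega

end Potential

section Sufficiency

variable {s t : ℤ} {α β : Set ℤ}

theorem existsUnique_of_eq (ht : 0 < t) (hβ : Symm β) (hβt : CoreSet t β) :
    ∃! B, B ∈ Sol s t β β (energy β) := by
  refine ⟨β, ⟨hβ, SameCharge.refl _ _, SameCharge.refl _ _, rfl⟩, ?_⟩
  rintro B ⟨h1, -, h3, h4⟩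
  obtain ⟨m, m1, m2, m3, m4, m5, m6⟩ := hβt.exists_first ht hβ.isMaya
  refine eq_of_dif_eq_zero hβ h1 (f := fun k => 2 * k + ((t - 2 * m k) + 0)) ht
    (fun k hk => ?_) (fun k hk => ?_) ?_
  · have := m5 k hk
    linarith
  · have := m6 k hk
    linarith
  · rw [dif_eq_mul_energy h1.isMaya hβ.isMaya h3 h3 (p := 2) (u := fun k => t - 2 * m k)
      (v := fun _ => 0) (fun k => by rw [m1]) (fun _ => rfl) (fun k => rfl), h4]
    ring

theorem dvd_of_modEq {b x : ℤ} (hx : 2 * x + 1 = t) (h : bar b - b ≡ t [ZMOD 2 * s]) :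
    s ∣ b + 1 + x := by
  rw [Int.modEq_iff_dvd] at h
  obtain ⟨d, hd⟩ := h
  simp only [bar] at hd
  exact ⟨d, by linarith⟩

theorem sameCharge_flip_flip (hβ : Symm β) {x b : ℤ} (hx : x ∈ β) (hb : b ∈ β) (h : s ∣ b - x) :
    SameCharge s (flip β {x}) (flip β {b}) := by
  intro u hu
  rw [← dif_add_dif (hβ.flip_one hx).isMaya hβ.isMaya (hβ.flip_one hb).isMaya,
    dif_comm (flip β {b}), dif_flip hβ (by simpa using hx), dif_flip hβ (by simpa using hb),
    Finset.sum_singleton, Finset.sum_singleton, apply_eq_of_dvd_sub hu (k := b) (l := x) h,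
    apply_eq_of_dvd_sub hu (k := -1 - b) (l := -1 - x)
      (by rw [show -1 - b - (-1 - x) = -(b - x) by ring, dvd_neg]; exact h)]
  ring

theorem existsUnique_of_flipRel (ht : 0 < t) (hot : Odd t) (hβ : Symm β) (hβt : CoreSet t β)
    (h : FlipRel s t α β) : ∃! B, B ∈ Sol s t α β (energy β + t) := by
  obtain ⟨b, hb, hmod, rfl⟩ := h
  rw [← flip_singleton]
  obtain ⟨x, hx⟩ := hot
  have hd := dvd_of_modEq hx.symm hmod
  have hxβ : -1 - x ∈ β :=
    hβ.notMem_iff.1 (hβt.notMem_of_dvd ht hβ (by omega) (by rw [hx]))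
  refine ⟨flip β {-1 - x}, ⟨hβ.flip_one hxβ, sameCharge_flip_flip hβ hxβ hb.1 ?_,
    sameCharge_flip_one hβ hxβ ⟨-1, by linarith⟩, ?_⟩, ?_⟩
  · rwa [show b - (-1 - x) = b + 1 + x by ring]
  · rw [energy_flip_one hβ hxβ]; linarith
  rintro B ⟨h1, -, h3, h4⟩
  obtain ⟨m, m1, m2, m3, m4, m5, m6⟩ := hβt.exists_first ht hβ.isMaya
  refine eq_flip_of_dif_eq hβ h1 (f := fun k => 2 * k + ((t - 2 * m k) + 0)) ht
    (fun k hk => ?_) (fun k hk => ?_) ?_ h4 hx.symm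
  · have := m5 k hk
    linarith
  · have := m6 k hk
    linarith
  · rw [dif_eq_mul_energy h1.isMaya hβ.isMaya h3 h3 (p := 2) (u := fun k => t - 2 * m k)
      (v := fun _ => 0) (fun k => by rw [m1]) (fun _ => rfl) (fun k => rfl), h4]
    ring

/-- Coordinates of an integer with respect to two coprime moduli. -/
theorem exists_coordinates (hs : 0 < s) (ht : 0 < t) (hst : IsCoprime s t) :
    ∃ i j q : ℤ → ℤ, (∀ k, 0 ≤ i k ∧ i k < t) ∧ (∀ k, 0 ≤ j k ∧ j k < s) ∧
      (∀ k, i (k + t) = i k) ∧ (∀ k, j (k + s) = j k) ∧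
      ∀ k, k = s * i k + t * j k + s * t * q k := by
  obtain ⟨a, b, hab⟩ := hst
  refine ⟨fun k => a * k % t, fun k => b * k % s, fun k => a * k / t + b * k / s,
    fun k => ⟨Int.emod_nonneg _ ht.ne', Int.emod_lt_of_pos _ ht⟩,
    fun k => ⟨Int.emod_nonneg _ hs.ne', Int.emod_lt_of_pos _ hs⟩, fun k => ?_, fun k => ?_,
    fun k => ?_⟩
  · simp [mul_add]
  · simp [mul_add]
  · have h1 := Int.emod_add_mul_ediv (a * k) t
    have h2 := Int.emod_add_mul_ediv (b * k) s
    beta_reduce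
    linear_combination (-k) * hab - s * h1 - t * h2

theorem CoreSet.add_notMem {A : Set ℤ} (h : CoreSet s A) {k i : ℤ} (hk : k ∉ A)
    (hi : 0 ≤ i) : k + s * i ∉ A := fun hmem => by
  have := h.sub_mul_mem hmem i.toNat
  rw [Int.toNat_of_nonneg hi, show k + s * i - i * s = k by ring] at this
  exact hk this

theorem existsUnique_of_notMem (hs : 1 < s) (ht : 1 < t) (hst : IsCoprime s t) (hos : Odd s)
    (hot : Odd t) (hβ : Symm β) (hβs : CoreSet s β) (hβt : CoreSet t β)
    (h : ∀ x, 2 * x + 1 = s + t - s * t → x ∉ β) :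
    ∃! B, B ∈ Sol s t β β (energy β + s * t) := by
  have hpos : 0 < s * t := by positivity
  obtain ⟨x, hx⟩ := hos.mul hot
  obtain ⟨x0, hx0⟩ : ∃ x0, 2 * x0 + 1 = s + t - s * t := by
    obtain ⟨v, hv⟩ := hos
    obtain ⟨w, hw⟩ := hot
    exact ⟨v + w - x, by linarith⟩
  have hx0β := h x0 hx0
  have hxβ : -1 - x ∈ β := hβ.notMem_iff.1
    (hβs.notMem_of_dvd (by omega) hβ (by omega) (by rw [← hx]; exact dvd_mul_right s t))
  have hd : ∀ q, q ∣ s * t → q ∣ 2 * (-1 - x) + 1 := fun q hq => by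
    rwa [show 2 * (-1 - x) + 1 = -(s * t) by linarith, dvd_neg]
  refine ⟨flip β {-1 - x}, ⟨hβ.flip_one hxβ,
    sameCharge_flip_one hβ hxβ (hd s (dvd_mul_right s t)),
    sameCharge_flip_one hβ hxβ (hd t (dvd_mul_left t s)), ?_⟩, ?_⟩
  · rw [energy_flip_one hβ hxβ]; linarith
  rintro B ⟨h1, h2, h3, h4⟩
  obtain ⟨i, j, q, hi, hj, hit, hjs, hq⟩ := exists_coordinates (by omega) (by omega) hst
  have rep : ∀ a b : ℤ, 0 ≤ a → 0 ≤ b → x0 + s * a + t * b ∉ β := fun a b ha hb =>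
    hβt.add_notMem (hβs.add_notMem hx0β ha) hb
  have key : ∀ k, k ∉ β ↔ 0 ≤ q (k - x0) := by
    intro k
    have e := hq (k - x0)
    have := hi (k - x0)
    have := hj (k - x0)
    constructor
    · intro hk
      by_contra hneg
      have h5 := rep (t - 1 - i (k - x0)) (s - 1 - j (k - x0) + s * (-q (k - x0) - 1)) (by omega)
        (by
          have : 0 ≤ s * (-q (k - x0) - 1) := mul_nonneg (by omega) (by omega)
          omega)
      rw [show x0 + s * (t - 1 - i (k - x0)) + t * (s - 1 - j (k - x0) + s * (-q (k - x0) - 1)) =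
        -1 - k by linear_combination hx0 + e] at h5
      exact h5 (hβ.notMem_iff.1 hk)
    · intro h0
      have h5 := rep (i (k - x0)) (j (k - x0) + s * q (k - x0)) (by omega) (by
        have : 0 ≤ s * q (k - x0) := mul_nonneg (by omega) h0
        omega)
      rwa [show x0 + s * i (k - x0) + t * (j (k - x0) + s * q (k - x0)) = k by
        linear_combination -e] at h5
  refine eq_flip_of_dif_eq hβ h1 (f := fun k => s * t * (2 * q (k - x0) + 1)) hpos
    (fun k hk => ?_) (fun k hk => ?_) ?_ h4 hx.symm
  · have := (key k).1 hk
    nlinarith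
  · have : ¬ 0 ≤ q (k - x0) := fun h0 => (key k).2 h0 hk
    nlinarith
  · rw [dif_eq_mul_energy h1.isMaya hβ.isMaya h2 h3 (p := 2)
      (u := fun k => -2 * t * j (k - x0) - 2 * x0 + s * t) (v := fun k => -2 * s * i (k - x0))
      (fun k => by rw [show k + s - x0 = k - x0 + s by ring, hjs])
      (fun k => by rw [show k + t - x0 = k - x0 + t by ring, hit])
      (fun k => by linear_combination -2 * hq (k - x0)), h4]
    ring

end Sufficiency

section Collapse

variable {s t : ℤ}

/-- A function which increases by `s` at each step of length `s`, except at the steps starting at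
`x + s * l` modulo `t`, for `-K ≤ l < K`, where it is constant. -/
theorem exists_collapse (hst : IsCoprime s t) {K : ℤ} (hK : 0 ≤ K) (hKt : 2 * K < t)
    (x : ℤ) : ∃ (Φ : ℤ → ℤ) (c : ℤ), (∀ k, Φ (k + t) = Φ k + c) ∧
      (∀ k, Φ (k + s) = Φ k + s ∨
        (Φ (k + s) = Φ k ∧ ∃ l j, -K ≤ l ∧ l < K ∧ k = x + s * l + t * j)) ∧
      (∀ l, -K ≤ l → l ≤ K → Φ (x + s * l) = Φ x) ∧ Φ (x + s * (K + 1)) = Φ x + s := by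
  obtain ⟨a, b, hab⟩ := hst
  have ht : 0 < t := by omega
  let φ : ℤ → ℤ := fun l => (t - 2 * K) * ((l + K) / t) + max ((l + K) % t - 2 * K) 0
  have φmul : ∀ l n, φ (l + t * n) = φ l + (t - 2 * K) * n := fun l n => by
    simp only [φ]
    rw [show l + t * n + K = l + K + t * n by ring, Int.add_mul_ediv_left _ _ ht.ne',
      Int.add_mul_emod_self_left]
    ring
  have φ0 : ∀ l, -K ≤ l → l ≤ K → φ l = 0 := fun l h1 h2 => by
    simp only [φ]
    rw [Int.ediv_eq_zero_of_lt (by omega) (by omega), Int.emod_eq_of_lt (by omega) (by omega),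
      max_eq_right (by omega)]
    ring
  have φ1 : ∀ l, φ (l + 1) = φ l + 1 ∨ (φ (l + 1) = φ l ∧ (l + K) % t < 2 * K) := fun l => by
    have e := Int.emod_add_mul_ediv (l + K) t
    have h0 := Int.emod_nonneg (l + K) ht.ne'
    have h1 := Int.emod_lt_of_pos (l + K) ht
    generalize hr : (l + K) % t = r at *
    generalize hq : (l + K) / t = q at *
    rcases eq_or_lt_of_le (show r + 1 ≤ t by omega) with h2 | h2
    · left
      simp only [φ]
      rw [show l + 1 + K = t * (q + 1) by linarith, Int.mul_ediv_cancel_left _ ht.ne',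
        Int.mul_emod_right, hr, hq, max_eq_right (by omega), max_eq_left (by omega)]
      linarith
    · have h3 : l + 1 + K = r + 1 + t * q := by linarith
      have h4 : (l + 1 + K) / t = q := by
        rw [h3, Int.add_mul_ediv_left _ _ ht.ne', Int.ediv_eq_zero_of_lt (by omega) h2, zero_add]
      have h5 : (l + 1 + K) % t = r + 1 := by
        rw [h3, Int.add_mul_emod_self_left, Int.emod_eq_of_lt (by omega) h2]
      simp only [φ, h4, h5, hr, hq]
      rcases lt_or_ge r (2 * K) with h6 | h6
      · right
        rw [max_eq_right (by omega), max_eq_right (by omega)]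
        exact ⟨rfl, h6⟩
      · left
        rw [max_eq_left (by omega), max_eq_left (by omega)]
        ring
  have ha : ∀ l, a * (s * l) = l + t * (-b * l) := fun l => by linear_combination l * hab
  have Φ0 : ∀ l, s * φ (a * (x + s * l - x)) + (t - 2 * K) * b * (x + s * l) =
      s * φ l + (t - 2 * K) * b * x := fun l => by
    rw [add_sub_cancel_left, ha, φmul]
    ring
  have Φx := Φ0 0
  rw [mul_zero, add_zero, φ0 0 (by omega) hK] at Φx
  refine ⟨fun k => s * φ (a * (k - x)) + (t - 2 * K) * b * k, t - 2 * K, fun k => ?_, fun k => ?_,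
    fun l h1 h2 => ?_, ?_⟩
  · beta_reduce
    rw [show a * (k + t - x) = a * (k - x) + t * a by ring, φmul]
    linear_combination (t - 2 * K) * hab
  · beta_reduce
    have e : φ (a * (k + s - x)) = φ (a * (k - x) + 1) + (t - 2 * K) * (-b) := by
      rw [← φmul]
      congr 1
      linear_combination hab
    rw [e]
    rcases φ1 (a * (k - x)) with h1 | ⟨h1, h2⟩
    · left
      rw [h1]
      ring
    · right
      refine ⟨by rw [h1]; ring, (a * (k - x) + K) % t - K, s * ((a * (k - x) + K) / t) + b * (k - x),
        ?_, by omega, ?_⟩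
      · have := Int.emod_nonneg (a * (k - x) + K) ht.ne'
        omega
      · have := Int.emod_add_mul_ediv (a * (k - x) + K) t
        linear_combination (x - k) * hab - s * this
  · beta_reduce
    rw [Φ0, Φx, φ0 l h1 h2]
  · beta_reduce
    rw [Φ0, Φx]
    rcases φ1 K with h1 | h1
    · rw [h1, φ0 K (by omega) le_rfl]
      ring
    · have := h1.2
      rw [Int.emod_eq_of_lt (by omega) (by omega)] at this
      omega

variable {υ : Set ℤ} {b x y : ℤ}

theorem first_eq {m : ℤ → ℤ} (m1 : ∀ k, m (k + s) = m k) (m5 : ∀ k, k ∉ υ → m k ≤ k)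
    (m6 : ∀ k ∈ υ, k ≤ m k - s) {k z : ℤ} (hz : z ∉ υ) (hzs : z - s ∈ υ) (hd : s ∣ z - k) :
    m k = z := by
  have h1 := m5 z hz
  have h2 := m6 _ hzs
  rw [apply_eq_of_dvd_sub m1 (k := z - s) (l := z) ⟨-1, by ring⟩] at h2
  rw [← apply_eq_of_dvd_sub m1 hd]
  omega

/-- The potential detecting the pair of flips. -/
theorem exists_potential (hs : 0 < s) (ht : 0 < t) (hst : IsCoprime s t) (hυ : Symm υ)
    (hυs : CoreSet s υ) (hυt : CoreSet t υ) (hx : 2 * x + 1 = t) (hy : 2 * y + 1 = s)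
    (hb : b ∈ υ) (hbs : b + s ∉ υ) (hd : s ∣ b + 1 + x) :
    ∃ (g u v : ℤ → ℤ) (p : ℤ), (∀ k, u (k + s) = u k) ∧ (∀ k, v (k + t) = v k) ∧
      (∀ k, t * g k = p * k + (u k + v k)) ∧ (∀ k, k ∉ υ → s ≤ g k) ∧ (∀ k ∈ υ, g k ≤ -s) ∧
      g x = s ∧ g y = s ∧ g (-1 - x) = -s ∧ g (-1 - y) = -s := by
  obtain ⟨K, hbK⟩ := id hd
  have hxυ : x ∉ υ := hυt.notMem_of_dvd ht hυ (by omega) (by rw [hx])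
  have hyυ : y ∉ υ := hυs.notMem_of_dvd hs hυ (by omega) (by rw [hy])
  have hxυ' := hυ.notMem_iff.1 hxυ
  have hyυ' := hυ.notMem_iff.1 hyυ
  have hK : 0 ≤ K := by
    have h1 := hυs.lt_of_mem_of_notMem hs hxυ' hbs ⟨-K - 1, by linarith⟩
    by_contra hneg
    nlinarith
  have out : ∀ l, -K ≤ l → x + s * l ∉ υ := fun l hl => by
    have := hυs.add_notMem ((hυ.mem_iff b).1 hb) (i := l + K) (by omega)
    rwa [show -1 - b + s * (l + K) = x + s * l by linarith] at this
  have ins : ∀ l, l ≤ K → x + s * l - t ∈ υ := fun l hl =>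
    hυs.mem_of_le hs hb (by nlinarith) ⟨K - l, by linarith⟩
  have hKt : 2 * K < t := by
    by_contra hcon
    have h1 := ins (-K + t) (by omega)
    have h2 := hυt.add_notMem (out (-K) le_rfl) (i := s - 1) (by omega)
    rw [show x + s * -K + t * (s - 1) = x + s * (-K + t) - t by ring] at h2
    exact h2 h1
  obtain ⟨Φ, c, Φt, Φs, Φ0, Φ1⟩ := exists_collapse hst hK hKt x
  obtain ⟨m, m1, m2, m3, m4, m5, m6⟩ := hυs.exists_first hs hυ.isMaya
  have cross : ∀ k ∈ υ, k + s ∉ υ → Φ (k + s) = Φ k + s := by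
    intro k hk hks
    rcases Φs k with h1 | ⟨-, l, j, h2, h3, rfl⟩
    · exact h1
    · exfalso
      rcases lt_or_ge j 0 with hj | hj
      · refine hks (hυt.mem_of_le ht (ins (l + 1) (by omega)) (by nlinarith) ⟨-j - 1, by ring⟩)
      · exact hυt.add_notMem (out l h2) hj hk
  have mono : ∀ k (n : ℕ), Φ k ≤ Φ (k + s * n) := by
    intro k n
    induction n with
    | zero => simp
    | succ n ih =>
      push_cast
      rw [show k + s * (n + 1) = k + s * n + s by ring]
      rcases Φs (k + s * n) with h | ⟨h, -⟩ <;> omega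
  have mono' : ∀ k l, k ≤ l → s ∣ l - k → Φ k ≤ Φ l := by
    rintro k l hkl ⟨n, hn⟩
    have hn0 : 0 ≤ n := by
      by_contra hneg
      nlinarith
    have := mono k n.toNat
    rwa [Int.toNat_of_nonneg hn0, ← hn, add_sub_cancel] at this
  have mx : m x = x + s * -K := first_eq m1 m5 m6 (out _ le_rfl) (by
    have := hυ.notMem_iff.1 hbs
    rwa [show -1 - (b + s) = x + s * -K - s by linarith] at this) ⟨-K, by ring⟩
  have mx' : m (-1 - x) = x + s * (K + 1) - t := first_eq m1 m5 m6
    (by rwa [show x + s * (K + 1) - t = b + s by linarith])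
    (by rwa [show x + s * (K + 1) - t - s = b by linarith]) ⟨K + 1, by linarith⟩
  have my : m y = y := first_eq m1 m5 m6 hyυ
    (by rwa [show y - s = -1 - y by linarith]) (by simp)
  have my' : m (-1 - y) = y := first_eq m1 m5 m6 hyυ
    (by rwa [show y - s = -1 - y by linarith]) ⟨1, by linarith⟩
  refine ⟨fun k => 2 * (Φ k - Φ (m k)) + s, fun k => t * (s - 2 * Φ (m k)),
    fun k => 2 * (t * Φ k - c * k), 2 * c, fun k => by beta_reduce; rw [m1], fun k => ?_, fun k => by ring,
    fun k hk => ?_, fun k hk => ?_, ?_, ?_, ?_, ?_⟩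
  · beta_reduce
    rw [Φt]
    ring
  · have := mono' _ _ (m5 k hk) ((dvd_sub_comm).1 (m2 k))
    beta_reduce
    linarith
  · have h1 := mono' _ _ (m6 k hk) (by obtain ⟨c, hc⟩ := m2 k; exact ⟨c - 1, by linarith⟩)
    have h2 := cross _ (m4 k) (by rw [sub_add_cancel]; exact m3 k)
    rw [sub_add_cancel] at h2
    beta_reduce
    linarith
  · beta_reduce
    rw [mx, Φ0 _ le_rfl (by omega)]
    ring
  · beta_reduce
    rw [my]
    ring
  · beta_reduce
    have h1 := Φt (-1 - x)
    have h2 := Φt (x + s * (K + 1) - t)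
    rw [show -1 - x + t = x by linarith] at h1
    rw [sub_add_cancel] at h2
    rw [mx']
    linarith
  · beta_reduce
    have h1 := cross _ hyυ' (by rwa [show -1 - y + s = y by linarith])
    rw [show -1 - y + s = y by linarith] at h1
    rw [my']
    linarith

end Collapse

section PairOfFlips

variable {s t : ℤ} {υ : Set ℤ} {b d x y : ℤ}

/-- If flipping `b` and flipping `d` both give cores, then the set is a core. -/
theorem coreSet_of_flip (hs : 1 < s) (ht : 1 < t) (hst : IsCoprime s t) (hb : b ∈ υ)
    (hd : d ∈ υ) (hbd : b ≠ d) (hx : 2 * x + 1 = t) (hy : 2 * y + 1 = s) (hbx : s ∣ b + 1 + x)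
    (hdy : t ∣ d + 1 + y) (hαs : CoreSet s (flip υ {b})) (hαt : CoreSet t (flip υ {b}))
    (hβs : CoreSet s (flip υ {d})) (hβt : CoreSet t (flip υ {d})) : CoreSet s υ := by
  intro k hk
  by_contra hks
  have key : ∀ c, CoreSet s (flip υ {c}) → k = c ∨ k - s = -1 - c := fun c hc => by
    by_contra! hcon
    have := hc k (mem_flip_one.2 (Or.inl ⟨hk, hcon.1⟩))
    rw [mem_flip_one] at this
    rcases this with g | g
    · exact hks g.1
    · exact hcon.2 g
  have notMem : ∀ c ∈ υ, CoreSet s (flip υ {c}) → CoreSet t (flip υ {c}) → ∀ i j : ℤ, 0 ≤ i →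
      0 ≤ j → 2 * c + 1 ≠ -(s * i + t * j) := by
    intro c hc h1 h2 i j hi hj he
    have hn : c ∉ flip υ {c} := by
      rw [mem_flip_one]
      rintro (g | g)
      · exact g.2 rfl
      · omega
    have := h2.add_notMem (h1.add_notMem hn hi) hj
    refine this (mem_flip_one.2 (Or.inr ?_))
    linarith
  have hsum : b + d + 1 = s := by
    rcases key b hαs with h1 | h1 <;> rcases key d hβs with h2 | h2 <;> omega
  obtain ⟨q, hq⟩ := hbx
  obtain ⟨p, hp⟩ := hdy
  have e : s * (2 * q - 3) = t * (1 - 2 * p) := by linarith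
  obtain ⟨w, hw⟩ : s ∣ 1 - 2 * p := hst.dvd_of_dvd_mul_left (Dvd.intro _ e)
  have hw' : 2 * q - 3 = t * w := by
    rw [hw, show t * (s * w) = s * (t * w) by ring] at e
    exact mul_left_cancel₀ (by omega) e
  rcases lt_trichotomy w 0 with h0 | rfl | h0
  · have ht3 : 3 ≤ t := by omega
    have : 0 ≤ t * (-w) - 3 := by nlinarith
    exact notMem b hb hαs hαt (t * (-w) - 3) 1 this (by norm_num)
      (by linear_combination 2 * hq - hx + s * hw')
  · omega
  · have : 0 ≤ s * w - 1 := by nlinarith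
    exact notMem d hd hβs hβt 1 (s * w - 1) (by norm_num) this
      (by linear_combination 2 * hp - hy - t * hw)

/-- Splitting a pair of flips with prescribed charges. -/
theorem dvd_of_charge {p q : ℤ} (hx : ¬ s ∣ 2 * x + 1)
    (h : ∀ u : ℤ → ℤ, (∀ k, u (k + s) = u k) →
      (u (-1 - p) - u p) + (u (-1 - q) - u q) = u x - u (-1 - x)) :
    (s ∣ p + 1 + x ∧ s ∣ 2 * q + 1) ∨ (s ∣ q + 1 + x ∧ s ∣ 2 * p + 1) := by
  have main : ∀ p q : ℤ, (∀ u : ℤ → ℤ, (∀ k, u (k + s) = u k) →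
      (u (-1 - p) - u p) + (u (-1 - q) - u q) = u x - u (-1 - x)) → s ∣ -1 - p - x →
      s ∣ p + 1 + x ∧ s ∣ 2 * q + 1 := by
    rintro p q h ⟨c, hc⟩
    refine ⟨⟨-c, by linarith⟩, ?_⟩
    have h1 := h (cls s q) (cls_periodic s q)
    rw [apply_eq_of_dvd_sub (cls_periodic s q) (k := -1 - p) (l := x) ⟨c, by linarith⟩,
      apply_eq_of_dvd_sub (cls_periodic s q) (k := p) (l := -1 - x) ⟨-c, by linarith⟩,
      cls_of_dvd (k := q) (by simp)] at h1
    by_contra hn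
    rw [cls_of_not_dvd (k := -1 - q)] at h1
    · omega
    · rwa [show -1 - q - q = -(2 * q + 1) by ring, dvd_neg]
  by_cases h1 : s ∣ -1 - p - x
  · exact Or.inl (main p q h h1)
  by_cases h2 : s ∣ -1 - q - x
  · exact Or.inr (main q p (fun u hu => by rw [← h u hu]; ring) h2)
  have h3 := h (cls s x) (cls_periodic s x)
  rw [cls_of_dvd (k := x) (by simp), cls_of_not_dvd h1, cls_of_not_dvd h2,
    cls_of_not_dvd (k := -1 - x)] at h3
  · have := cls_nonneg s x p
    have := cls_nonneg s x q
    omega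
  · rwa [show -1 - x - x = -(2 * x + 1) by ring, dvd_neg]

/-- If `s * t - s - t` occurs in a core, it is the last element of its class modulo `s`. -/
theorem eq_of_mem_frobenius (hs : 1 < s) (hυ : Symm υ) (hυs : CoreSet s υ)
    (hυt : CoreSet t υ) (hx : 2 * x + 1 = t) (hb : b ∈ υ) (hbs : b + s ∉ υ) (hbx : s ∣ b + 1 + x)
    {z : ℤ} (hz : 2 * z + 1 = s * t - s - t) (hzυ : z ∈ υ) : b = z := by
  have h1 : z + s ∉ υ := by
    have := hυt.add_notMem ((hυ.mem_iff z).1 hzυ) (i := s - 1) (by omega)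
    rwa [show -1 - z + t * (s - 1) = z + s by linear_combination -hz] at this
  obtain ⟨q, hq⟩ := hbx
  have e : b - z = s * (q - x) := by
    have : s * t = 2 * (s * x) + s := by rw [← hx]; ring
    rw [mul_sub]
    omega
  have h2 := hυs.lt_of_mem_of_notMem (by omega) hb h1 ⟨q - x - 1, by linarith⟩
  have h3 := hυs.lt_of_mem_of_notMem (by omega) hzυ hbs ⟨x - q - 1, by linarith⟩
  have h4 := nonneg_of_dvd (s := s) ⟨q - x, e⟩ (by omega)
  have h5 := nonneg_of_dvd (s := s) (d := z - b) ⟨x - q, by linarith⟩ (by omega)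
  omega

theorem existsUnique_of_pair (hs : 1 < s) (ht : 1 < t) (hst : IsCoprime s t) (hυ : Symm υ)
    (hυs : CoreSet s υ) (hυt : CoreSet t υ) (hx : 2 * x + 1 = t) (hy : 2 * y + 1 = s)
    (hb : b ∈ υ) (hbs : b + s ∉ υ) (hbx : s ∣ b + 1 + x) (hd : d ∈ υ) (hdt : d + t ∉ υ)
    (hdy : t ∣ d + 1 + y) (hbd : b ≠ d) :
    ∃! B, B ∈ Sol s t (flip υ {b}) (flip υ {d}) (energy υ + s + t) := by
  have hs0 : 0 < s := by omega
  have ht0 : 0 < t := by omega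
  have hnst : ¬ s ∣ t := fun h => by
    rcases Int.isUnit_iff.1 (hst.isUnit_of_dvd' dvd_rfl h) with h | h <;> omega
  have hnts : ¬ t ∣ s := fun h => by
    rcases Int.isUnit_iff.1 (hst.isUnit_of_dvd' h dvd_rfl) with h | h <;> omega
  have hxυ := hυ.notMem_iff.1 (hυt.notMem_of_dvd ht0 hυ (x := x) (by omega) (by rw [hx]))
  have hyυ := hυ.notMem_iff.1 (hυs.notMem_of_dvd hs0 hυ (x := y) (by omega) (by rw [hy]))
  have hne : -1 - x ≠ -1 - y := fun he => hnst ⟨1, by linarith⟩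
  have hF : ∀ k ∈ ({-1 - x, -1 - y} : Finset ℤ), k ∈ υ := by
    intro k hk
    simp only [Finset.mem_insert, Finset.mem_singleton] at hk
    rcases hk with rfl | rfl <;> assumption
  have hB0 := hυ.flip hF
  have charge : ∀ u : ℤ → ℤ, dif (flip υ {-1 - x, -1 - y}) υ u =
      (u x - u (-1 - x)) + (u y - u (-1 - y)) := fun u => by
    rw [dif_flip hυ hF, Finset.sum_pair hne, show -1 - (-1 - x) = x by ring,
      show -1 - (-1 - y) = y by ring]
  have charge_s : ∀ u : ℤ → ℤ, (∀ k, u (k + s) = u k) →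
      dif (flip υ {b}) υ u = u x - u (-1 - x) := fun u hu => by
    obtain ⟨c, hc⟩ := hbx
    rw [dif_flip hυ (by simpa using hb), Finset.sum_singleton,
      apply_eq_of_dvd_sub hu (k := b) (l := -1 - x) ⟨c, by linarith⟩,
      apply_eq_of_dvd_sub hu (k := -1 - b) (l := x) ⟨-c, by linarith⟩]
  have charge_t : ∀ u : ℤ → ℤ, (∀ k, u (k + t) = u k) →
      dif (flip υ {d}) υ u = u y - u (-1 - y) := fun u hu => by
    obtain ⟨c, hc⟩ := hdy
    rw [dif_flip hυ (by simpa using hd), Finset.sum_singleton,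
      apply_eq_of_dvd_sub hu (k := d) (l := -1 - y) ⟨c, by linarith⟩,
      apply_eq_of_dvd_sub hu (k := -1 - d) (l := y) ⟨-c, by linarith⟩]
  have hbf := (hυ.flip_one hb).isMaya
  have hdf := (hυ.flip_one hd).isMaya
  have hmem : flip υ {-1 - x, -1 - y} ∈ Sol s t (flip υ {b}) (flip υ {d}) (energy υ + s + t) := by
    refine ⟨hB0, fun u hu => ?_, fun u hu => ?_, ?_⟩
    · rw [← dif_add_dif hB0.isMaya hυ.isMaya hbf, dif_comm (flip υ {b}), charge_s u hu, charge,
        apply_eq_of_dvd_sub hu (k := y) (l := -1 - y) ⟨1, by linarith⟩]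
      ring
    · rw [← dif_add_dif hB0.isMaya hυ.isMaya hdf, dif_comm (flip υ {d}), charge_t u hu, charge,
        apply_eq_of_dvd_sub hu (k := x) (l := -1 - x) ⟨1, by linarith⟩]
      ring
    · rw [energy_flip hυ hF, Finset.sum_pair hne]
      linarith
  refine ⟨_, hmem, ?_⟩
  rintro B ⟨h1, h2, h3, h4⟩
  obtain ⟨-, g2, g3, g4⟩ := hmem
  have hsame : ∀ {q : ℤ} {C : Set ℤ}, IsMaya C → SameCharge q B C →
      SameCharge q (flip υ {-1 - x, -1 - y}) C → SameCharge q B (flip υ {-1 - x, -1 - y}) :=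
    fun hC hc hc' => hc.trans h1.isMaya hC hB0.isMaya hc'.symm
  obtain ⟨g, u, v, p, hu, hv, hg, hg1, hg2, gx, gy, gx', gy'⟩ :=
    exists_potential hs0 ht0 hst hυ hυs hυt hx hy hb hbs hbx
  have hdif : dif B υ g = 4 * s := by
    have e1 := dif_eq_mul_energy h1.isMaya hB0.isMaya (hsame hbf h2 g2) (hsame hdf h3 g3) hu hv hg
    rw [h4, g4, sub_self, mul_zero, dif_const_mul] at e1
    have e2 := (mul_eq_zero.1 e1).resolve_left ht0.ne'
    rw [← dif_add_dif h1.isMaya hB0.isMaya hυ.isMaya, e2, charge, gx, gy, gx', gy']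
    ring
  have hBs : ∀ u : ℤ → ℤ, (∀ k, u (k + s) = u k) → dif B υ u = u x - u (-1 - x) := fun u hu => by
    rw [← dif_add_dif h1.isMaya hbf hυ.isMaya, h2 u hu, charge_s u hu, zero_add]
  have hBt : ∀ u : ℤ → ℤ, (∀ k, u (k + t) = u k) → dif B υ u = u y - u (-1 - y) := fun u hu => by
    rw [← dif_add_dif h1.isMaya hdf hυ.isMaya, h3 u hu, charge_t u hu, zero_add]
  obtain ⟨Q, hQ, rfl⟩ := hυ.exists_eq_flip h1
  have hcard := card_mul_le_dif_flip hυ hQ hg1 hg2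
  rw [hdif] at hcard
  have hcard2 : Q.card ≤ 2 := by
    have : (Q.card : ℤ) ≤ 2 := by nlinarith
    exact_mod_cast this
  rw [energy_flip hυ hQ] at h4
  have hQ2 : Q.card = 2 := by
    rcases (show Q.card = 0 ∨ Q.card = 1 ∨ Q.card = 2 by omega) with h | h | h
    · rw [Finset.card_eq_zero] at h
      subst h
      simp at h4
      omega
    · obtain ⟨q, rfl⟩ := Finset.card_eq_one.1 h
      rw [Finset.sum_singleton] at h4
      omega
    · exact h
  obtain ⟨p, q, hpq, rfl⟩ := Finset.card_eq_two.1 hQ2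
  have hp : p ∈ υ := hQ p (by simp)
  have hq : q ∈ υ := hQ q (by simp)
  rw [Finset.sum_pair hpq] at h4
  simp only [dif_flip hυ hQ, Finset.sum_pair hpq] at hBs hBt
  have cs := dvd_of_charge (by rwa [hx]) hBs
  have ct := dvd_of_charge (by rwa [hy]) hBt
  have neg : ∀ {k}, k ∈ υ → s ∣ 2 * k + 1 ∨ t ∣ 2 * k + 1 → 2 * k + 1 < 0 := by
    intro k hk hdk
    by_contra hge
    rcases hdk with hdk | hdk
    · exact hυs.notMem_of_dvd hs0 hυ (by omega) hdk hk
    · exact hυt.notMem_of_dvd ht0 hυ (by omega) hdk hk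
  have good : ∀ {p q : ℤ}, p ∈ υ → q ∈ υ → 2 * p + 1 + (2 * q + 1) = -(s + t) → s ∣ p + 1 + x →
      s ∣ 2 * q + 1 → t ∣ q + 1 + y → t ∣ 2 * p + 1 → p = -1 - x ∧ q = -1 - y := by
    intro p q hp hq hsum ⟨e, he⟩ hq1 ⟨f, hf⟩ hp1
    have np := neg hp (Or.inr hp1)
    have nq := neg hq (Or.inl hq1)
    have hte : t ∣ e := by
      have : t ∣ s * (2 * e) := by
        obtain ⟨w, hw⟩ := hp1
        exact ⟨w + 1, by linarith⟩
      exact dvd_of_dvd_two_mul (x := x) (by rw [hx]) (hst.symm.dvd_of_dvd_mul_left this)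
    have hsf : s ∣ f := by
      have : s ∣ t * (2 * f) := by
        obtain ⟨w, hw⟩ := hq1
        exact ⟨w + 1, by linarith⟩
      exact dvd_of_dvd_two_mul (x := y) (by rw [hy]) (hst.dvd_of_dvd_mul_left this)
    obtain ⟨z, rfl⟩ := hte
    obtain ⟨z', rfl⟩ := hsf
    have e1 : s * (t * z) = (s * t) * z := by ring
    have e2 : t * (s * z') = (s * t) * z' := by ring
    rw [e1] at he
    rw [e2] at hf
    have hst0 : 0 < s * t := mul_pos hs0 ht0
    have hlt1 : t < s * t := by nlinarith
    have hlt2 : s < s * t := by nlinarith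
    have hz : z ≤ 0 := by
      by_contra hz
      have : s * t ≤ s * t * z := by nlinarith
      omega
    have hz' : z' ≤ 0 := by
      by_contra hz
      have : s * t ≤ s * t * z' := by nlinarith
      omega
    have hzz : (s * t) * (z + z') = 0 := by linarith
    have := (mul_eq_zero.1 hzz).resolve_left hst0.ne'
    obtain rfl : z = 0 := by omega
    obtain rfl : z' = 0 := by omega
    constructor <;> linarith
  have bad : ∀ {p q : ℤ}, p ∈ υ → q ∈ υ → 2 * p + 1 + (2 * q + 1) = -(s + t) →
      s ∣ 2 * q + 1 → t ∣ 2 * q + 1 → False := by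
    intro p q hp hq hsum hq1 hq2
    have nq := neg hq (Or.inl hq1)
    obtain ⟨w, hw⟩ := hst.mul_dvd hq1 hq2
    have hst0 : 0 < s * t := mul_pos hs0 ht0
    have hw0 : w < 0 := by
      by_contra hge
      nlinarith
    have hw1 : Odd w := (Int.odd_mul.1 (⟨q, hw.symm⟩ : Odd (s * t * w))).2
    obtain ⟨w', rfl⟩ := hw1
    have hz : p + s * t * (w' + 1) ∈ υ := by
      refine hυs.mem_of_le hs0 hp ?_ ⟨-(t * (w' + 1)), by ring⟩
      have : s * t * (w' + 1) ≤ 0 := mul_nonpos_of_nonneg_of_nonpos hst0.le (by omega)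
      omega
    have hz' : 2 * (p + s * t * (w' + 1)) + 1 = s * t - s - t := by linarith
    refine hbd ((eq_of_mem_frobenius hs hυ hυs hυt hx hb hbs hbx hz' hz).trans
      (eq_of_mem_frobenius ht hυ hυt hυs hy hd hdt hdy ?_ hz).symm)
    linarith
  rcases cs with ⟨c1, c2⟩ | ⟨c1, c2⟩ <;> rcases ct with ⟨c3, c4⟩ | ⟨c3, c4⟩
  · exact (bad hp hq (by linarith) c2 c4).elim
  · obtain ⟨rfl, rfl⟩ := good hp hq (by linarith) c1 c2 c3 c4
    rfl
  · obtain ⟨rfl, rfl⟩ := good hq hp (by linarith) c1 c2 c3 c4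
    rw [Finset.pair_comm]
  · exact (bad hq hp (by linarith) c2 c4).elim

theorem CoreSet.add_notMem_of_flip (hs : 0 < s) (h : CoreSet s (flip υ {b})) : b + s ∉ υ := by
  intro hmem
  have := h _ (mem_flip_one.2 (Or.inl ⟨hmem, by omega⟩))
  rw [add_sub_cancel_right, mem_flip_one] at this
  rcases this with g | g
  · exact g.2 rfl
  · omega

variable {α β : Set ℤ} {c : ℤ}

theorem existsUnique_of_doubleFlipRel (hs : 1 < s) (ht : 1 < t) (hst : IsCoprime s t)
    (hos : Odd s) (hot : Odd t) (hβ : Symm β) (hαs : CoreSet s α) (hαt : CoreSet t α)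
    (hβs : CoreSet s β) (hβt : CoreSet t β) (h : DoubleFlipRel s t α β b c) :
    ∃! B, B ∈ Sol s t α β (energy ((β \ {c}) ∪ {bar c}) + s + t) := by
  obtain ⟨y, hy⟩ := hos
  obtain ⟨x, hx⟩ := hot
  have hb := h.left_mem.1
  have hc := h.right_mem.1
  have hυ := hβ.flip_one hc
  have hd : -1 - c ∈ flip β {c} := mem_flip_one.2 (Or.inr rfl)
  have hbυ : b ∈ flip β {c} := mem_flip_one.2 (Or.inl ⟨hb, h.ne⟩)
  have hβ' : β = flip (flip β {c}) {-1 - c} := (flip_flip hβ hc).symm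
  have hα' : α = flip (flip β {c}) {b} := by
    have h1 := (hβ.mem_iff b).1 hb
    have h2 := (hβ.mem_iff c).1 hc
    rw [h.eq]
    ext k
    simp only [mem_flip_one, Set.mem_union, Set.mem_sdiff, Set.mem_insert_iff,
      Set.mem_singleton_iff, bar, not_or]
    by_cases h3 : k = b
    · subst h3
      have : k ≠ -1 - c := fun he => h2 (he ▸ hb)
      simp [this]
    · tauto
  have hbx := dvd_of_modEq hx.symm h.left_modEq
  have hdy : t ∣ -1 - c + 1 + y := dvd_of_modEq (b := -1 - c) hy.symm (by
    have := h.right_modEq.neg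
    simp only [bar] at this ⊢
    convert this using 1 <;> ring)
  have hbd : b ≠ -1 - c := fun he => (hβ.mem_iff c).1 hc (he ▸ hb)
  rw [← flip_singleton]
  rw [hα'] at hαs hαt
  have hβs' := hβs
  have hβt' := hβt
  rw [hβ'] at hβs' hβt'
  have := existsUnique_of_pair hs ht hst hυ
    (coreSet_of_flip hs ht hst hbυ hd hbd hx.symm hy.symm hbx hdy hαs hαt hβs' hβt')
    (coreSet_of_flip ht hs hst.symm hd hbυ hbd.symm hy.symm hx.symm hdy hbx hβt' hβs' hαt hαs)
    hx.symm hy.symm hbυ (hαs.add_notMem_of_flip (by omega)) hbx hd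
    (hβt'.add_notMem_of_flip (by omega)) hdy hbd
  rwa [← hα', ← hβ'] at this

/-- The exceptional data are those with a unique symmetric set. -/
theorem existsUnique_iff_exceptional (hs : 1 < s) (ht : 1 < t) (hst : IsCoprime s t) (hα : Symm α)
    (hβ : Symm β) (hαs : CoreSet s α) (hαt : CoreSet t α) (hβs : CoreSet s β) (hβt : CoreSet t β)
    {n : ℤ} : (∃! B, B ∈ Sol s t α β n) ↔ Exceptional s t α β n := by
  refine ⟨exceptional_of_existsUnique hs ht hst hα hβ hαs hαt hβs hβt, ?_⟩
  rintro (⟨rfl, rfl⟩ | ⟨h1, h2, rfl⟩ | ⟨h1, h2, rfl⟩ | ⟨h1, h2, b, c, h3, rfl⟩ |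
    ⟨h1, h2, h3, rfl, rfl⟩)
  · exact existsUnique_of_eq (by omega) hβ hβt
  · exact existsUnique_of_flipRel (by omega) h1 hβ hβt h2
  · rw [Sol_swap]
    exact existsUnique_of_flipRel (by omega) h1 hα hαs h2
  · exact existsUnique_of_doubleFlipRel hs ht hst h1 h2 hβ hαs hαt hβs hβt h3
  · exact existsUnique_of_notMem hs ht hst h1 h2 hβ hβs hβt h3

end PairOfFlips

section Sawtooth

theorem sum_range_add {s : ℕ} {h : ℤ → ℤ} (hh : ∀ k, h (k + s) = h k) (d : ℕ) :
    ∑ i ∈ Finset.range s, h (i + d) = ∑ i ∈ Finset.range s, h i := by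
  induction d with
  | zero => simp
  | succ d ih =>
    rw [← ih]
    have h1 := Finset.sum_range_succ (fun i : ℕ => h (i + d)) s
    have h2 := Finset.sum_range_succ' (fun i : ℕ => h (i + d)) s
    have h3 : h ((s : ℤ) + d) = h ((0 : ℕ) + d) := by
      rw [add_comm, hh]; simp
    have h4 : ∑ i ∈ Finset.range s, h ((i : ℤ) + (d + 1 : ℕ)) =
        ∑ i ∈ Finset.range s, h (((i + 1 : ℕ) : ℤ) + d) :=
      Finset.sum_congr rfl fun i _ => by push_cast; congr 1; ring
    rw [h4]
    linarith

theorem sum_range_sawtooth {s : ℕ} {g : ℤ → ℤ} (hg : ∀ k, g (k + s) = g k) (t : ℤ) :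
    ∑ d ∈ Finset.range s, ∑ i ∈ Finset.range s,
        (g (i + d) - g i - d * t) * (g (i + d) - g i + (s - d) * t) =
      2 * s * ∑ i ∈ Finset.range s, g i ^ 2 - 2 * (∑ i ∈ Finset.range s, g i) ^ 2 -
        s * t ^ 2 * ∑ d ∈ Finset.range s, (d : ℤ) * (s - d) := by
  have h1 : ∀ d ∈ Finset.range s, ∑ i ∈ Finset.range s,
      (g (i + d) - g i - d * t) * (g (i + d) - g i + (s - d) * t) =
      2 * ∑ i ∈ Finset.range s, g i ^ 2 - 2 * ∑ i ∈ Finset.range s, g (i + d) * g i -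
        s * t ^ 2 * (d * (s - d)) := by
    intro d _
    have e1 := sum_range_add hg d
    have e2 := sum_range_add (h := fun k => g k ^ 2) (fun k => by rw [hg]) d
    have e3 : ∀ i ∈ Finset.range s, (g (i + d) - g i - d * t) * (g (i + d) - g i + (s - d) * t) =
        g (i + d) ^ 2 + g i ^ 2 - 2 * (g (i + d) * g i) + (s - 2 * d) * t * (g (i + d) - g i) -
          t ^ 2 * (d * (s - d)) := fun i _ => by ring
    rw [Finset.sum_congr rfl e3, Finset.sum_sub_distrib, Finset.sum_add_distrib,
      Finset.sum_sub_distrib, Finset.sum_add_distrib, ← Finset.mul_sum, ← Finset.mul_sum,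
      Finset.sum_sub_distrib, e1, e2, Finset.sum_const, Finset.card_range, nsmul_eq_mul]
    ring
  have h2 : ∑ d ∈ Finset.range s, ∑ i ∈ Finset.range s, g (i + d) * g i =
      (∑ i ∈ Finset.range s, g i) ^ 2 := by
    rw [Finset.sum_comm, sq, Finset.mul_sum]
    refine Finset.sum_congr rfl fun i _ => ?_
    rw [← Finset.sum_mul, ← sum_range_add hg i]
    congr 1
    exact Finset.sum_congr rfl fun d _ => by rw [add_comm]
  rw [Finset.sum_congr rfl h1, Finset.sum_sub_distrib, Finset.sum_sub_distrib, ← Finset.mul_sum,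
    ← Finset.mul_sum, ← Finset.mul_sum, h2, Finset.sum_const, Finset.card_range, nsmul_eq_mul]
  ring

theorem sum_range_arith (s : ℕ) (x t : ℤ) :
    2 * s * ∑ i ∈ Finset.range s, (x + t * i) ^ 2 - 2 * (∑ i ∈ Finset.range s, (x + t * i)) ^ 2 =
      s * t ^ 2 * ∑ d ∈ Finset.range s, (d : ℤ) * (s - d) := by
  have h1 : 2 * ∑ i ∈ Finset.range s, (i : ℤ) = s * (s - 1) := by
    induction s with
    | zero => simp
    | succ s ih => rw [Finset.sum_range_succ, mul_add, ih]; push_cast; ring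
  have h2 : 6 * ∑ i ∈ Finset.range s, (i : ℤ) ^ 2 = s * (s - 1) * (2 * s - 1) := by
    clear h1
    induction s with
    | zero => simp
    | succ s ih => rw [Finset.sum_range_succ, mul_add, ih]; push_cast; ring
  have e1 : ∑ i ∈ Finset.range s, (x + t * i) ^ 2 = s * x ^ 2 +
      2 * x * t * ∑ i ∈ Finset.range s, (i : ℤ) + t ^ 2 * ∑ i ∈ Finset.range s, (i : ℤ) ^ 2 := by
    rw [Finset.mul_sum, Finset.mul_sum, ← Finset.card_range s, ← nsmul_eq_mul, ← Finset.sum_const,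
      Finset.card_range, ← Finset.sum_add_distrib, ← Finset.sum_add_distrib]
    exact Finset.sum_congr rfl fun i _ => by ring
  have e2 : ∑ i ∈ Finset.range s, (x + t * i) = s * x + t * ∑ i ∈ Finset.range s, (i : ℤ) := by
    rw [Finset.sum_add_distrib, ← Finset.mul_sum, Finset.sum_const, Finset.card_range,
      nsmul_eq_mul]
  have e3 : ∑ d ∈ Finset.range s, (d : ℤ) * (s - d) =
      s * ∑ i ∈ Finset.range s, (i : ℤ) - ∑ i ∈ Finset.range s, (i : ℤ) ^ 2 := by
    rw [Finset.mul_sum, ← Finset.sum_sub_distrib]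
    exact Finset.sum_congr rfl fun i _ => by ring
  rw [e1, e2, e3]
  generalize ∑ i ∈ Finset.range s, (i : ℤ) = a at *
  generalize ∑ i ∈ Finset.range s, (i : ℤ) ^ 2 = b at *
  have h3 : 2 * (3 * s * b - s ^ 2 * a - 2 * a ^ 2) = 0 := by
    linear_combination s * h2 - (s ^ 2 + 2 * a + s * (s - 1)) * h1
  have h4 := (mul_eq_zero.1 h3).resolve_left two_ne_zero
  linear_combination t ^ 2 * h4

/-- Sums over the first missing elements. -/
theorem dif_shift {s : ℤ} {A B : Set ℤ} (hA : IsMaya A) (hB : IsMaya B) (hAs : CoreSet s A)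
    (hBs : CoreSet s B) {P Q : Finset ℤ} (hP : ∀ k, k ∈ P ↔ k ∉ A ∧ k - s ∈ A)
    (hQ : ∀ k, k ∈ Q ↔ k ∉ B ∧ k - s ∈ B) (F : ℤ → ℤ) :
    dif A B (fun k => F (k + s) - F k) = ∑ k ∈ P, F k - ∑ k ∈ Q, F k := by
  have shift : ∀ {C : Set ℤ} {R : Finset ℤ}, CoreSet s C → (∀ k, k ∈ R ↔ k ∉ C ∧ k - s ∈ C) →
      (Equiv.subRight s) ⁻¹' C = (C \ (∅ : Finset ℤ)) ∪ R := by
    intro C R hC hR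
    ext k
    simp only [Set.mem_preimage, Equiv.subRight_apply, Finset.coe_empty, Set.sdiff_empty,
      Set.mem_union, Finset.mem_coe, hR]
    have := hC k
    tauto
  have hA' := hA.sdiff_union ∅ P
  have hB' := hB.sdiff_union ∅ Q
  have e1 : dif ((Equiv.subRight s) ⁻¹' A) ((Equiv.subRight s) ⁻¹' B) F =
      dif A B fun k => F (k + s) := dif_comp_equiv _ _ _ _
  rw [shift hAs hP, shift hBs hQ] at e1
  have e2 := dif_add_dif hA' hA hB F
  have e3 := dif_add_dif hA' hB' hB F
  have e4 := dif_sdiff_union (A := A) ∅ P (by simp) (fun k hk => ((hP k).1 hk).1) F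
  have e5 := dif_sdiff_union (A := B) ∅ Q (by simp) (fun k hk => ((hQ k).1 hk).1) F
  rw [dif_sub hA hB]
  simp only [Finset.sum_empty, sub_zero] at e4 e5
  linarith

end Sawtooth

section Largest

/-- The complement of the translated numerical semigroup generated by `s` and `t`. -/
def kappaSet (s t x : ℤ) : Set ℤ := {k | ∀ a b : ℤ, 0 ≤ a → 0 ≤ b → k ≠ x + s * a + t * b}

theorem notMem_kappaSet {s t x k : ℤ} :
    k ∉ kappaSet s t x ↔ ∃ a b : ℤ, 0 ≤ a ∧ 0 ≤ b ∧ k = x + s * a + t * b := by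
  simp [kappaSet]

theorem coreSet_left_kappaSet (s t x : ℤ) : CoreSet s (kappaSet s t x) := by
  intro k hk
  by_contra hks
  obtain ⟨a, b, ha, hb, h⟩ := notMem_kappaSet.1 hks
  exact hk (a + 1) b (by omega) hb (by linarith)

theorem coreSet_right_kappaSet (s t x : ℤ) : CoreSet t (kappaSet s t x) := by
  intro k hk
  by_contra hks
  obtain ⟨a, b, ha, hb, h⟩ := notMem_kappaSet.1 hks
  exact hk a (b + 1) ha (by omega) (by linarith)

theorem subset_kappaSet {s t x : ℤ} {A : Set ℤ} (hAs : CoreSet s A) (hAt : CoreSet t A)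
    (hx : x ∉ A) : A ⊆ kappaSet s t x := by
  rintro k hk a b ha hb rfl
  exact hAt.add_notMem (hAs.add_notMem hx ha) hb hk

variable {s t x : ℤ}

theorem symm_kappaSet (hs : 0 < s) (ht : 0 < t) (hst : IsCoprime s t)
    (hx : 2 * x + 1 = s + t - s * t) : Symm (kappaSet s t x) := by
  obtain ⟨i, j, q, hi, hj, -, -, hq⟩ := exists_coordinates hs ht hst
  refine ⟨fun k => ⟨fun hk => ?_, fun hk => ?_⟩, x + 2 * (s * t), fun k hk => ?_⟩
  · have e := hq (k - x)
    have := hi (k - x)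
    have := hj (k - x)
    have hneg : q (k - x) < 0 := by
      by_contra hge
      have h0 : 0 ≤ t * q (k - x) := mul_nonneg ht.le (not_lt.1 hge)
      exact hk (i (k - x) + t * q (k - x)) (j (k - x)) (by omega) (by omega)
        (by linear_combination e)
    rw [notMem_kappaSet]
    have h0 : 0 ≤ t * (-q (k - x) - 1) := mul_nonneg ht.le (by omega)
    exact ⟨t - 1 - i (k - x) + t * (-q (k - x) - 1), s - 1 - j (k - x), by omega, by omega,
      by linear_combination -hx - e⟩
  · intro a b ha hb he
    obtain ⟨c, d, hc, hd, h⟩ := notMem_kappaSet.1 hk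
    have h1 : s * (a + c + 1) + t * (b + d + 1) = s * t := by linarith
    have h2 : t ∣ a + c + 1 := hst.symm.dvd_of_dvd_mul_left ⟨s - (b + d + 1), by linarith⟩
    have h3 := Int.le_of_dvd (by omega) h2
    have h4 : 0 < t * (b + d + 1) := mul_pos ht (by omega)
    nlinarith
  · rw [notMem_kappaSet]
    have e := hq (k - x)
    have h1 := hi (k - x)
    have h2 := hj (k - x)
    have h0 : 0 ≤ q (k - x) := by
      by_contra hneg
      have h3 : s * i (k - x) < s * t := by nlinarith
      have h4 : t * j (k - x) < s * t := by nlinarith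
      have h5 : s * t * q (k - x) ≤ 0 :=
        mul_nonpos_of_nonneg_of_nonpos (mul_pos hs ht).le (by omega)
      linarith
    exact ⟨i (k - x) + t * q (k - x), j (k - x),
      by have := mul_nonneg ht.le h0; omega, by omega, by linear_combination e⟩

theorem eq_kappaSet (hs : 0 < s) (ht : 0 < t) (hst : IsCoprime s t)
    (hx : 2 * x + 1 = s + t - s * t) {A : Set ℤ} (hA : Symm A) (hAs : CoreSet s A)
    (hAt : CoreSet t A) (hxA : x ∉ A) : A = kappaSet s t x := by
  have hsub := subset_kappaSet hAs hAt hxA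
  refine hsub.antisymm fun k hk => ?_
  by_contra hkA
  exact ((symm_kappaSet hs ht hst hx).mem_iff k).1 hk (hsub (hA.notMem_iff.1 hkA))

theorem first_kappaSet (hs : 0 < s) (ht : 0 < t) (hst : IsCoprime s t) (k : ℤ) :
    (k ∉ kappaSet s t x ∧ k - s ∈ kappaSet s t x) ↔ ∃ j, 0 ≤ j ∧ j < s ∧ k = x + t * j := by
  constructor
  · rintro ⟨h1, h2⟩
    obtain ⟨a, b, ha, hb, h⟩ := notMem_kappaSet.1 h1
    have ha0 : a = 0 := by
      by_contra hne
      exact h2 (a - 1) b (by omega) hb (by linarith)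
    subst ha0
    refine ⟨b, hb, ?_, by linarith⟩
    by_contra hge
    exact h2 (t - 1) (b - s) (by omega) (by omega) (by linarith)
  · rintro ⟨j, hj, hjs, rfl⟩
    refine ⟨notMem_kappaSet.2 ⟨0, j, le_rfl, hj, by ring⟩, fun a b ha hb h => ?_⟩
    have h1 : t * (j - b) = s * (a + 1) := by linarith
    have h2 : s ∣ j - b := hst.dvd_of_dvd_mul_left (Dvd.intro _ h1.symm)
    have h3 : 0 < j - b := by
      by_contra hle
      nlinarith
    have := Int.le_of_dvd h3 h2
    omega

end Largest

section Maximality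

variable {s : ℕ} {t x : ℤ}

/-- The first missing elements of an `s`-core, listed in steps of `t`. -/
theorem exists_first_steps (hs : 0 < s) (hst : IsCoprime (s : ℤ) t) {A : Set ℤ} (hA : IsMaya A)
    (hAs : CoreSet s A) (hAt : CoreSet t A) :
    ∃ g : ℤ → ℤ, (∀ k, g (k + s) = g k) ∧ (∀ k, g (k + 1) ≤ g k + t) ∧ (∀ k, g k ∉ A) ∧
      ∃ P : Finset ℤ, (∀ k, k ∈ P ↔ k ∉ A ∧ k - s ∈ A) ∧
        ∀ F : ℤ → ℤ, ∑ k ∈ P, F k = ∑ i ∈ Finset.range s, F (g i) := by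
  have hs' : (0 : ℤ) < s := by exact_mod_cast hs
  obtain ⟨m, m1, m2, m3, m4, m5, m6⟩ := hAs.exists_first hs' hA
  refine ⟨fun k => m (k * t), fun k => ?_, fun k => ?_, fun k => m3 _,
    (Finset.range s).image fun i : ℕ => m (i * t), fun k => ?_, fun F => ?_⟩
  · exact apply_eq_of_dvd_sub m1 ⟨t, by ring⟩
  · have h1 := m5 _ (hAt.add_notMem (m3 (k * t)) (i := 1) (by norm_num))
    rw [apply_eq_of_dvd_sub m1 (l := (k + 1) * t) (by
      obtain ⟨c, hc⟩ := m2 (k * t); exact ⟨c, by linarith⟩)] at h1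
    linarith
  · rw [Finset.mem_image]
    constructor
    · rintro ⟨i, -, rfl⟩
      exact ⟨m3 _, m4 _⟩
    · rintro ⟨h1, h2⟩
      obtain ⟨a, b, hab⟩ := hst
      have h0 := Int.emod_nonneg (b * k) hs'.ne'
      have h3 := Int.emod_lt_of_pos (b * k) hs'
      refine ⟨(b * k % s).toNat, Finset.mem_range.2 (by omega), first_eq m1 m5 m6 h1 h2 ?_⟩
      rw [Int.toNat_of_nonneg h0]
      have := Int.emod_add_mul_ediv (b * k) s
      exact ⟨k * a + (b * k / s) * t, by linear_combination (-k) * hab - t * this⟩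
  · refine Finset.sum_image fun i hi j hj hij => ?_
    simp only [Finset.coe_range, Set.mem_Iio] at hi hj
    have h1 : (s : ℤ) ∣ (i - j) * t := by
      obtain ⟨c, hc⟩ := m2 (i * t)
      obtain ⟨d, hd⟩ := m2 (j * t)
      exact ⟨d - c, by linear_combination hd - hc + hij⟩
    have h2 := Int.eq_zero_of_abs_lt_dvd (hst.dvd_of_dvd_mul_right h1) (by rw [abs_lt]; omega)
    omega

theorem energy_lt_kappaSet (hs : 0 < s) (ht : 0 < t) (hst : IsCoprime (s : ℤ) t)
    (hx : 2 * x + 1 = s + t - s * t) {A : Set ℤ} (hA : IsMaya A)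
    (h1 : dif A (kappaSet s t x) (fun _ => 1) = 0) (hAs : CoreSet s A) (hAt : CoreSet t A)
    (hne : A ≠ kappaSet s t x) : energy A < energy (kappaSet s t x) := by
  have hs' : (0 : ℤ) < s := by exact_mod_cast hs
  have hκ := (symm_kappaSet hs' ht hst hx).isMaya
  obtain ⟨g, gs, g1, gA, P, hP, hsum⟩ := exists_first_steps hs hst hA hAs hAt
  have hQ : ∀ k, k ∈ (Finset.range s).image (fun i : ℕ => x + t * i) ↔
      k ∉ kappaSet s t x ∧ k - s ∈ kappaSet s t x := by
    intro k
    rw [first_kappaSet hs' ht hst, Finset.mem_image]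
    constructor
    · rintro ⟨i, hi, rfl⟩
      rw [Finset.mem_range] at hi
      exact ⟨i, by omega, by omega, rfl⟩
    · rintro ⟨j, h1, h2, rfl⟩
      exact ⟨j.toNat, Finset.mem_range.2 (by omega), by rw [Int.toNat_of_nonneg h1]⟩
  have hsumQ : ∀ F : ℤ → ℤ, ∑ k ∈ (Finset.range s).image (fun i : ℕ => x + t * i), F k =
      ∑ i ∈ Finset.range s, F (x + t * i) := fun F => Finset.sum_image fun i _ j _ hij => by
    have : t * ((i : ℤ) - j) = 0 := by linarith
    have := (mul_eq_zero.1 this).resolve_left ht.ne'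
    omega
  have step := dif_shift hA hκ hAs (coreSet_left_kappaSet s t x) hP hQ
  have e1 := step fun k => k
  rw [dif_congr (g := fun k => (s : ℤ) * 1) (fun k => by ring), dif_const_mul, h1, mul_zero,
    hsum, hsumQ] at e1
  have e2 := step fun k => k ^ 2
  rw [dif_congr (g := fun k => 2 * s * k + s ^ 2 * 1) (fun k => by ring), dif_add hA hκ,
    dif_const_mul, dif_const_mul, h1, mul_zero, add_zero, ← energy_sub_energy hA hκ, hsum,
    hsumQ] at e2
  have e3 := sum_range_sawtooth gs t
  have e4 := sum_range_arith s x t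
  have hdown : ∀ (k : ℤ) (d : ℕ), g (k + d) ≤ g k + d * t := by
    intro k d
    induction d with
    | zero => simp
    | succ d ih =>
      have := g1 (k + d)
      push_cast
      rw [← add_assoc]
      linarith
  have hterm : ∀ d ∈ Finset.range s, ∀ i ∈ Finset.range s,
      (g (i + d) - g i - d * t) * (g (i + d) - g i + (s - d) * t) ≤ 0 := by
    intro d hd i _
    rw [Finset.mem_range] at hd
    refine mul_nonpos_of_nonpos_of_nonneg ?_ ?_
    · have := hdown i d
      linarith
    · have := hdown (i + d) (s - d)
      rw [Nat.cast_sub hd.le, show (i : ℤ) + d + (s - d) = i + s by ring, gs] at this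
      linarith
  have hle : ∑ d ∈ Finset.range s, ∑ i ∈ Finset.range s,
      (g (i + d) - g i - d * t) * (g (i + d) - g i + (s - d) * t) ≤ 0 :=
    Finset.sum_nonpos fun d hd => Finset.sum_nonpos fun i hi => hterm d hd i hi
  have key : ∑ d ∈ Finset.range s, ∑ i ∈ Finset.range s,
      (g (i + d) - g i - d * t) * (g (i + d) - g i + (s - d) * t) =
      4 * s ^ 2 * (energy A - energy (kappaSet s t x)) := by
    rw [e3, ← e4, show ∑ i ∈ Finset.range s, g i = ∑ i ∈ Finset.range s, (x + t * (i : ℤ)) by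
      linarith]
    linear_combination (-2 * s) * e2
  have h4s : (0 : ℤ) < 4 * s ^ 2 := by positivity
  rw [key] at hle
  refine lt_of_le_of_ne (by nlinarith) fun hE => hne ?_
  rw [hE, sub_self, mul_zero] at key
  have hzero : ∀ d ∈ Finset.range s, ∀ i ∈ Finset.range s,
      (g (i + d) - g i - d * t) * (g (i + d) - g i + (s - d) * t) = 0 := by
    have h2 := (Finset.sum_eq_zero_iff_of_nonpos fun d hd =>
      Finset.sum_nonpos fun i hi => hterm d hd i hi).1 key
    intro d hd i hi
    exact (Finset.sum_eq_zero_iff_of_nonpos fun i hi => hterm d hd i hi).1 (h2 d hd) i hi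
  obtain ⟨i, hi, hmin⟩ := Finset.exists_min_image (Finset.range s) (fun i : ℕ => g i)
    ⟨0, Finset.mem_range.2 hs⟩
  have hmin' : ∀ k : ℤ, g i ≤ g k := fun k => by
    have h0 := Int.emod_nonneg k hs'.ne'
    have h3 := Int.emod_lt_of_pos k hs'
    have := hmin (k % s).toNat (Finset.mem_range.2 (by omega))
    rw [Int.toNat_of_nonneg h0] at this
    rwa [apply_eq_of_dvd_sub gs (k := k) (l := k % s)
      ⟨k / s, by have := Int.emod_add_mul_ediv k s; linarith⟩]
  have hsaw : ∀ d ∈ Finset.range s, g ((d : ℤ) + i) = g i + t * d := by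
    intro d hd
    have h2 := hmin' (i + d)
    have h3 := Finset.mem_range.1 hd
    rcases mul_eq_zero.1 (hzero d hd i hi) with h | h
    · rw [add_comm]
      linarith
    · have : 0 < ((s : ℤ) - d) * t := mul_pos (by omega) ht
      omega
  have hgx : g i = x := by
    have h2 := sum_range_add gs i
    rw [Finset.sum_congr rfl hsaw, show ∑ i ∈ Finset.range s, g i =
      ∑ i ∈ Finset.range s, (x + t * (i : ℤ)) by linarith, Finset.sum_add_distrib,
      Finset.sum_add_distrib, add_left_inj, Finset.sum_const, Finset.sum_const, Finset.card_range,
      nsmul_eq_mul, nsmul_eq_mul] at h2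
    exact mul_left_cancel₀ hs'.ne' h2
  have hsub := subset_kappaSet hAs hAt (hgx ▸ gA i)
  refine hsub.antisymm fun k hk => ?_
  by_contra hkA
  rw [dif_comm, neg_eq_zero] at h1
  refine absurd h1 (finsum_pos_of_support_finite (x := k) (hκ.support_mul_finite hA _)
    (fun l => ?_) ?_).ne'
  · rw [mul_one, sub_nonneg]
    exact ind_le_ind fun hl => hsub hl
  · rw [ind_of_mem hk, ind_of_notMem hkA]
    norm_num

end Maximality

section Translation

theorem dif_betaSet_transpose (μ ν : YoungDiagram) (u : ℤ → ℤ) :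
    dif (betaSet μ.transpose) (betaSet ν.transpose) u =
      -dif (betaSet μ) (betaSet ν) fun k => u (-1 - k) := by
  have h : ∀ (ρ : YoungDiagram) (k : ℤ),
      ind (betaSet ρ.transpose) k = 1 - ind (betaSet ρ) (-1 - k) := by
    intro ρ k
    by_cases hk : k ∈ betaSet ρ.transpose
    · rw [ind_of_mem hk, ind_of_notMem (mem_betaSet_transpose.1 hk)]
      ring
    · rw [ind_of_notMem hk, ind_of_mem (not_not.1 fun h => hk (mem_betaSet_transpose.2 h))]
      ring
  unfold dif
  rw [← finsum_neg_distrib, ← finsum_comp_equiv (Equiv.subLeft (-1 : ℤ))]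
  refine finsum_congr fun k => ?_
  simp only [Equiv.subLeft_apply, h, show -1 - (-1 - k) = k by ring]
  ring

theorem SelfConjugate.core {s : ℕ} (hs : 0 < s) {μ : YoungDiagram} (h : SelfConjugate μ) :
    SelfConjugate (core s μ) := by
  obtain ⟨h1, h2, -⟩ := core_spec s μ
  have h3 : IsCore s (CorePartitions.core s μ).transpose := by
    rw [isCore_iff hs] at h1 ⊢
    intro k hk
    rw [mem_betaSet_transpose] at hk ⊢
    intro hmem
    have := h1 _ hmem
    rw [show -1 - (k - s) - s = -1 - k by ring] at this
    exact hk this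
  refine ((core_eq_iff hs h3).2 fun u hu => ?_).symm
  have h4 := dif_betaSet_transpose μ (CorePartitions.core s μ) u
  have h5 := h2.symm (fun k => u (-1 - k)) fun k => by
    have := hu (-1 - k - s)
    rw [sub_add_cancel] at this
    rw [this]
    congr 1
    ring
  rw [show μ.transpose = μ from h, h5, neg_zero] at h4
  exact h4

variable {s t : ℕ}

/-- Self-conjugate partitions with given cores correspond to symmetric sets. -/
theorem existsUnique_partition_iff (hs : 0 < s) (ht : 0 < t) {σ τ : YoungDiagram}
    (hσ : IsCore s σ) (hτ : IsCore t τ) (n : ℕ) :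
    (∃! μ : YoungDiagram, μ ∈ partitionsWithCores s t n σ τ ∧ SelfConjugate μ) ↔
      ∃! B, B ∈ Sol s t (betaSet σ) (betaSet τ) n := by
  have key : ∀ μ : YoungDiagram, (μ ∈ partitionsWithCores s t n σ τ ∧ SelfConjugate μ) ↔
      betaSet μ ∈ Sol s t (betaSet σ) (betaSet τ) n := fun μ => by
    simp only [partitionsWithCores, Sol, Set.mem_ofPred_eq, core_eq_iff hs hσ, core_eq_iff ht hτ,
      selfConjugate_iff, energy_betaSet, Nat.cast_inj]
    tauto
  simp only [key]
  constructor
  · rintro ⟨μ, h1, h2⟩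
    refine ⟨betaSet μ, h1, fun B hB => ?_⟩
    obtain ⟨ν, rfl⟩ := hB.1.exists_betaSet_eq
    rw [h2 ν hB]
  · rintro ⟨B, h1, h2⟩
    obtain ⟨μ, rfl⟩ := h1.1.exists_betaSet_eq
    exact ⟨μ, h1, fun ν hν => betaSet_injective (h2 _ hν)⟩

theorem exists_shuffle_core (hs : 1 < s) (ht : 1 < t) (hst : IsCoprime (s : ℤ) t)
    {σ : YoungDiagram} (hσ : IsCore s σ) (hσ' : SelfConjugate σ) :
    ∃ e, Shuffle s t e ∧ e ⁻¹' betaSet σ = betaSet (core t σ) := by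
  rw [selfConjugate_iff] at hσ'
  rw [isCore_iff (by omega)] at hσ
  obtain ⟨e, he, h1, h2⟩ := exists_shuffle (by exact_mod_cast hs) (by exact_mod_cast ht) hst hσ' hσ
  obtain ⟨h3, h4, -⟩ := core_spec t σ
  rw [isCore_iff (by omega)] at h3
  have hM := he.symm_preimage hσ'
  exact ⟨e, he, CoreSet.eq_of_sameCharge (s := t) (by omega) hM.isMaya (isMaya_betaSet _) h2 h3
    ((he.charge _ hσ').trans hM.isMaya hσ'.isMaya (isMaya_betaSet _) h4.symm)⟩

theorem coreSet_core (hs : 1 < s) (ht : 1 < t) (hst : IsCoprime (s : ℤ) t) {σ : YoungDiagram}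
    (hσ : IsCore s σ) (hσ' : SelfConjugate σ) : CoreSet s (betaSet (core t σ)) := by
  obtain ⟨e, he, h⟩ := exists_shuffle_core hs ht hst hσ hσ'
  rw [← h]
  exact ((isCore_iff (by omega)).1 hσ).preimage he

/-- Reduction to data consisting of simultaneous cores. -/
theorem existsUnique_core_iff (hs : 1 < s) (ht : 1 < t) (hst : IsCoprime (s : ℤ) t)
    {σ τ : YoungDiagram} (hσ : IsCore s σ) (hτ : IsCore t τ) (hσ' : SelfConjugate σ)
    (hτ' : SelfConjugate τ) (n : ℤ) :
    (∃! B, B ∈ Sol s t (betaSet σ) (betaSet τ) n) ↔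
      ∃! B, B ∈ Sol s t (betaSet (core t σ)) (betaSet (core s τ))
        (n - t * weight t σ - s * weight s τ) := by
  obtain ⟨e, he, h1⟩ := exists_shuffle_core hs ht hst hσ hσ'
  obtain ⟨f, hf, h2⟩ := exists_shuffle_core ht hs hst.symm hτ hτ'
  have hσc := selfConjugate_iff.1 (hσ'.core (s := t) (by omega))
  have eσ := (core_spec t σ).2.2
  have eτ := (core_spec s τ).2.2
  rw [selfConjugate_iff] at hσ' hτ'
  rw [he.existsUnique_iff hσ' hτ', h1, Sol_swap, hf.existsUnique_iff hτ' hσc, h2, Sol_swap,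
    energy_betaSet, energy_betaSet, energy_betaSet, energy_betaSet, eσ, eτ]
  push_cast
  rw [show n + ((core t σ).card : ℤ) - ((core t σ).card + t * weight t σ) + (core s τ).card -
    ((core s τ).card + s * weight s τ) = n - t * weight t σ - s * weight s τ by ring]

theorem isLargestCore_iff (hs : 0 < s) (ht : 0 < t) (hst : IsCoprime (s : ℤ) t) {x : ℤ}
    (hx : 2 * x + 1 = s + t - s * t) {κ : YoungDiagram} :
    IsLargestCore s t κ ↔ betaSet κ = kappaSet s t x := by
  have hs' : (0 : ℤ) < s := by exact_mod_cast hs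
  have ht' : (0 : ℤ) < t := by exact_mod_cast ht
  obtain ⟨ν, hν⟩ := (symm_kappaSet hs' ht' hst hx).exists_betaSet_eq
  have hmax : ∀ μ : YoungDiagram, IsCore s μ → IsCore t μ → μ ≠ ν → μ.card < ν.card := by
    intro μ h1 h2 hne
    rw [isCore_iff hs] at h1
    rw [isCore_iff ht] at h2
    have := energy_lt_kappaSet hs ht' hst hx (isMaya_betaSet μ) (by
      rw [← hν, ← dif_add_dif (isMaya_betaSet μ) isMaya_Iio (isMaya_betaSet ν), dif_betaSet_one,
        dif_comm, dif_betaSet_one, neg_zero, add_zero]) h1 h2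
      (fun he => hne (betaSet_injective (he.trans hν.symm)))
    rw [← hν, energy_betaSet, energy_betaSet] at this
    exact_mod_cast this
  have hνs : IsCore s ν := by
    rw [isCore_iff hs, hν]
    exact coreSet_left_kappaSet _ _ _
  have hνt : IsCore t ν := by
    rw [isCore_iff ht, hν]
    exact coreSet_right_kappaSet _ _ _
  rw [← hν, betaSet_injective.eq_iff]
  constructor
  · intro h
    by_contra hne
    exact (hmax κ h.left_core h.right_core hne).asymm (h.card_lt ν hνs hνt (Ne.symm hne))
  · rintro rfl
    exact ⟨hνs, hνt, hmax⟩

theorem isLargestCore_iff_notMem (hs : 0 < s) (ht : 0 < t) (hst : IsCoprime (s : ℤ) t)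
    (hos : Odd s) (hot : Odd t) {κ : YoungDiagram} (hκ : SelfConjugate κ)
    (hκs : CoreSet s (betaSet κ)) (hκt : CoreSet t (betaSet κ)) :
    IsLargestCore s t κ ↔ ∀ x : ℤ, 2 * x + 1 = s + t - s * t → x ∉ betaSet κ := by
  obtain ⟨x, hx⟩ : ∃ x : ℤ, 2 * x + 1 = s + t - s * t := by
    obtain ⟨v, rfl⟩ := hos
    obtain ⟨w, rfl⟩ := hot
    exact ⟨-2 * v * w, by push_cast; ring⟩
  rw [isLargestCore_iff hs ht hst hx]
  constructor
  · intro h y hy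
    rw [h, notMem_kappaSet]
    exact ⟨0, 0, le_rfl, le_rfl, by linarith⟩
  · intro h
    exact eq_kappaSet (by exact_mod_cast hs) (by exact_mod_cast ht) hst hx
      (selfConjugate_iff.1 hκ) hκs hκt (h x hx)

end Translation

end CorePartitions

open CorePartitions in
theorem theorem5p15 (s t : ℕ) (hs : 1 < s) (ht : 1 < t) (hst : Nat.Coprime s t)
    (σ τ : YoungDiagram) (hσ : IsCore s σ) (hτ : IsCore t τ) (n : ℕ) :
    (∃! μ : YoungDiagram, μ ∈ partitionsWithCores s t n σ τ ∧ SelfConjugate μ) ↔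
      SelfConjugate σ ∧ SelfConjugate τ ∧
        ((core t σ = core s τ ∧ (n : ℤ) = σ.card + τ.card - (core t σ).card) ∨
          (Odd t ∧ SingleFlip s t (core t σ) (core s τ) ∧
            n = τ.card + t * (weight t σ + 1)) ∨
          (Odd s ∧ SingleFlip t s (core s τ) (core t σ) ∧
            n = σ.card + s * (weight s τ + 1)) ∨
          (Odd s ∧ Odd t ∧ ∃ υ : YoungDiagram, DoubleFlip s t (core t σ) (core s τ) υ ∧
            n = υ.card + s * (weight s τ + 1) + t * (weight t σ + 1)) ∨
          (Odd s ∧ Odd t ∧ ∃ κ : YoungDiagram, IsLargestCore s t κ ∧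
            core t σ = κ ∧ core s τ = κ ∧
            (n : ℤ) = σ.card + τ.card - κ.card + s * t)) := by
  have hst' : IsCoprime (s : ℤ) t := Nat.isCoprime_iff_coprime.2 hst
  have hs1 : (1 : ℤ) < s := by exact_mod_cast hs
  have ht1 : (1 : ℤ) < t := by exact_mod_cast ht
  have hconj : (∃! μ : YoungDiagram, μ ∈ partitionsWithCores s t n σ τ ∧ SelfConjugate μ) →
      SelfConjugate σ ∧ SelfConjugate τ := by
    rintro ⟨μ, ⟨⟨-, rfl, rfl⟩, h⟩, -⟩
    exact ⟨h.core (by omega), h.core (by omega)⟩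
  rw [← and_assoc]
  refine (and_iff_right_of_imp hconj).symm.trans (and_congr_right fun ⟨hσ', hτ'⟩ => ?_)
  have hα := hσ'.core (s := t) (by omega)
  have hβ := hτ'.core (s := s) (by omega)
  have hαs := coreSet_core hs ht hst' hσ hσ'
  have hβt := coreSet_core ht hs hst'.symm hτ hτ'
  have hαt := (isCore_iff (by omega)).1 (core_spec t σ).1
  have hβs := (isCore_iff (by omega)).1 (core_spec s τ).1
  have eσ : (σ.card : ℤ) = (core t σ).card + t * weight t σ := by
    exact_mod_cast (core_spec t σ).2.2
  have eτ : (τ.card : ℤ) = (core s τ).card + s * weight s τ := by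
    exact_mod_cast (core_spec s τ).2.2
  rw [existsUnique_partition_iff (by omega) (by omega) hσ hτ,
    existsUnique_core_iff hs ht hst' hσ hτ hσ' hτ', existsUnique_iff_exceptional hs1 ht1 hst'
      (selfConjugate_iff.1 hα) (selfConjugate_iff.1 hβ) hαs hαt hβs hβt]
  have hos : Odd (s : ℤ) ↔ Odd s := Int.odd_coe_nat s
  have hot : Odd (t : ℤ) ↔ Odd t := Int.odd_coe_nat t
  unfold Exceptional
  rw [hos, hot, energy_betaSet, energy_betaSet, betaSet_injective.eq_iff]
  refine or_congr (and_congr_right fun h => ?_) (or_congr (and_congr_right fun _ =>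
    and_congr Iff.rfl ?_) (or_congr (and_congr_right fun _ => and_congr Iff.rfl ?_) (or_congr
    (and_congr_right fun _ => and_congr_right fun _ => ?_)
    (and_congr_right fun h1 => and_congr_right fun h2 => ?_))))
  · rw [eσ, eτ, h]
    constructor <;> intro h <;> linarith
  · rw [← Nat.cast_inj (R := ℤ)]
    push_cast
    rw [eτ]
    constructor <;> intro h <;> linarith
  · rw [← Nat.cast_inj (R := ℤ)]
    push_cast
    rw [eσ]
    constructor <;> intro h <;> linarith
  · constructor
    · rintro ⟨b, c, h, hn⟩
      obtain ⟨υ, hυ⟩ := ((selfConjugate_iff.1 hβ).flip_one h.right_mem.1).exists_betaSet_eq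
      rw [flip_singleton] at hυ
      refine ⟨υ, ⟨b, c, ⟨h.1, h.2, h.3, h.4, h.5, h.6⟩, hυ⟩, ?_⟩
      rw [← hυ, energy_betaSet] at hn
      rw [← Nat.cast_inj (R := ℤ)]
      push_cast
      linarith
    · rintro ⟨υ, ⟨b, c, h, hυ⟩, hn⟩
      refine ⟨b, c, ⟨h.1, h.2, h.3, h.4, h.5, h.6⟩, ?_⟩
      rw [← hυ, energy_betaSet, hn]
      push_cast
      ring
  · rw [← isLargestCore_iff_notMem (by omega) (by omega) hst' h1 h2 hα hαs hαt]
    constructor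
    · rintro ⟨h3, h4, h5⟩
      exact ⟨_, h3, rfl, h4.symm, by rw [eσ, eτ, ← h4]; linarith⟩
    · rintro ⟨κ, h3, rfl, h4, h5⟩
      exact ⟨h3, h4.symm, by rw [eσ, eτ, h4] at h5; linarith⟩
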